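/- Let $d\ge 1$, $\alpha\in(0,2)$, $p>1$, $m>0$, $\gamma>1$ and $p'=\frac{p}{p-1}$. For each $\varepsilon>0$ let the kernel $\Lambda^\varepsilon:\mathbb R^d\times\mathbb R^d\to(0,\infty)$ be given in one of the following two ways. (P1) $\Lambda^\varepsilon(x,y)=\lambda(x/\varepsilon)\,\mu(y/\varepsilon)$, where $\lambda,\mu:\mathbb R^d\to\mathbb R$ are measurable, $1$-periodic in each coordinate direction, and take values in $[\gamma^{-1},\gamma]$. In this case put $\nu^\varepsilon(x)=\mu(x/\varepsilon)/\lambda(x/\varepsilon)$ and $$\Lambda^{\rm eff}(x,y)=\Big(\int_{[0,1]^d}\frac{\mu(\xi)}{\lambda(\xi)}\,d\xi\Big)^{-1}\Big(\int_{[0,1]^d}\mu(\xi)\,d\xi\Big)^2 .$$ (P2) $\Lambda^\varepsilon(x,y)=\Lambda(x,y,x/\varepsilon,y/\varepsilon)$, where $\Lambda(x,y,\xi,\eta)$ is continuous in $(x,y)$ for all fixed $(\xi,\eta)$, is measurable in $(\xi,\eta)$ for all fixed $(x,y)$, is $1$-periodic in each coordinate direction of $\xi$ and of $\eta$, takes values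 in $[\gamma^{-1},\gamma]$, and satisfies $\Lambda(x,y,\xi,\eta)=\Lambda(y,x,\eta,\xi)$ for all $x,y,\xi,\eta\in\mathbb R^d$. In this case put $\nu^\varepsilon=1$ and $$\Lambda^{\rm eff}(x,y)=\int_{[0,1]^d}\int_{[0,1]^d}\Lambda(x,y,\xi,\eta)\,d\xi\,d\eta .$$ Let $W^{\alpha/p,p}(\mathbb R^d)$ be the space of all $u\in L^p(\mathbb R^d)$ with $[u]^p=\iint\frac{|u(y)-u(x)|^p}{|x-y|^{d+\alpha}}\,dx\,dy<\infty$, with norm $(\|u\|_{L^p}^p+[u]^p)^{1/p}$. (For $\alpha<p$ this is the usual fractional Sobolev space; for $\alpha\ge p$ it is $\{0\}$ and the assertion below is trivial.) For a measurable kernel $A(x,y)$ and a weight $\nu(x)$, both bounded above and below by positive constants, with $\nu(x)A(x,y)$ symmetric in $(x,y)$, a (weak) solution of $$\int_{\mathbb R^d}\frac{|u(y)-u(x)|^{p-2}(u(y)-u(x))}{|x-y|^{d+\alpha}}A(x,y)\,dy-m|u(x)|^{p-2}u(x)=f(x)\qquad(x\in\mathbb R^d)$$ with respect to $\nu$ is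 a function $u\in W^{\alpha/p,p}(\mathbb R^d)$ such that for all $v\in W^{\alpha/p,p}(\mathbb R^d)$ $$-\frac12\iint\frac{|u(y)-u(x)|^{p-2}(u(y)-u(x))(v(y)-v(x))}{|x-y|^{d+\alpha}}\,\nu(x)A(x,y)\,dx\,dy-m\int|u|^{p-2}u\,v\,\nu\,dx=\int f\,v\,\nu\,dx .$$ Then for every $f\in L^{p'}(\mathbb R^d)$ and every $\varepsilon>0$ this equation with $A=\Lambda^\varepsilon$, $\nu=\nu^\varepsilon$ has a unique solution $u^\varepsilon$; the equation with $A=\Lambda^{\rm eff}$, $\nu=1$ has a unique solution $u^0$; and, as $\varepsilon\to0^+$, $u^\varepsilon\to u^0$ strongly in $L^p(\mathbb R^d)$ and weakly in $W^{\alpha/p,p}(\mathbb R^d)$. -/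

import Mathlib

open MeasureTheory Filter Topology

noncomputable section

namespace NonlocalHomogenization

/-- `ℝ^d` with the Euclidean norm and Lebesgue measure. -/
abbrev Rd (d : ℕ) : Type := EuclideanSpace ℝ (Fin d)

/-- The unit cube `[0,1]^d`. -/
def unitCube (d : ℕ) : Set (Rd d) := {ξ | ∀ i, ξ i ∈ Set.Icc (0 : ℝ) 1}

/-- `1`-periodicity in each coordinate direction. -/
def UnitPeriodic {d : ℕ} (g : Rd d → ℝ) : Prop :=
  ∀ (i : Fin d) (ξ : Rd d), g (ξ + EuclideanSpace.single i 1) = g ξ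

/-- The two kinds of oscillating coefficients: a product `lam (x/ε) * mu (y/ε)`, or a locally
periodic function `Λ (x, y, x/ε, y/ε)`. -/
inductive Coefficient (d : ℕ) : Type
  | product (lam mu : Rd d → ℝ) : Coefficient d
  | locallyPeriodic (Λ : Rd d → Rd d → Rd d → Rd d → ℝ) : Coefficient d

/-- The assumptions on the coefficients, with ellipticity constant `γ`.
`AEMeasurable` with respect to Lebesgue measure is Lebesgue measurability. -/
def Coefficient.Admissible {d : ℕ} (γ : ℝ) : Coefficient d → Prop
  | .product lam mu =>
      AEMeasurable lam volume ∧ AEMeasurable mu volume ∧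
      UnitPeriodic lam ∧ UnitPeriodic mu ∧
      (∀ ξ, γ⁻¹ ≤ lam ξ ∧ lam ξ ≤ γ) ∧ (∀ η, γ⁻¹ ≤ mu η ∧ mu η ≤ γ)
  | .locallyPeriodic Λ =>
      (∀ ξ η, Continuous fun z : Rd d × Rd d => Λ z.1 z.2 ξ η) ∧
      (∀ x y, AEMeasurable (fun w : Rd d × Rd d => Λ x y w.1 w.2) volume) ∧
      (∀ x y η, UnitPeriodic fun ξ => Λ x y ξ η) ∧
      (∀ x y ξ, UnitPeriodic fun η => Λ x y ξ η) ∧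
      (∀ x y ξ η, Λ x y ξ η = Λ y x η ξ) ∧
      (∀ x y ξ η, γ⁻¹ ≤ Λ x y ξ η ∧ Λ x y ξ η ≤ γ)

/-- The kernel `Λ^ε (x, y)`. -/
def Coefficient.kernel {d : ℕ} (ε : ℝ) : Coefficient d → Rd d → Rd d → ℝ
  | .product lam mu => fun x y => lam (ε⁻¹ • x) * mu (ε⁻¹ • y)
  | .locallyPeriodic Λ => fun x y => Λ x y (ε⁻¹ • x) (ε⁻¹ • y)

/-- The weight `ν^ε` for which `ν^ε (x) Λ^ε (x, y)` is symmetric in `x, y`: it is `μ/λ` at `x/ε`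
for product coefficients and `1` for (symmetric) locally periodic ones. -/
def Coefficient.weight {d : ℕ} (ε : ℝ) : Coefficient d → Rd d → ℝ
  | .product lam mu => fun x => mu (ε⁻¹ • x) / lam (ε⁻¹ • x)
  | .locallyPeriodic _ => fun _ => 1

/-- The effective kernel `Λ^eff (x, y)`. -/
def Coefficient.effective {d : ℕ} : Coefficient d → Rd d → Rd d → ℝ
  | .product lam mu => fun _ _ =>
      (∫ ξ in unitCube d, mu ξ / lam ξ)⁻¹ * (∫ ξ in unitCube d, mu ξ) ^ 2
  | .locallyPeriodic Λ => fun x y =>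
      ∫ η in unitCube d, ∫ ξ in unitCube d, Λ x y ξ η

/-- The Gagliardo energy `∬ |u(y) - u(x)|^p / |x - y|^(d + α) dx dy`, a value in `[0, ∞]`. -/
def gagliardoEnergy {d : ℕ} (α p : ℝ) (u : Rd d → ℝ) : ENNReal :=
  ∫⁻ z : Rd d × Rd d, ENNReal.ofReal (|u z.2 - u z.1| ^ p / ‖z.1 - z.2‖ ^ ((d : ℝ) + α))

lemma gagliardoEnergy_congr {d : ℕ} (α p : ℝ) {u v : Rd d → ℝ} (h : u =ᵐ[volume] v) :
    gagliardoEnergy α p u = gagliardoEnergy α p v := by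
  refine lintegral_congr_ae ?_
  have h1 : ∀ᵐ z : Rd d × Rd d, u z.1 = v z.1 := Measure.quasiMeasurePreserving_fst.ae h
  have h2 : ∀ᵐ z : Rd d × Rd d, u z.2 = v z.2 := Measure.quasiMeasurePreserving_snd.ae h
  filter_upwards [h1, h2] with z hz1 hz2
  rw [hz1, hz2]

lemma gagliardoEnergy_add_lt_top {d : ℕ} (α : ℝ) {p : ℝ} (hp : 1 < p) {u v : Rd d → ℝ}
    (hum : AEStronglyMeasurable u volume)
    (hu : gagliardoEnergy α p u < ⊤) (hv : gagliardoEnergy α p v < ⊤) :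
    gagliardoEnergy α p (u + v) < ⊤ := by
  have hmeas : AEMeasurable (fun z : Rd d × Rd d =>
      ENNReal.ofReal (|u z.2 - u z.1| ^ p / ‖z.1 - z.2‖ ^ ((d : ℝ) + α))) volume := by
    have h1 : AEMeasurable (fun z : Rd d × Rd d => u z.1) volume :=
      hum.aemeasurable.comp_quasiMeasurePreserving Measure.quasiMeasurePreserving_fst
    have h2 : AEMeasurable (fun z : Rd d × Rd d => u z.2) volume :=
      hum.aemeasurable.comp_quasiMeasurePreserving Measure.quasiMeasurePreserving_snd
    have h3 : AEMeasurable (fun z : Rd d × Rd d => |u z.2 - u z.1| ^ p) volume :=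
      (measurable_norm.comp_aemeasurable (h2.sub h1)).pow_const p
    exact (h3.div (by fun_prop)).ennreal_ofReal
  have key : gagliardoEnergy α p (u + v) ≤
      ENNReal.ofReal (2 ^ (p - 1)) * (gagliardoEnergy α p u + gagliardoEnergy α p v) := by
    unfold gagliardoEnergy
    rw [← lintegral_add_left' hmeas, ← lintegral_const_mul' _ _ ENNReal.ofReal_ne_top]
    refine lintegral_mono fun z => ?_
    rw [← ENNReal.ofReal_add (by positivity) (by positivity),
      ← ENNReal.ofReal_mul (by positivity)]
    refine ENNReal.ofReal_le_ofReal ?_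
    rw [← add_div, ← mul_div_assoc]
    refine div_le_div_of_nonneg_right ?_ (by positivity)
    have h1 : |(u + v) z.2 - (u + v) z.1| ≤ |u z.2 - u z.1| + |v z.2 - v z.1| := by
      have : (u + v) z.2 - (u + v) z.1 = (u z.2 - u z.1) + (v z.2 - v z.1) := by
        simp only [Pi.add_apply]; ring
      rw [this]
      exact abs_add_le _ _
    calc |(u + v) z.2 - (u + v) z.1| ^ p
        ≤ (|u z.2 - u z.1| + |v z.2 - v z.1|) ^ p :=
          Real.rpow_le_rpow (abs_nonneg _) h1 (by linarith)
      _ ≤ 2 ^ (p - 1) * (|u z.2 - u z.1| ^ p + |v z.2 - v z.1| ^ p) :=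
          mod_cast NNReal.rpow_add_le_mul_rpow_add_rpow
            ⟨|u z.2 - u z.1|, abs_nonneg _⟩ ⟨|v z.2 - v z.1|, abs_nonneg _⟩ hp.le
  exact key.trans_lt (ENNReal.mul_lt_top ENNReal.ofReal_lt_top (ENNReal.add_lt_top.2 ⟨hu, hv⟩))

lemma gagliardoEnergy_smul {d : ℕ} (α p : ℝ) (c : ℝ) (u : Rd d → ℝ) :
    gagliardoEnergy α p (c • u) = ENNReal.ofReal (|c| ^ p) * gagliardoEnergy α p u := by
  unfold gagliardoEnergy
  rw [← lintegral_const_mul' _ _ ENNReal.ofReal_ne_top]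
  refine lintegral_congr fun z => ?_
  rw [← ENNReal.ofReal_mul (by positivity), ← mul_div_assoc,
    ← Real.mul_rpow (abs_nonneg _) (abs_nonneg _), ← abs_mul, mul_sub]
  rfl

lemma gagliardoEnergy_zero {d : ℕ} (α : ℝ) {p : ℝ} (hp : 1 < p) :
    gagliardoEnergy α p (0 : Rd d → ℝ) = 0 := by
  simp [gagliardoEnergy, Real.zero_rpow (by linarith : p ≠ 0)]

/-- The fractional Sobolev space `W^{α/p,p}(ℝ^d)`: the `u ∈ L^p(ℝ^d)` of finite Gagliardo energy
(the exponent `d + α` is `d + s * p` with `s = α / p`). For `α ≥ p` this space is `{0}`. -/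
def Sobolev (d : ℕ) (α p : ℝ) (hp : 1 < p) :
    Submodule ℝ (Lp ℝ (ENNReal.ofReal p) (volume : Measure (Rd d))) where
  carrier := {u | gagliardoEnergy α p u < ⊤}
  add_mem' {u v} hu hv := by
    rw [Set.mem_ofPred_eq, gagliardoEnergy_congr α p (Lp.coeFn_add u v)]
    exact gagliardoEnergy_add_lt_top α hp (Lp.aestronglyMeasurable u) hu hv
  zero_mem' := by
    rw [Set.mem_ofPred_eq, gagliardoEnergy_congr α p (Lp.coeFn_zero _ _ _),
      gagliardoEnergy_zero α hp]
    exact ENNReal.zero_lt_top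
  smul_mem' c u hu := by
    rw [Set.mem_ofPred_eq, gagliardoEnergy_congr α p (Lp.coeFn_smul c u), gagliardoEnergy_smul]
    exact ENNReal.mul_lt_top ENNReal.ofReal_lt_top hu

/-- The norm of `W^{α/p,p}(ℝ^d)`. -/
def sobolevNorm {d : ℕ} {α p : ℝ} {hp : 1 < p} (u : Sobolev d α p hp) : ℝ :=
  (‖u.1‖ ^ p + (gagliardoEnergy α p u.1).toReal) ^ (1 / p)

/-- Weak convergence in `W^{α/p,p}(ℝ^d)`: convergence under every bounded linear functional. -/
def WeakTendsto {ι : Type*} {d : ℕ} {α p : ℝ} {hp : 1 < p}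
    (u : ι → Sobolev d α p hp) (l : Filter ι) (u₀ : Sobolev d α p hp) : Prop :=
  ∀ ℓ : Sobolev d α p hp →ₗ[ℝ] ℝ, (∃ C : ℝ, ∀ v, |ℓ v| ≤ C * sobolevNorm v) →
    Tendsto (fun i => ℓ (u i)) l (𝓝 (ℓ u₀))

/-- The function `t ↦ |t|^(p-2) t` (with value `0` at `0`). -/
def signedPow (p t : ℝ) : ℝ := |t| ^ (p - 2) * t

/-- The form
`½ ∬ a(x,y) |u(y)-u(x)|^(p-2) (u(y)-u(x)) (v(y)-v(x)) / |x-y|^(d+α) dx dy`. -/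
def energyForm {d : ℕ} (α p : ℝ) (a : Rd d → Rd d → ℝ) (u v : Rd d → ℝ) : ℝ :=
  (1 / 2) * ∫ z : Rd d × Rd d,
    a z.1 z.2 * signedPow p (u z.2 - u z.1) * (v z.2 - v z.1) / ‖z.1 - z.2‖ ^ ((d : ℝ) + α)

/-- `u ∈ W^{α/p,p}` is a weak solution of `L u - m |u|^(p-2) u = f`, where
`L u (x) = ∫ |u(y)-u(x)|^(p-2) (u(y)-u(x)) |x-y|^(-d-α) Λ(x,y) dy` and `ν` is a weight for which
`ν(x) Λ(x,y)` is symmetric. The equation is multiplied by `v ν` and integrated; by the symmetry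
of `ν(x) Λ(x,y)`, the pairing of `L u` with `v ν` is minus the energy form with coefficient
`ν(x) Λ(x,y)`. -/
def IsWeakSolution {d : ℕ} {α p : ℝ} {hp : 1 < p} (m : ℝ) (Λ : Rd d → Rd d → ℝ) (ν : Rd d → ℝ)
    (f : Rd d → ℝ) (u : Sobolev d α p hp) : Prop :=
  ∀ v : Sobolev d α p hp,
    -energyForm α p (fun x y => ν x * Λ x y) u.1 v.1
      - m * ∫ x, signedPow p (u.1 x) * v.1 x * ν x = ∫ x, f x * v.1 x * ν x

end NonlocalHomogenization

end

noncomputable section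

namespace NonlocalHomogenization

/-! ### Pointwise inequalities for powers -/

/-! Multiplication by the weight makes the problem variational: the weak equation is the
Euler-Lagrange equation of a strictly convex functional whose coefficients, `ν` and `ν Λ`, enter
linearly. No corrector is needed. The coefficients multiply `u` and its differences `u y - u x`, and
at the limit function these are fixed, so weak-* limits of `ν^ε` and `ν^ε Λ^ε` determine the limit
problem. For products, `ν^ε Λ^ε` is `μ(x/ε) μ(y/ε)`, with limit `(∫ μ)^2`, and `ν^ε` tends to the
constant `n₀ = ∫ μ/λ`; division by `n₀` gives the effective kernel. In the locally periodic case
`ν^ε = 1` and `Λ^ε` tends to its mean over the fast variables. Both limits come from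
`IsOscillating.tendsto_integral`.

The map `u ↦ (u, u y - u x)` embeds the Sobolev space isometrically, with closed range, into `L^p`
of a disjoint union (`isClosed_range_sobolevEmbedding`). There the equation reads `∫ w |Du|^(p-2) Du
Dv = ℓ v`. Uniform convexity, obtained for every `p > 1` from `abs_sub_rpow_le_midpointDefect`,
makes minimizing sequences Cauchy and gives solvability (`existsUnique_weightedForm_eq`).

For convergence, both equations are tested with `v = u^ε - u⁰`. Monotonicity bounds the convexity
defect of `u^ε` and `u⁰` by the error of the coefficients and of the source, evaluated at the fixed
`u⁰` and tested with `v` (`tendsto_of_weightedForm_eq`). Since `v` varies with `ε`, weak-*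
convergence must act uniformly for `v` in bounded sets of the Sobolev space. This is the role of
local compactness, made quantitative in `eventually_abs_integral_le`: passing to averages over balls
of radius `r` costs only `r^(α/p)` times the norm of `v`, and for fixed `r` the averages of the
coefficient error tend to zero strongly. The outcome, `tendsto_sobolev_of_weakStar`, is convergence
in the Sobolev norm, which contains both asserted modes of convergence. -/

lemma abs_signedPow {p : ℝ} (hp : 1 < p) (t : ℝ) : |signedPow p t| = |t| ^ (p - 1) := by
  rcases eq_or_ne t 0 with rfl | ht
  · simp [signedPow, Real.zero_rpow (by linarith : p - 1 ≠ 0)]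
  · have h : 0 < |t| := abs_pos.2 ht
    rw [signedPow, abs_mul, abs_of_nonneg (by positivity : 0 ≤ |t| ^ (p - 2))]
    nth_rewrite 2 [← Real.rpow_one |t|]
    rw [← Real.rpow_add h]
    congr 1; ring

lemma signedPow_mul_self {p : ℝ} (hp : 1 < p) (t : ℝ) : signedPow p t * t = |t| ^ p := by
  rcases eq_or_ne t 0 with rfl | ht
  · simp [Real.zero_rpow (by linarith : p ≠ 0)]
  · have h : 0 < |t| := abs_pos.2 ht
    rw [signedPow, mul_assoc, ← abs_mul_abs_self, ← mul_assoc]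
    have := Real.rpow_add h (p - 2) 2
    rw [Real.rpow_two] at this
    rw [mul_assoc, ← sq, ← this]
    congr 1; ring

lemma continuous_signedPow {p : ℝ} (hp : 1 < p) : Continuous (signedPow p) := by
  rw [continuous_iff_continuousAt]
  intro t
  rcases eq_or_ne t 0 with rfl | ht
  · have h0 : signedPow p 0 = 0 := by simp [signedPow]
    rw [ContinuousAt, h0, tendsto_zero_iff_abs_tendsto_zero]
    have h : Tendsto (fun t : ℝ => |t| ^ (p - 1)) (𝓝 0) (𝓝 (|(0 : ℝ)| ^ (p - 1))) :=
      (continuous_abs.rpow_const fun _ => Or.inr (by linarith)).tendsto 0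
    rw [abs_zero, Real.zero_rpow (by linarith)] at h
    exact h.congr fun t => (abs_signedPow hp t).symm
  · exact (continuous_abs.continuousAt.rpow_const (Or.inl (abs_ne_zero.2 ht))).mul continuousAt_id

lemma continuous_abs_rpow {p : ℝ} (hp : 1 < p) : Continuous fun t : ℝ => |t| ^ p :=
  continuous_abs.rpow_const fun _ => Or.inr (by linarith)

/-- Young's inequality for the exponents `p` and `p/(p-1)`, applied to `|b|` and `|a|^(p-1)`. -/
lemma signedPow_mul_le {p : ℝ} (hp : 1 < p) (a b : ℝ) :
    signedPow p a * b ≤ (1 - 1 / p) * |a| ^ p + |b| ^ p / p := by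
  have hpq := Real.HolderConjugate.conjExponent hp
  have h1 : signedPow p a * b ≤ |b| * |a| ^ (p - 1) := by
    rw [← abs_signedPow hp, mul_comm |b|, ← abs_mul]; exact le_abs_self _
  refine h1.trans ((Real.young_inequality_of_nonneg (abs_nonneg b) (by positivity) hpq).trans ?_)
  have h2 : (|a| ^ (p - 1)) ^ p.conjExponent = |a| ^ p := by
    rw [← Real.rpow_mul (abs_nonneg a), Real.conjExponent, mul_div_cancel₀ _ (by linarith)]
  have h3 : (p.conjExponent)⁻¹ = 1 - 1 / p := by
    have := hpq.inv_add_inv_eq_one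
    rw [one_div]; linarith
  rw [h2, div_eq_mul_inv _ p.conjExponent, h3]
  linarith

/-- The tangent inequality for the convex function `|t|^p / p`. -/
lemma abs_rpow_tangent_le {p : ℝ} (hp : 1 < p) (a b : ℝ) :
    |a| ^ p / p + signedPow p a * (b - a) ≤ |b| ^ p / p := by
  have h := signedPow_mul_le hp a b
  have h2 := signedPow_mul_self hp a
  rw [mul_sub, h2]
  have : (1 - 1 / p) * |a| ^ p = |a| ^ p - |a| ^ p / p := by ring
  linarith

/-- The defect of midpoint convexity of `|t|^p`. -/
def midpointDefect (p a b : ℝ) : ℝ := |a| ^ p + |b| ^ p - 2 * |(a + b) / 2| ^ p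

/-- The tangents at `a` and at `b`, both evaluated at the midpoint, are added. This lets
monotonicity of the operator control the convexity defect. -/
lemma midpointDefect_le {p : ℝ} (hp : 1 < p) (a b : ℝ) :
    midpointDefect p a b ≤ p / 2 * ((signedPow p a - signedPow p b) * (a - b)) := by
  have hp0 : 0 < p := by linarith
  have h1 := mul_le_mul_of_nonneg_left (abs_rpow_tangent_le hp a ((a + b) / 2)) hp0.le
  have h2 := mul_le_mul_of_nonneg_left (abs_rpow_tangent_le hp b ((a + b) / 2)) hp0.le
  rw [mul_add, mul_div_cancel₀ _ hp0.ne', mul_div_cancel₀ _ hp0.ne'] at h1 h2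
  unfold midpointDefect
  linear_combination h1 + h2

/-- The tangent at the midpoint is evaluated at `a` and `b`; the linear terms cancel. -/
lemma midpointDefect_nonneg {p : ℝ} (hp : 1 < p) (a b : ℝ) : 0 ≤ midpointDefect p a b := by
  have hp0 : 0 < p := by linarith
  have h1 := mul_le_mul_of_nonneg_left (abs_rpow_tangent_le hp ((a + b) / 2) a) hp0.le
  have h2 := mul_le_mul_of_nonneg_left (abs_rpow_tangent_le hp ((a + b) / 2) b) hp0.le
  rw [mul_add, mul_div_cancel₀ _ hp0.ne', mul_div_cancel₀ _ hp0.ne'] at h1 h2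
  unfold midpointDefect
  linear_combination h1 + h2

/-- Strict convexity of the power on `[0, ∞)` settles `|a| ≠ |b|`. In the remaining case `a = -b ≠
0` the midpoint is zero. -/
lemma midpointDefect_pos {p : ℝ} (hp : 1 < p) {a b : ℝ} (hab : a ≠ b) :
    0 < midpointDefect p a b := by
  have hp0 : 0 < p := by linarith
  unfold midpointDefect
  by_cases h : |a| = |b|
  · have hb : a = -b := (abs_eq_abs.1 h).resolve_left hab
    have hb0 : b ≠ 0 := by rintro rfl; simp at hb; exact hab hb
    subst hb
    have : 0 < |b| ^ p := Real.rpow_pos_of_pos (abs_pos.2 hb0) p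
    simp [Real.zero_rpow hp0.ne', this]
  · have h1 := (strictConvexOn_rpow hp).2 (Set.mem_Ici.2 (abs_nonneg a))
      (Set.mem_Ici.2 (abs_nonneg b)) h (by norm_num : (0 : ℝ) < 1 / 2)
      (by norm_num : (0 : ℝ) < 1 / 2) (by norm_num)
    simp only [smul_eq_mul] at h1
    have h2 : |(a + b) / 2| ^ p ≤ (1 / 2 * |a| + 1 / 2 * |b|) ^ p := by
      refine Real.rpow_le_rpow (abs_nonneg _) ?_ hp0.le
      rw [abs_div, abs_two]
      linarith [abs_add_le a b]
    linarith

lemma midpointDefect_smul {p c : ℝ} (hc : 0 ≤ c) (a b : ℝ) :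
    midpointDefect p (c * a) (c * b) = c ^ p * midpointDefect p a b := by
  unfold midpointDefect
  rw [show (c * a + c * b) / 2 = c * ((a + b) / 2) by ring]
  simp only [abs_mul, abs_of_nonneg hc, Real.mul_rpow hc (abs_nonneg _)]
  ring

/-- A substitute for Clarkson's inequalities that treats all `p > 1` alike. All terms are
homogeneous of degree `p`, so the unit sphere suffices. Where the `δ` term does not already
dominate, `a ≠ b`, so the defect is positive and by compactness bounded away from zero. -/
lemma abs_sub_rpow_le_midpointDefect {p : ℝ} (hp : 1 < p) {δ : ℝ} (hδ : 0 < δ) :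
    ∃ C, 0 ≤ C ∧ ∀ a b : ℝ,
      |a - b| ^ p ≤ δ * (|a| ^ p + |b| ^ p) + C * midpointDefect p a b := by
  have hp0 : 0 < p := by linarith
  have hc := continuous_abs_rpow hp
  have hcA : Continuous fun x : ℝ × ℝ => |x.1 - x.2| ^ p :=
    hc.comp (continuous_fst.sub continuous_snd)
  have hcB : Continuous fun x : ℝ × ℝ => |x.1| ^ p + |x.2| ^ p :=
    (hc.comp continuous_fst).add (hc.comp continuous_snd)
  have hcN : Continuous fun x : ℝ × ℝ => midpointDefect p x.1 x.2 := by
    have : Continuous fun x : ℝ × ℝ => |(x.1 + x.2) / 2| ^ p :=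
      hc.comp ((continuous_fst.add continuous_snd).div_const 2)
    exact hcB.sub (this.const_mul 2)
  let S : Set (ℝ × ℝ) := Metric.sphere 0 1 ∩
    {x | δ * (|x.1| ^ p + |x.2| ^ p) ≤ |x.1 - x.2| ^ p}
  have hS : IsCompact S :=
    (isCompact_sphere 0 1).inter_right (isClosed_le (hcB.const_mul δ) hcA)
  have hpos : ∀ x ∈ S, 0 < midpointDefect p x.1 x.2 := by
    rintro ⟨a, b⟩ ⟨h1, h2⟩
    refine midpointDefect_pos hp ?_
    intro hab
    simp only at hab
    subst hab
    simp only [Set.mem_ofPred_eq, sub_self, abs_zero, Real.zero_rpow hp0.ne'] at h2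
    have ha : a ≠ 0 := by
      rintro rfl
      simp at h1
    have : 0 < |a| ^ p := Real.rpow_pos_of_pos (abs_pos.2 ha) p
    nlinarith
  obtain ⟨C, hC0, hC⟩ : ∃ C, 0 ≤ C ∧ ∀ x ∈ S, |x.1 - x.2| ^ p ≤ C * midpointDefect p x.1 x.2 := by
    rcases S.eq_empty_or_nonempty with he | hne
    · exact ⟨0, le_rfl, by simp [he]⟩
    obtain ⟨x₀, hx₀, hmin⟩ := hS.exists_isMinOn hne hcN.continuousOn
    obtain ⟨x₁, hx₁, hmax⟩ := hS.exists_isMaxOn hne hcA.continuousOn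
    have h0 := hpos x₀ hx₀
    refine ⟨|x₁.1 - x₁.2| ^ p / midpointDefect p x₀.1 x₀.2, by positivity, fun x hx => ?_⟩
    rw [div_mul_eq_mul_div, le_div_iff₀ h0]
    exact mul_le_mul (hmax hx) (hmin hx) h0.le (by positivity)
  refine ⟨C, hC0, fun a b => ?_⟩
  have hsph : ∀ x ∈ Metric.sphere (0 : ℝ × ℝ) 1,
      |x.1 - x.2| ^ p ≤ δ * (|x.1| ^ p + |x.2| ^ p) + C * midpointDefect p x.1 x.2 := by
    intro x hx
    have hN := midpointDefect_nonneg hp x.1 x.2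
    by_cases h : δ * (|x.1| ^ p + |x.2| ^ p) ≤ |x.1 - x.2| ^ p
    · have := hC x ⟨hx, h⟩
      have h3 : 0 ≤ δ * (|x.1| ^ p + |x.2| ^ p) := by positivity
      linarith
    · have h3 : 0 ≤ C * midpointDefect p x.1 x.2 := by positivity
      linarith
  rcases eq_or_ne ((a, b) : ℝ × ℝ) 0 with h0 | h0
  · simp only [Prod.mk_eq_zero] at h0
    simp [h0.1, h0.2, midpointDefect, Real.zero_rpow hp0.ne']
  · set r := ‖((a, b) : ℝ × ℝ)‖ with hr
    have hr0 : 0 < r := norm_pos_iff.2 h0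
    have h1 := hsph (r⁻¹ • (a, b)) (by
      rw [mem_sphere_zero_iff_norm, norm_smul, ← hr, norm_inv, Real.norm_of_nonneg hr0.le,
        inv_mul_cancel₀ hr0.ne'])
    simp only [Prod.smul_mk, smul_eq_mul] at h1
    rw [midpointDefect_smul (by positivity), ← mul_sub] at h1
    simp only [abs_mul, abs_of_nonneg (inv_nonneg.2 hr0.le),
      Real.mul_rpow (inv_nonneg.2 hr0.le) (abs_nonneg _)] at h1
    have h2 : 0 < r⁻¹ ^ p := by positivity
    refine le_of_mul_le_mul_left ?_ h2
    linarith

/-! ### Integrals of powers and products -/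

section Holder

variable {Ω : Type*} [MeasurableSpace Ω] {ρ : Measure Ω} {p : ℝ}

lemma holderConjugate_div {p : ℝ} (hp : 1 < p) : p.HolderConjugate (p / (p - 1)) :=
  Real.HolderConjugate.conjExponent hp

lemma memLp_iff_integrable_abs_rpow (hp : 0 < p) {g : Ω → ℝ} (hg : AEStronglyMeasurable g ρ) :
    MemLp g (ENNReal.ofReal p) ρ ↔ Integrable (fun x => |g x| ^ p) ρ := by
  rw [← integrable_norm_rpow_iff hg (by simpa using hp) ENNReal.ofReal_ne_top,
    ENNReal.toReal_ofReal hp.le]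
  rfl

lemma integrable_abs_rpow (hp : 0 < p) {g : Ω → ℝ} (hg : MemLp g (ENNReal.ofReal p) ρ) :
    Integrable (fun x => |g x| ^ p) ρ :=
  (memLp_iff_integrable_abs_rpow hp hg.1).1 hg

lemma eLpNorm_toReal (hp : 0 < p) {g : Ω → ℝ} (hg : MemLp g (ENNReal.ofReal p) ρ) :
    (eLpNorm g (ENNReal.ofReal p) ρ).toReal = (∫ x, |g x| ^ p ∂ρ) ^ (1 / p) := by
  rw [hg.eLpNorm_eq_integral_rpow_norm (by simpa using hp) ENNReal.ofReal_ne_top,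
    ENNReal.toReal_ofReal (by positivity), ENNReal.toReal_ofReal hp.le, one_div]
  rfl

lemma Lp_norm_eq (hp : 0 < p) (u : Lp ℝ (ENNReal.ofReal p) ρ) :
    ‖u‖ = (∫ x, |u x| ^ p ∂ρ) ^ (1 / p) := by
  rw [Lp.norm_def, eLpNorm_toReal hp (Lp.memLp u)]

lemma Lp_norm_rpow (hp : 0 < p) (u : Lp ℝ (ENNReal.ofReal p) ρ) :
    ‖u‖ ^ p = ∫ x, |u x| ^ p ∂ρ := by
  rw [Lp_norm_eq hp, ← Real.rpow_mul (integral_nonneg fun x => by positivity),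
    one_div_mul_cancel hp.ne', Real.rpow_one]

lemma integrable_mul_of_holder (hp : 1 < p) {g v : Ω → ℝ}
    (hg : MemLp g (ENNReal.ofReal (p / (p - 1))) ρ) (hv : MemLp v (ENNReal.ofReal p) ρ) :
    Integrable (fun x => g x * v x) ρ := by
  have := (holderConjugate_div hp).symm.ennrealOfReal
  exact hg.integrable_mul hv

lemma integral_abs_mul_le (hp : 1 < p) {g v : Ω → ℝ}
    (hg : MemLp g (ENNReal.ofReal (p / (p - 1))) ρ) (hv : MemLp v (ENNReal.ofReal p) ρ) :
    ∫ x, |g x| * |v x| ∂ρ ≤ (∫ x, |g x| ^ (p / (p - 1)) ∂ρ) ^ (1 / (p / (p - 1))) *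
      (∫ x, |v x| ^ p ∂ρ) ^ (1 / p) :=
  integral_mul_norm_le_Lp_mul_Lq (holderConjugate_div hp).symm hg hv

lemma memLp_bdd_mul {q : ENNReal} {C : ℝ} {w g : Ω → ℝ} (hw : AEStronglyMeasurable w ρ)
    (hwC : ∀ x, |w x| ≤ C) (hg : MemLp g q ρ) : MemLp (fun x => w x * g x) q ρ :=
  MemLp.of_le_mul hg (hw.mul hg.1) (.of_forall fun x => by
    rw [norm_mul]; exact mul_le_mul_of_nonneg_right (hwC x) (norm_nonneg _))

/-- Hölder's inequality with a bounded weight, the common source of every bound linear in the norm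
of the test function. -/
lemma abs_integral_bdd_mul_le (hp : 1 < p) {C : ℝ} {w g v : Ω → ℝ}
    (hw : AEStronglyMeasurable w ρ) (hwC : ∀ x, |w x| ≤ C)
    (hg : MemLp g (ENNReal.ofReal (p / (p - 1))) ρ) (hv : MemLp v (ENNReal.ofReal p) ρ) :
    |∫ x, w x * g x * v x ∂ρ| ≤ C * ((∫ x, |g x| ^ (p / (p - 1)) ∂ρ) ^ (1 / (p / (p - 1))) *
      (∫ x, |v x| ^ p ∂ρ) ^ (1 / p)) := by
  -- On an empty space `C` may be negative, but then both sides vanish.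
  rcases isEmpty_or_nonempty Ω with h | ⟨⟨x₀⟩⟩
  · have hp0 : 0 < p := by linarith
    have hρ : ρ = 0 := Measure.eq_zero_of_isEmpty ρ
    simp [hρ, Real.zero_rpow (inv_ne_zero hp0.ne')]
  have hC : 0 ≤ C := (abs_nonneg _).trans (hwC x₀)
  refine (abs_integral_le_integral_abs).trans ?_
  refine le_trans ?_ (mul_le_mul_of_nonneg_left (integral_abs_mul_le hp hg hv) hC)
  rw [← integral_const_mul]
  refine integral_mono ?_ ?_ fun x => ?_
  · exact (integrable_mul_of_holder hp (memLp_bdd_mul hw hwC hg) hv).abs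
  · have := (integrable_mul_of_holder hp hg hv).abs.const_mul C
    simpa only [abs_mul] using this
  · simp only [abs_mul, mul_assoc]
    exact mul_le_mul_of_nonneg_right (hwC x) (by positivity)

lemma abs_signedPow_rpow (hp : 1 < p) (t : ℝ) :
    |signedPow p t| ^ (p / (p - 1)) = |t| ^ p := by
  rw [abs_signedPow hp, ← Real.rpow_mul (abs_nonneg _), mul_div_cancel₀ _ (by linarith)]

lemma memLp_signedPow (hp : 1 < p) {u : Ω → ℝ} (hu : MemLp u (ENNReal.ofReal p) ρ) :
    MemLp (fun x => signedPow p (u x)) (ENNReal.ofReal (p / (p - 1))) ρ := by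
  have hm : AEStronglyMeasurable (fun x => signedPow p (u x)) ρ :=
    (continuous_signedPow hp).comp_aestronglyMeasurable hu.1
  rw [memLp_iff_integrable_abs_rpow (div_pos (by linarith) (by linarith)) hm]
  simp only [abs_signedPow_rpow hp]
  exact integrable_abs_rpow (by linarith) hu

lemma integrable_form (hp : 1 < p) {C : ℝ} {w u v : Ω → ℝ} (hw : AEStronglyMeasurable w ρ)
    (hwC : ∀ x, |w x| ≤ C) (hu : MemLp u (ENNReal.ofReal p) ρ)
    (hv : MemLp v (ENNReal.ofReal p) ρ) :
    Integrable (fun x => w x * signedPow p (u x) * v x) ρ :=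
  integrable_mul_of_holder hp (memLp_bdd_mul hw hwC (memLp_signedPow hp hu)) hv

lemma integrable_bdd_mul_abs_rpow (hp : 0 < p) {C : ℝ} {w u : Ω → ℝ}
    (hw : AEStronglyMeasurable w ρ) (hwC : ∀ x, |w x| ≤ C)
    (hu : MemLp u (ENNReal.ofReal p) ρ) : Integrable (fun x => w x * |u x| ^ p) ρ :=
  (integrable_abs_rpow hp hu).bdd_mul hw (.of_forall hwC)

end Holder

/-! ### Monotone variational problems in a closed subspace of `L^p` -/

section Abstract

variable {Ω : Type*} [MeasurableSpace Ω] {ρ : Measure Ω} {p : ℝ}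
  {V : Type*} [AddCommGroup V] [Module ℝ V]
  (D : V →ₗ[ℝ] Lp ℝ (ENNReal.ofReal p) ρ)

/-- The form `∫ w |Du|^(p-2) Du Dv`. -/
def weightedForm (w : Ω → ℝ) (u v : V) : ℝ := ∫ x, w x * signedPow p (D u x) * D v x ∂ρ

variable {D}

lemma weightedForm_smul_right (w : Ω → ℝ) (u v : V) (t : ℝ) :
    weightedForm D w u (t • v) = t * weightedForm D w u v := by
  unfold weightedForm
  rw [← integral_const_mul]
  refine integral_congr_ae ?_
  rw [map_smul]
  filter_upwards [Lp.coeFn_smul t (D v)] with x hx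
  rw [hx, Pi.smul_apply, smul_eq_mul]; ring

lemma weightedForm_self (hp : 1 < p) (w : Ω → ℝ) (u : V) :
    weightedForm D w u u = ∫ x, w x * |D u x| ^ p ∂ρ := by
  simp only [weightedForm, mul_assoc, signedPow_mul_self hp]

lemma memLp_half_add {u v : Ω → ℝ} (hu : MemLp u (ENNReal.ofReal p) ρ)
    (hv : MemLp v (ENNReal.ofReal p) ρ) :
    MemLp (fun x => (u x + v x) / 2) (ENNReal.ofReal p) ρ := by
  have := (hu.add hv).const_mul (1 / 2)
  refine this.ae_eq (.of_forall fun x => ?_)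
  simp only [Pi.add_apply]; ring

lemma integrable_midpointDefect (hp : 1 < p) {C : ℝ} {w u v : Ω → ℝ}
    (hw : AEStronglyMeasurable w ρ) (hwC : ∀ x, |w x| ≤ C)
    (hu : MemLp u (ENNReal.ofReal p) ρ) (hv : MemLp v (ENNReal.ofReal p) ρ) :
    Integrable (fun x => w x * midpointDefect p (u x) (v x)) ρ := by
  have hp0 : 0 < p := by linarith
  have h := ((integrable_bdd_mul_abs_rpow hp0 hw hwC hu).add
    (integrable_bdd_mul_abs_rpow hp0 hw hwC hv)).sub
    ((integrable_bdd_mul_abs_rpow hp0 hw hwC (memLp_half_add hu hv)).const_mul 2)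
  refine h.congr (.of_forall fun x => ?_)
  simp only [midpointDefect, Pi.add_apply, Pi.sub_apply]; ring

/-- Uniform convexity of the `p`-th power of the `L^p` norm. -/
lemma norm_sub_rpow_le (hp : 1 < p) {c : ℝ} (hc : 0 < c) {δ : ℝ} (hδ : 0 < δ) :
    ∃ K, 0 ≤ K ∧ ∀ (C : ℝ) (w : Ω → ℝ), AEStronglyMeasurable w ρ → (∀ x, c ≤ w x) →
      (∀ x, |w x| ≤ C) → ∀ u v : Lp ℝ (ENNReal.ofReal p) ρ, ‖u - v‖ ^ p ≤
      δ * (‖u‖ ^ p + ‖v‖ ^ p) + K * ∫ x, w x * midpointDefect p (u x) (v x) ∂ρ := by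
  obtain ⟨K, hK0, hK⟩ := abs_sub_rpow_le_midpointDefect hp hδ
  refine ⟨K / c, by positivity, fun C w hw hwc hwC u v => ?_⟩
  have hp0 : 0 < p := by linarith
  have iu := integrable_abs_rpow hp0 (Lp.memLp u)
  have iv := integrable_abs_rpow hp0 (Lp.memLp v)
  have iN := integrable_midpointDefect hp hw hwC (Lp.memLp u) (Lp.memLp v)
  rw [Lp_norm_rpow hp0, Lp_norm_rpow hp0, Lp_norm_rpow hp0, ← integral_add iu iv,
    ← integral_const_mul, ← integral_const_mul,
    ← integral_add (by exact (iu.add iv).const_mul δ) (iN.const_mul _)]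
  refine integral_mono_ae (integrable_abs_rpow hp0 (Lp.memLp _))
    (((iu.add iv).const_mul δ).add (iN.const_mul _)) ?_
  filter_upwards [Lp.coeFn_sub u v] with x hx
  rw [hx]
  refine (hK (u x) (v x)).trans ?_
  have hN := midpointDefect_nonneg hp (u x) (v x)
  have : K * midpointDefect p (u x) (v x) ≤ K / c * (w x * midpointDefect p (u x) (v x)) := by
    rw [div_mul_eq_mul_div, le_div_iff₀ hc, mul_assoc]
    refine mul_le_mul_of_nonneg_left ?_ hK0
    rw [mul_comm]
    exact mul_le_mul_of_nonneg_right (hwc x) hN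
  linarith

/-- The pointwise bound `midpointDefect_le` integrated against `w`: the defect is controlled by the
monotonicity pairing, which the equations make computable. -/
lemma integral_midpointDefect_le (hp : 1 < p) {C : ℝ} {w : Ω → ℝ}
    (hw : AEStronglyMeasurable w ρ) (hw0 : ∀ x, 0 ≤ w x) (hwC : ∀ x, |w x| ≤ C) (u v : V) :
    ∫ x, w x * midpointDefect p (D u x) (D v x) ∂ρ ≤
      p / 2 * (weightedForm D w u (u - v) - weightedForm D w v (u - v)) := by
  have iu := integrable_form hp hw hwC (Lp.memLp (D u)) (Lp.memLp (D (u - v)))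
  have iv := integrable_form hp hw hwC (Lp.memLp (D v)) (Lp.memLp (D (u - v)))
  unfold weightedForm
  rw [← integral_sub iu iv, ← integral_const_mul]
  refine integral_mono_ae (integrable_midpointDefect hp hw hwC (Lp.memLp _) (Lp.memLp _))
    ((iu.sub iv).const_mul _) ?_
  have hx : D (u - v) =ᵐ[ρ] D u - D v := by rw [map_sub]; exact Lp.coeFn_sub _ _
  filter_upwards [hx] with x hx
  have h := mul_le_mul_of_nonneg_left (midpointDefect_le hp (D u x) (D v x)) (hw0 x)
  simp only [Pi.sub_apply, hx]
  linear_combination h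

/-- Young's inequality in the form that absorbs a linear term into a `p`-th power. -/
lemma exists_mul_le_mul_rpow_add (hp : 1 < p) {c : ℝ} (hc : 0 < c) (K : ℝ) :
    ∃ K', ∀ t : ℝ, 0 ≤ t → K * t ≤ c * t ^ p + K' := by
  have hp0 : 0 < p := by linarith
  -- The scaling for which `(a * t) ^ p / p` equals `c * t ^ p`.
  set a := (c * p) ^ (1 / p) with ha
  have ha0 : 0 < a := by positivity
  refine ⟨(|K| / a) ^ (p / (p - 1)) / (p / (p - 1)), fun t ht => ?_⟩
  have h := Real.young_inequality_of_nonneg (a := a * t) (b := |K| / a) (by positivity)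
    (by positivity) (holderConjugate_div hp)
  have h1 : a * t * (|K| / a) = |K| * t := by field_simp
  have h2 : (a * t) ^ p / p = c * t ^ p := by
    rw [Real.mul_rpow ha0.le ht, ha, ← Real.rpow_mul (by positivity), one_div_mul_cancel hp0.ne',
      Real.rpow_one]
    field_simp
  rw [h1, h2] at h
  exact (mul_le_mul_of_nonneg_right (le_abs_self K) ht).trans h

lemma mul_norm_rpow_le_weightedForm (hp : 1 < p) {c C : ℝ} {w : Ω → ℝ}
    (hw : AEStronglyMeasurable w ρ) (hwc : ∀ x, c ≤ w x) (hwC : ∀ x, |w x| ≤ C) (u : V) :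
    c * ‖D u‖ ^ p ≤ weightedForm D w u u := by
  have hp0 : 0 < p := by linarith
  rw [Lp_norm_rpow hp0, weightedForm_self hp, ← integral_const_mul]
  refine integral_mono ((integrable_abs_rpow hp0 (Lp.memLp _)).const_mul c)
    (integrable_bdd_mul_abs_rpow hp0 hw hwC (Lp.memLp _)) fun x => ?_
  exact mul_le_mul_of_nonneg_right (hwc x) (by positivity)

lemma norm_lt_of_rpow_lt (hp : 0 < p) {a b : ℝ} (hb : 0 ≤ b) (h : a ^ p < b ^ p) : a < b := by
  by_contra! hab
  exact absurd (Real.rpow_le_rpow hb hab hp.le) (not_le.2 h)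

variable [Fact (1 ≤ ENNReal.ofReal p)]

lemma abs_weightedForm_le (hp : 1 < p) {C : ℝ} {w : Ω → ℝ} (hw : AEStronglyMeasurable w ρ)
    (hwC : ∀ x, |w x| ≤ C) (u v : V) :
    |weightedForm D w u v| ≤ C * ‖D u‖ ^ (p - 1) * ‖D v‖ := by
  refine (abs_integral_bdd_mul_le hp hw hwC (memLp_signedPow hp (Lp.memLp _))
    (Lp.memLp _)).trans (le_of_eq ?_)
  have hp0 : 0 < p := by linarith
  simp only [abs_signedPow_rpow hp]
  rw [← Lp_norm_eq hp0, ← Lp_norm_rpow hp0, ← Real.rpow_mul (norm_nonneg _), mul_assoc]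
  congr 4
  field_simp

/-- Solutions of `∫ w |Du|^(p-2) Du Dv = ℓ v` depend continuously on the data `w, ℓ`, where the
convergence of the data is that of the functionals on the space of test functions. -/
theorem tendsto_of_weightedForm_eq (hp : 1 < p) {c C K : ℝ} (hc : 0 < c)
    {ι : Type*} {l : Filter ι} {w : ι → Ω → ℝ} {w₀ : Ω → ℝ} {ℓ : ι → V → ℝ} {ℓ₀ : V → ℝ}
    {u : ι → V} {u₀ : V}
    (hw : ∀ᶠ i in l, AEStronglyMeasurable (w i) ρ ∧ ∀ x, c ≤ w i x ∧ |w i x| ≤ C)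
    (hℓ : ∀ᶠ i in l, ∀ v, |ℓ i v| ≤ K * ‖D v‖)
    (hu : ∀ᶠ i in l, ∀ v, weightedForm D (w i) (u i) v = ℓ i v)
    (hu₀ : ∀ v, weightedForm D w₀ u₀ v = ℓ₀ v)
    (hwconv : ∀ τ > 0, ∀ᶠ i in l, ∀ v,
      |weightedForm D (w i) u₀ v - weightedForm D w₀ u₀ v| ≤ τ * ‖D v‖)
    (hℓconv : ∀ τ > 0, ∀ᶠ i in l, ∀ v, |ℓ i v - ℓ₀ v| ≤ τ * ‖D v‖) :
    Tendsto (fun i => ‖D (u i) - D u₀‖) l (𝓝 0) := by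
  have hp0 : 0 < p := by linarith
  -- A priori bound: each equation is tested with its own solution, and half of the coercivity
  -- constant absorbs the source.
  obtain ⟨K', hK'⟩ := exists_mul_le_mul_rpow_add hp (half_pos hc) K
  have hbd : ∀ᶠ i in l, ‖D (u i)‖ ^ p ≤ 2 * K' / c := by
    filter_upwards [hw, hℓ, hu] with i hw hℓ hu
    have h1 := mul_norm_rpow_le_weightedForm hp hw.1 (fun x => (hw.2 x).1)
      (fun x => (hw.2 x).2) (u i) (D := D)
    rw [hu] at h1
    have h2 := (le_abs_self _).trans (hℓ (u i))
    have h3 := hK' ‖D (u i)‖ (norm_nonneg _)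
    rw [le_div_iff₀ hc]
    linarith
  set M := |2 * K' / c| + ‖D u₀‖ ^ p with hM
  have hM0 : 0 ≤ M := by positivity
  set R := |2 * K' / c| ^ (1 / p) + ‖D u₀‖ with hR
  have hR0 : 0 ≤ R := by positivity
  rw [Metric.tendsto_nhds]
  intro τ hτ
  have hτp : 0 < τ ^ p := by positivity
  -- `M` and `R` bound the norms uniformly in `i`. This `δ` keeps the first term of the convexity
  -- estimate below `τ ^ p / 2`, and `σ` keeps the defect term at most `τ ^ p / 4`.
  obtain ⟨A, hA0, hA⟩ := norm_sub_rpow_le (ρ := ρ) hp hc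
    (δ := τ ^ p / (2 * (M + 1))) (by positivity)
  set σ := τ ^ p / (4 * (A * p * R + 1)) with hσ
  have hσ0 : 0 < σ := by positivity
  filter_upwards [hw, hu, hbd, hwconv σ hσ0, hℓconv σ hσ0] with i hw hu hbd hwc hℓc
  rw [dist_zero_right, norm_norm]
  refine norm_lt_of_rpow_lt hp0 hτ.le ?_
  have h1 := hA C (w i) hw.1 (fun x => (hw.2 x).1) (fun x => (hw.2 x).2) (D (u i)) (D u₀)
  have h2 := integral_midpointDefect_le (D := D) hp hw.1 (fun x => hc.le.trans (hw.2 x).1)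
    (fun x => (hw.2 x).2) (u i) u₀
  have h3 : ‖D (u i - u₀)‖ ≤ R := by
    rw [map_sub]
    refine (norm_sub_le _ _).trans (add_le_add_left ?_ _)
    rw [← Real.rpow_le_rpow_iff (norm_nonneg _) (by positivity) hp0, ← Real.rpow_mul (abs_nonneg _),
      one_div_mul_cancel hp0.ne', Real.rpow_one]
    exact hbd.trans (le_abs_self _)
  -- The equation of `u i` replaces the first form by `ℓ i`. Exchanging `ℓ i` for `ℓ₀` and `w i` for
  -- `w₀` costs `σ` times the norm each, and the rest cancels by the equation of `u₀`.
  have h4 : weightedForm D (w i) (u i) (u i - u₀) - weightedForm D (w i) u₀ (u i - u₀)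
      ≤ 2 * σ * R := by
    have a1 := le_of_abs_le (hℓc (u i - u₀))
    have a2 := neg_le_of_abs_le (hwc (u i - u₀))
    rw [hu]
    rw [hu₀] at a2
    have a3 := mul_le_mul_of_nonneg_left h3 hσ0.le
    linarith
  have h5 : ‖D (u i)‖ ^ p + ‖D u₀‖ ^ p ≤ M := add_le_add_left (hbd.trans (le_abs_self _)) _
  have h6 : τ ^ p / (2 * (M + 1)) * (‖D (u i)‖ ^ p + ‖D u₀‖ ^ p) < τ ^ p / 2 := by
    refine (mul_le_mul_of_nonneg_left h5 (by positivity)).trans_lt ?_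
    rw [div_mul_eq_mul_div, div_lt_div_iff₀ (by positivity) (by positivity)]
    nlinarith
  have h7 : A * ∫ x, w i x * midpointDefect p (D (u i) x) (D u₀ x) ∂ρ ≤ τ ^ p / 4 := by
    have b1 := h2.trans (mul_le_mul_of_nonneg_left h4 (by positivity : 0 ≤ p / 2))
    refine (mul_le_mul_of_nonneg_left b1 hA0).trans ?_
    have : A * (p / 2 * (2 * σ * R)) = τ ^ p / 4 * ((A * p * R) / (A * p * R + 1)) := by
      rw [hσ]; field_simp
    rw [this]
    have h8 : A * p * R / (A * p * R + 1) ≤ 1 := by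
      rw [div_le_one (by positivity)]; linarith
    nlinarith
  linarith

end Abstract

/-! ### Existence and uniqueness by minimization of a uniformly convex functional. -/

section Existence

variable {Ω : Type*} [MeasurableSpace Ω] {ρ : Measure Ω} {p : ℝ}
  {V : Type*} [AddCommGroup V] [Module ℝ V] {D : V →ₗ[ℝ] Lp ℝ (ENNReal.ofReal p) ρ}

/-- The convex functional `(1/p) ∫ w |Du|^p - ℓ u`. -/
def weightedEnergy (D : V →ₗ[ℝ] Lp ℝ (ENNReal.ofReal p) ρ) (w : Ω → ℝ) (ℓ : V →ₗ[ℝ] ℝ)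
    (u : V) : ℝ :=
  (1 / p) * (∫ x, w x * |D u x| ^ p ∂ρ) - ℓ u

/-- The form minus `ℓ` is a subgradient of the energy, by integrating `abs_rpow_tangent_le`. This
one inequality yields both lower semicontinuity and the Euler-Lagrange equation. -/
lemma weightedEnergy_tangent_le (hp : 1 < p) {C : ℝ} {w : Ω → ℝ}
    (hw : AEStronglyMeasurable w ρ) (hw0 : ∀ x, 0 ≤ w x) (hwC : ∀ x, |w x| ≤ C)
    (ℓ : V →ₗ[ℝ] ℝ) (u v : V) :
    weightedEnergy D w ℓ u + weightedForm D w u v - ℓ v ≤ weightedEnergy D w ℓ (u + v) := by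
  have hp0 : 0 < p := by linarith
  have i1 := (integrable_bdd_mul_abs_rpow hp0 hw hwC (Lp.memLp (D u))).const_mul (1 / p)
  have i2 := integrable_form hp hw hwC (Lp.memLp (D u)) (Lp.memLp (D v))
  have i3 := (integrable_bdd_mul_abs_rpow hp0 hw hwC (Lp.memLp (D (u + v)))).const_mul (1 / p)
  have key : (1 / p) * (∫ x, w x * |D u x| ^ p ∂ρ) + weightedForm D w u v ≤
      (1 / p) * (∫ x, w x * |D (u + v) x| ^ p ∂ρ) := by
    unfold weightedForm
    rw [← integral_const_mul, ← integral_const_mul, ← integral_add i1 i2]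
    refine integral_mono_ae (i1.add i2) i3 ?_
    have hx : D (u + v) =ᵐ[ρ] D u + D v := by rw [map_add]; exact Lp.coeFn_add _ _
    filter_upwards [hx] with x hx
    have h := mul_le_mul_of_nonneg_left (abs_rpow_tangent_le hp (D u x) (D u x + D v x)) (hw0 x)
    simp only [hx, Pi.add_apply]
    rw [add_sub_cancel_left] at h
    calc _ = w x * (|D u x| ^ p / p + signedPow p (D u x) * D v x) := by ring
      _ ≤ _ := h
      _ = _ := by ring
  unfold weightedEnergy
  rw [map_add ℓ]
  linarith

/-- The linear part `ℓ` is affine and drops out of the midpoint defect, so this is an identity. -/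
lemma weightedEnergy_midpoint (hp : 1 < p) {C : ℝ} {w : Ω → ℝ}
    (hw : AEStronglyMeasurable w ρ) (hwC : ∀ x, |w x| ≤ C) (ℓ : V →ₗ[ℝ] ℝ) (u v : V) :
    (∫ x, w x * midpointDefect p (D u x) (D v x) ∂ρ) =
      p * (weightedEnergy D w ℓ u + weightedEnergy D w ℓ v
        - 2 * weightedEnergy D w ℓ ((1 / 2 : ℝ) • (u + v))) := by
  have hp0 : 0 < p := by linarith
  have i1 := integrable_bdd_mul_abs_rpow hp0 hw hwC (Lp.memLp (D u))
  have i2 := integrable_bdd_mul_abs_rpow hp0 hw hwC (Lp.memLp (D v))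
  have i3 := (integrable_bdd_mul_abs_rpow hp0 hw hwC
    (Lp.memLp (D ((1 / 2 : ℝ) • (u + v))))).const_mul 2
  have key : (∫ x, w x * midpointDefect p (D u x) (D v x) ∂ρ) =
      (∫ x, w x * |D u x| ^ p ∂ρ) + (∫ x, w x * |D v x| ^ p ∂ρ)
        - 2 * ∫ x, w x * |D ((1 / 2 : ℝ) • (u + v)) x| ^ p ∂ρ := by
    rw [← integral_const_mul, ← integral_add i1 i2, ← integral_sub (by exact i1.add i2) i3]
    refine integral_congr_ae ?_
    have hx : D ((1 / 2 : ℝ) • (u + v)) =ᵐ[ρ] (1 / 2 : ℝ) • (D u + D v : Ω → ℝ) := by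
      rw [map_smul, map_add]
      exact (Lp.coeFn_smul _ _).trans ((Lp.coeFn_add _ _).const_smul _)
    filter_upwards [hx] with x hx
    rw [hx]
    simp only [midpointDefect, Pi.smul_apply, Pi.add_apply, smul_eq_mul]
    rw [show 1 / 2 * (D u x + D v x) = (D u x + D v x) / 2 by ring]
    ring
  rw [key]
  unfold weightedEnergy
  simp only [map_smul, map_add, smul_eq_mul]
  field_simp
  ring

/-- Hemicontinuity of the operator, by dominated convergence: for `0 < t ≤ 1` the argument is at
most `|Du| + |Dv|` in absolute value. -/
lemma tendsto_weightedForm_line (hp : 1 < p) {C : ℝ} {w : Ω → ℝ}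
    (hw : AEStronglyMeasurable w ρ) (hwC : ∀ x, |w x| ≤ C) (u v : V) :
    Tendsto (fun t : ℝ => weightedForm D w (u + t • v) v) (𝓝[>] 0)
      (𝓝 (weightedForm D w u v)) := by
  unfold weightedForm
  have hline : ∀ t : ℝ, D (u + t • v) =ᵐ[ρ] fun x => D u x + t * D v x := fun t => by
    rw [map_add, map_smul]
    filter_upwards [Lp.coeFn_add (D u) (t • D v), Lp.coeFn_smul t (D v)] with x h1 h2
    rw [h1, Pi.add_apply, h2, Pi.smul_apply, smul_eq_mul]
  have hdom : MemLp (fun x => |D u x| + |D v x|) (ENNReal.ofReal p) ρ :=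
    (Lp.memLp (D u)).abs.add (Lp.memLp (D v)).abs
  have hcongr : ∀ t : ℝ, (fun x => w x * signedPow p (D (u + t • v) x) * D v x) =ᵐ[ρ]
      fun x => w x * signedPow p (D u x + t * D v x) * D v x := fun t => by
    filter_upwards [hline t] with x hx
    rw [hx]
  refine Tendsto.congr (fun t => (integral_congr_ae (hcongr t)).symm) ?_
  refine tendsto_integral_filter_of_dominated_convergence
    (fun x => C * |signedPow p (|D u x| + |D v x|) * D v x|) ?_ ?_ ?_ ?_
  · exact .of_forall fun t =>
      (integrable_form hp hw hwC (Lp.memLp _) (Lp.memLp _)).1.congr (hcongr t)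
  · filter_upwards [Ioc_mem_nhdsGT (show (0 : ℝ) < 1 by norm_num)] with t ht
    refine .of_forall fun x => ?_
    rw [Real.norm_eq_abs, mul_assoc, abs_mul, abs_mul, abs_mul, abs_signedPow hp,
      abs_signedPow hp]
    have h1 : |D u x + t * D v x| ≤ |(|D u x| + |D v x|)| := by
      refine (abs_add_le _ _).trans ?_
      rw [abs_mul, abs_of_pos ht.1, abs_of_nonneg (by positivity : 0 ≤ |D u x| + |D v x|)]
      have := mul_le_mul_of_nonneg_right ht.2 (abs_nonneg (D v x))
      linarith
    exact mul_le_mul (hwC x) (mul_le_mul_of_nonneg_right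
      (Real.rpow_le_rpow (abs_nonneg _) h1 (by linarith)) (abs_nonneg _)) (by positivity)
      ((abs_nonneg _).trans (hwC x))
  · exact (integrable_mul_of_holder hp (memLp_signedPow hp hdom) (Lp.memLp _)).abs.const_mul C
  · refine .of_forall fun x => ?_
    have hc : Continuous fun t : ℝ => w x * signedPow p (D u x + t * D v x) * D v x :=
      (((continuous_signedPow hp).comp (by fun_prop)).const_mul (w x)).mul_const (D v x)
    have h := hc.tendsto 0
    simp only [zero_mul, add_zero] at h
    exact h.mono_left nhdsWithin_le_nhds

variable [Fact (1 ≤ ENNReal.ofReal p)]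

/-- The direct method with strong convergence: uniform convexity makes a minimizing sequence Cauchy,
and the closed range of `D` contains its limit. -/
lemma exists_isMinOn_weightedEnergy (hp : 1 < p) (hcl : IsClosed (Set.range D)) {c C K : ℝ}
    (hc : 0 < c) {w : Ω → ℝ} (hw : AEStronglyMeasurable w ρ) (hwc : ∀ x, c ≤ w x)
    (hwC : ∀ x, |w x| ≤ C) (ℓ : V →ₗ[ℝ] ℝ) (hℓ : ∀ v, |ℓ v| ≤ K * ‖D v‖) :
    ∃ u, ∀ v, weightedEnergy D w ℓ u ≤ weightedEnergy D w ℓ v := by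
  have hp0 : 0 < p := by linarith
  set J := weightedEnergy D w ℓ with hJ
  -- The energy has coercivity constant `c / p`; half of it is spent on `ℓ`.
  obtain ⟨K', hK'⟩ := exists_mul_le_mul_rpow_add hp (by positivity : 0 < c / (2 * p)) K
  have hlow : ∀ u, c / (2 * p) * ‖D u‖ ^ p - K' ≤ J u := fun u => by
    have h1 := mul_norm_rpow_le_weightedForm (D := D) hp hw hwc hwC u
    rw [weightedForm_self hp] at h1
    have h2 := (le_abs_self _).trans (hℓ u)
    have h3 := hK' ‖D u‖ (norm_nonneg _)
    have h4 := mul_le_mul_of_nonneg_left h1 (by positivity : 0 ≤ 1 / p)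
    have h5 : 1 / p * (c * ‖D u‖ ^ p) = 2 * (c / (2 * p) * ‖D u‖ ^ p) := by field_simp
    rw [hJ, weightedEnergy]
    linarith
  have hbdd : BddBelow (Set.range J) := by
    refine ⟨-K', ?_⟩
    rintro _ ⟨u, rfl⟩
    have : 0 ≤ c / (2 * p) * ‖D u‖ ^ p := by positivity
    linarith [hlow u]
  obtain ⟨s, hanti, hlim, hmem⟩ := exists_seq_tendsto_sInf (Set.range_nonempty J) hbdd
  choose x hx using hmem
  set I := sInf (Set.range J) with hI
  have hIle : ∀ v, I ≤ J v := fun v => csInf_le hbdd ⟨v, rfl⟩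
  set M := |(2 * p) / c * (s 0 + K')| with hM
  have hM0 : 0 ≤ M := abs_nonneg _
  have hbd : ∀ n, ‖D (x n)‖ ^ p ≤ M := fun n => by
    have h1 := hlow (x n)
    have h2 : J (x n) ≤ s 0 := (hx n).le.trans (hanti (Nat.zero_le n))
    refine le_trans ?_ (le_abs_self _)
    rw [div_mul_eq_mul_div, le_div_iff₀ hc]
    have h3 : c / (2 * p) * ‖D (x n)‖ ^ p ≤ s 0 + K' := by linarith
    rw [div_mul_eq_mul_div, div_le_iff₀ (by positivity)] at h3
    linarith
  -- The energy at the midpoint of two near-minimizers is at least the infimum, so their convexity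
  -- defect is small and they are close.
  have hcauchy : CauchySeq fun n => D (x n) := by
    rw [Metric.cauchySeq_iff]
    intro τ hτ
    have hτp : 0 < τ ^ p := by positivity
    obtain ⟨A, hA0, hA⟩ := norm_sub_rpow_le (ρ := ρ) hp hc
      (δ := τ ^ p / (4 * (M + 1))) (by positivity)
    have hσ : 0 < τ ^ p / (4 * (A * p + 1)) := by positivity
    obtain ⟨N, hN⟩ := eventually_atTop.1
      (hlim.eventually (gt_mem_nhds (show I < I + τ ^ p / (4 * (A * p + 1)) by linarith)))
    refine ⟨N, fun m hm n hn => ?_⟩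
    rw [dist_eq_norm]
    refine norm_lt_of_rpow_lt hp0 hτ.le ?_
    have h1 := hA C w hw hwc hwC (D (x m)) (D (x n))
    rw [weightedEnergy_midpoint hp hw hwC ℓ, ← hJ] at h1
    have h2 := hIle ((1 / 2 : ℝ) • (x m + x n))
    have h3 : J (x m) + J (x n) - 2 * J ((1 / 2 : ℝ) • (x m + x n)) ≤
        2 * (τ ^ p / (4 * (A * p + 1))) := by
      have := hN m hm
      have := hN n hn
      rw [hx, hx]
      linarith
    have h4 : A * (p * (J (x m) + J (x n) - 2 * J ((1 / 2 : ℝ) • (x m + x n)))) ≤ τ ^ p / 2 := by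
      refine (mul_le_mul_of_nonneg_left (mul_le_mul_of_nonneg_left h3 hp0.le) hA0).trans ?_
      have : A * (p * (2 * (τ ^ p / (4 * (A * p + 1))))) =
          τ ^ p / 2 * (A * p / (A * p + 1)) := by field_simp; ring
      rw [this]
      have h8 : A * p / (A * p + 1) ≤ 1 := by
        rw [div_le_one (by positivity)]; linarith
      nlinarith
    have h5 : τ ^ p / (4 * (M + 1)) * (‖D (x m)‖ ^ p + ‖D (x n)‖ ^ p) < τ ^ p / 2 := by
      refine (mul_le_mul_of_nonneg_left (add_le_add (hbd m) (hbd n)) (by positivity)).trans_lt ?_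
      rw [div_mul_eq_mul_div, div_lt_div_iff₀ (by positivity) (by positivity)]
      nlinarith
    linarith
  obtain ⟨g, hg⟩ := cauchySeq_tendsto_of_complete hcauchy
  obtain ⟨u, rfl⟩ := hcl.mem_of_tendsto hg (.of_forall fun n => ⟨x n, rfl⟩)
  refine ⟨u, fun v => le_trans ?_ (hIle v)⟩
  have hdist : Tendsto (fun n => ‖D (x n - u)‖) atTop (𝓝 0) := by
    simpa only [map_sub] using tendsto_iff_norm_sub_tendsto_zero.1 hg
  -- Lower semicontinuity along the sequence, from the tangent inequality at the limit `u`.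
  have hlow2 : ∀ n, J u - (C * ‖D u‖ ^ (p - 1) + K) * ‖D (x n - u)‖ ≤ s n := fun n => by
    have h1 := weightedEnergy_tangent_le (D := D) hp hw (fun x => hc.le.trans (hwc x)) hwC ℓ u
      (x n - u)
    rw [add_sub_cancel, ← hJ, hx] at h1
    have h2 := neg_le_of_abs_le (abs_weightedForm_le (D := D) hp hw hwC u (x n - u))
    have h3 := le_of_abs_le (hℓ (x n - u))
    linarith
  have hlim2 : Tendsto (fun n => J u - (C * ‖D u‖ ^ (p - 1) + K) * ‖D (x n - u)‖) atTop
      (𝓝 (J u)) := by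
    simpa using (hdist.const_mul (C * ‖D u‖ ^ (p - 1) + K)).const_sub (J u)
  exact le_of_tendsto_of_tendsto' hlim2 hlim hlow2

/-- Unique solvability of `∫ w |Du|^(p-2) Du Dv = ℓ v` for all `v`. -/
theorem existsUnique_weightedForm_eq (hp : 1 < p) (hinj : Function.Injective D)
    (hcl : IsClosed (Set.range D)) {c C K : ℝ} (hc : 0 < c) {w : Ω → ℝ}
    (hw : AEStronglyMeasurable w ρ) (hwc : ∀ x, c ≤ w x) (hwC : ∀ x, |w x| ≤ C)
    (ℓ : V →ₗ[ℝ] ℝ) (hℓ : ∀ v, |ℓ v| ≤ K * ‖D v‖) :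
    ∃! u, ∀ v, weightedForm D w u v = ℓ v := by
  obtain ⟨u, hu⟩ := exists_isMinOn_weightedEnergy hp hcl hc hw hwc hwC ℓ hℓ
  -- Minty's argument instead of differentiating the energy: the tangent at `u + t v` in direction
  -- `-t v`, combined with minimality of `u`, gives the inequality at `u + t v`; then `t → 0`.
  have hle : ∀ v, ℓ v ≤ weightedForm D w u v := fun v => by
    refine ge_of_tendsto (tendsto_weightedForm_line hp hw hwC u v) ?_
    filter_upwards [self_mem_nhdsWithin] with t ht
    have ht : 0 < t := ht
    have h1 := weightedEnergy_tangent_le (D := D) hp hw (fun x => hc.le.trans (hwc x)) hwC ℓ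
      (u + t • v) ((-t) • v)
    rw [weightedForm_smul_right, map_smul, neg_smul t v, add_neg_cancel_right, smul_eq_mul] at h1
    have h2 := hu (u + t • v)
    have h3 : t * ℓ v ≤ t * weightedForm D w (u + t • v) v := by linarith
    exact le_of_mul_le_mul_left h3 ht
  have hsol : ∀ v, weightedForm D w u v = ℓ v := fun v => by
    refine le_antisymm ?_ (hle v)
    have h := hle ((-1 : ℝ) • v)
    rw [weightedForm_smul_right, map_smul, smul_eq_mul] at h
    linarith
  refine ⟨u, hsol, fun u' hu' => hinj ?_⟩
  -- Uniqueness is continuous dependence for constant data along a one-point filter.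
  have h := tendsto_of_weightedForm_eq (D := D) (l := pure ()) (c := c) (C := C) (K := K) hp hc
    (w := fun _ => w) (w₀ := w) (ℓ := fun _ => ℓ) (ℓ₀ := ℓ) (u := fun _ => u') (u₀ := u)
    (.of_forall fun _ => ⟨hw, fun x => ⟨hwc x, hwC x⟩⟩) (.of_forall fun _ => hℓ)
    (.of_forall fun _ => hu') hsol
    (fun τ hτ => .of_forall fun _ v => by simp; positivity)
    (fun τ hτ => .of_forall fun _ v => by simp; positivity)
  exact sub_eq_zero.1 (norm_eq_zero.1 (tendsto_nhds_unique tendsto_const_nhds h))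

end Existence

/-! ### Periodic oscillations -/

section Oscillation

variable {E : Type*} [NormedAddCommGroup E] [NormedSpace ℝ E] {ι : Type*}
  {b : Module.Basis ι ℝ E}

/-- The periods of `f` form an additive subgroup, which therefore contains the lattice generated by
the basis. -/
lemma eq_of_mem_span_of_periodic {f : E → ℝ} (hf : ∀ i ζ, f (ζ + b i) = f ζ) {v : E}
    (hv : v ∈ Submodule.span ℤ (Set.range b)) (ζ : E) : f (v + ζ) = f ζ := by
  let Q : AddSubgroup E :=
    { carrier := {v | ∀ ζ, f (v + ζ) = f ζ}
      add_mem' := fun {v w} hv hw ζ => by rw [add_assoc, hv, hw]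
      zero_mem' := fun ζ => by rw [zero_add]
      neg_mem' := fun {v} hv ζ => by rw [← hv (-v + ζ), add_neg_cancel_left] }
  have hQ : Submodule.span ℤ (Set.range b) ≤ AddSubgroup.toIntSubmodule Q := by
    rw [Submodule.span_le]
    rintro _ ⟨i, rfl⟩ ζ
    rw [add_comm, hf]
  exact hQ hv ζ

lemma fract_eq_sum [Fintype ι] (x : E) : ZSpan.fract b x = ∑ i, Int.fract (b.repr x i) • b i := by
  refine b.ext_elem fun i => ?_
  classical
  rw [ZSpan.repr_fract_apply, b.repr_sum_self]

variable [MeasurableSpace E] [BorelSpace E] {μ : Measure E}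

lemma measurable_zspan_fract [Fintype ι] [FiniteDimensional ℝ E] : Measurable (ZSpan.fract b) := by
  have : (ZSpan.fract b) = fun x => ∑ i, Int.fract (b.repr x i) • b i := funext fract_eq_sum
  rw [this]
  refine Finset.measurable_sum _ fun i _ => ?_
  have h : Measurable fun x => b.repr x i :=
    ((b.coord i).continuous_of_finiteDimensional).measurable
  exact (measurable_fract.comp h).smul_const (b i)

/-- A function `A z ζ` which is continuous in `z`, measurable in `ζ`, periodic in `ζ` with respect
to a basis, and bounded. -/
structure IsOscillating (μ : Measure E) (b : Module.Basis ι ℝ E) (C : ℝ) (A : E → E → ℝ) :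
    Prop where
  cont : ∀ ζ, Continuous fun z => A z ζ
  meas : ∀ z, AEMeasurable (A z) μ
  periodic : ∀ z i ζ, A z (ζ + b i) = A z ζ
  bound : ∀ z ζ, |A z ζ| ≤ C

variable [FiniteDimensional ℝ E]

/-- Each slice `A z` is measurable only up to a null set that may depend on `z`. Continuity in `z`
allows one exceptional set for all `z`: the union over a countable dense set of slices. Off it, `A`
agrees with a jointly measurable function, so that `A z (z/ε)` can be handled. -/
lemma exists_measurable_modification {A : E → E → ℝ} (hc : ∀ ζ, Continuous fun z => A z ζ)
    (hm : ∀ z, AEMeasurable (A z) μ) :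
    ∃ (T : Set E) (B : E → E → ℝ), MeasurableSet T ∧ μ T = 0 ∧ Measurable (Function.uncurry B) ∧
      ∀ ζ ∉ T, ∀ z, A z ζ = B z ζ := by
  classical
  let q := TopologicalSpace.denseSeq E
  let N : Set E := ⋃ n, {ζ | A (q n) ζ ≠ (hm (q n)).mk _ ζ}
  have hN : μ N = 0 := measure_iUnion_null fun n => (hm (q n)).ae_eq_mk
  let T := toMeasurable μ N
  have hT : MeasurableSet T := measurableSet_toMeasurable _ _
  let B : E → E → ℝ := fun z => Tᶜ.indicator (A z)
  have hBc : ∀ ζ, Continuous fun z => B z ζ := fun ζ => by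
    by_cases hζ : ζ ∈ Tᶜ
    · simpa only [B, Set.indicator_of_mem hζ] using hc ζ
    · simpa only [B, Set.indicator_of_notMem hζ] using continuous_const
  have hBq : ∀ n, Measurable (B (q n)) := fun n => by
    have : B (q n) = Tᶜ.indicator ((hm (q n)).mk _) := by
      refine Set.indicator_congr fun ζ hζ => ?_
      by_contra hne
      exact hζ (subset_toMeasurable μ N (Set.mem_iUnion.2 ⟨n, hne⟩))
    rw [this]
    exact (hm (q n)).measurable_mk.indicator hT.compl
  have hBm : ∀ z, Measurable (B z) := fun z => by
    obtain ⟨s, hs, hlim⟩ := mem_closure_iff_seq_limit.1 (TopologicalSpace.denseRange_denseSeq E z)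
    refine measurable_of_tendsto_metrizable (f := fun n => B (s n)) (fun n => ?_)
      (tendsto_pi_nhds.2 fun ζ => ((hBc ζ).tendsto z).comp hlim)
    obtain ⟨k, hk⟩ := hs n
    rw [← hk]
    exact hBq k
  refine ⟨T, B, hT, (measure_toMeasurable N).trans hN, ?_, fun ζ hζ z => ?_⟩
  · exact (stronglyMeasurable_uncurry_of_continuous_of_stronglyMeasurable hBc
      fun z => (hBm z).stronglyMeasurable).measurable
  · exact (Set.indicator_of_mem (show ζ ∈ Tᶜ from hζ) _).symm

variable [μ.IsAddHaarMeasure]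

/-- A translate of the fundamental domain is again one, and a periodic function has the same
integral over all of them. -/
lemma setIntegral_fundamentalDomain_add [Fintype ι] {P : E → ℝ} (hP : ∀ i ζ, P (ζ + b i) = P ζ) (s : E) :
    ∫ y in ZSpan.fundamentalDomain b, P (s + y) ∂μ = ∫ y in ZSpan.fundamentalDomain b, P y ∂μ := by
  have : VAddInvariantMeasure (Submodule.span ℤ (Set.range b)) E μ :=
    ⟨fun c s _ => measure_preimage_add μ (c : E) s⟩
  have h1 := ZSpan.isAddFundamentalDomain b μ
  have h2 := h1.vadd_of_comm s
  rw [← h2.setIntegral_eq h1 (f := P) fun g x => eq_of_mem_span_of_periodic hP g.2 x]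
  exact ((measurePreserving_add_left μ s).setIntegral_image_emb
    (measurableEmbedding_addLeft s) P _).symm

lemma measure_smul_add_preimage {ε : ℝ} (hε : ε ≠ 0) (y : E) {T : Set E} (hT : μ T = 0) :
    μ {z | ε⁻¹ • z + y ∈ T} = 0 := by
  have : {z | ε⁻¹ • z + y ∈ T} = (ε⁻¹ • ·) ⁻¹' ((· + y) ⁻¹' T) := rfl
  rw [this, Measure.addHaar_preimage_smul μ (inv_ne_zero hε), measure_preimage_add_right, hT,
    mul_zero]

/-! ### Unfolding and weak-* convergence of oscillating functions. -/

namespace IsOscillating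

variable {C : ℝ} {A : E → E → ℝ}

/-- Dilation preserves null sets, so the exceptional set of the modification is avoided by `ε⁻¹ • z`
for almost every `z`. -/
lemma aestronglyMeasurable_diag (hA : IsOscillating μ b C A) {ε : ℝ} (hε : ε ≠ 0) :
    AEStronglyMeasurable (fun z => A z (ε⁻¹ • z)) μ := by
  obtain ⟨T, B, hT, hT0, hB, hAB⟩ := exists_measurable_modification hA.cont hA.meas
  have hBm : Measurable fun z => B z (ε⁻¹ • z) :=
    hB.comp (measurable_id.prodMk (measurable_const_smul _))
  refine hBm.aestronglyMeasurable.congr ?_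
  have h0 := measure_smul_add_preimage (μ := μ) hε 0 hT0
  simp only [add_zero] at h0
  filter_upwards [measure_eq_zero_iff_ae_notMem.1 h0] with z hz
  exact (hAB _ hz z).symm

lemma aestronglyMeasurable_mean (hA : IsOscillating μ b C A) (Y : Set E) :
    AEStronglyMeasurable (fun z => ∫ ζ in Y, A z ζ ∂μ) μ := by
  obtain ⟨T, B, hT, hT0, hB, hAB⟩ := exists_measurable_modification hA.cont hA.meas
  have h : (fun z => ∫ ζ in Y, A z ζ ∂μ) = fun z => ∫ ζ in Y, B z ζ ∂μ := by
    funext z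
    refine integral_congr_ae (ae_restrict_of_ae ?_)
    filter_upwards [measure_eq_zero_iff_ae_notMem.1 hT0] with ζ hζ
    exact hAB ζ hζ z
  rw [h]
  exact (hB.stronglyMeasurable.integral_prod_right (ν := μ.restrict Y)).aestronglyMeasurable

lemma ae_notMem_smul_add {Y T : Set E} {ε : ℝ} (hε : ε ≠ 0) (hT : MeasurableSet T)
    (hT0 : μ T = 0) : ∀ᵐ x ∂((μ.restrict Y).prod μ), ε⁻¹ • x.2 + x.1 ∉ T := by
  have hm : MeasurableSet {x : E × E | ε⁻¹ • x.2 + x.1 ∈ T} :=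
    ((measurable_snd.const_smul _).add measurable_fst) hT
  refine measure_eq_zero_iff_ae_notMem.1 ((Measure.measure_prod_null hm).2 ?_)
  exact .of_forall fun y => measure_smul_add_preimage hε y hT0

variable [Fintype ι]

/-- The unfolding identity for `∫ F (z, z/ε) dz`, where `F z ζ = A z ζ * g z`. -/
lemma integral_unfold (hA : IsOscillating μ b C A) (hY : μ (ZSpan.fundamentalDomain b) = 1)
    {g : E → ℝ} (hg : Continuous g) (hgs : HasCompactSupport g) {ε : ℝ} (hε : 0 < ε) :
    ∫ z, A z (ε⁻¹ • z) * g z ∂μ = ∫ z, ∫ ζ in ZSpan.fundamentalDomain b,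
      A (z + ε • ZSpan.fract b (ζ - ε⁻¹ • z)) ζ * g (z + ε • ZSpan.fract b (ζ - ε⁻¹ • z)) ∂μ ∂μ := by
  set Y := ZSpan.fundamentalDomain b with hYdef
  have : IsFiniteMeasure (μ.restrict Y) := ⟨by simp [hY]⟩
  obtain ⟨T, B, hT, hT0, hB, hAB⟩ := exists_measurable_modification hA.cont hA.meas
  obtain ⟨G, hG⟩ := hgs.exists_bound_of_continuous hg
  have hC : 0 ≤ C := (abs_nonneg _).trans (hA.bound 0 0)
  -- A translation by `ε • y` shifts the fast variable by `y`. Averaging over `y` in the cell then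
  -- decouples the two variables.
  have hshift : ∀ y, ∫ z, A z (ε⁻¹ • z) * g z ∂μ =
      ∫ z, A (z + ε • y) (ε⁻¹ • z + y) * g (z + ε • y) ∂μ := fun y => by
    rw [← integral_add_right_eq_self (fun z => A z (ε⁻¹ • z) * g z) (ε • y)]
    simp only [smul_add, smul_smul, inv_mul_cancel₀ hε.ne', one_smul]
  obtain ⟨R, hR⟩ := hgs.isCompact.isBounded.subset_closedBall (0 : E)
  set r := ∑ i, ‖b i‖
  have hint : Integrable (fun x : E × E => A (x.2 + ε • x.1) (ε⁻¹ • x.2 + x.1) *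
      g (x.2 + ε • x.1)) ((μ.restrict Y).prod μ) := by
    -- The cell lies in the ball of radius `r`, so the shifts by `ε • y` enlarge the support of `g`
    -- by at most `ε * r`.
    have hdom : Integrable (fun x : E × E => (1 : ℝ) *
        (Metric.closedBall (0 : E) (R + ε * r)).indicator (fun _ => C * G) x.2)
        ((μ.restrict Y).prod μ) := by
      refine (integrable_const (1 : ℝ)).mul_prod ?_
      exact (integrable_indicator_iff measurableSet_closedBall).2
        (integrableOn_const measure_closedBall_lt_top.ne)
    refine hdom.mono' ?_ ?_
    · have hm : Measurable fun x : E × E => B (x.2 + ε • x.1) (ε⁻¹ • x.2 + x.1) *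
          g (x.2 + ε • x.1) := by
        refine Measurable.mul ?_ (hg.measurable.comp (by fun_prop))
        exact hB.comp (Measurable.prodMk (by fun_prop) (by fun_prop))
      refine hm.aestronglyMeasurable.congr ?_
      filter_upwards [ae_notMem_smul_add hε.ne' hT hT0] with x hx
      rw [hAB _ hx]
    · have hmem : ∀ᵐ x ∂((μ.restrict Y).prod μ), x.1 ∈ Y :=
        Measure.quasiMeasurePreserving_fst.ae
          (ae_restrict_mem (ZSpan.fundamentalDomain_measurableSet b))
      filter_upwards [hmem] with x hx
      rw [one_mul, norm_mul]
      by_cases hz : x.2 ∈ Metric.closedBall (0 : E) (R + ε * r)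
      · rw [Set.indicator_of_mem hz]
        exact mul_le_mul (hA.bound _ _) (hG _) (norm_nonneg _) hC
      · have h0 : g (x.2 + ε • x.1) = 0 := by
          by_contra hne
          have h1 := hR (subset_tsupport g hne)
          apply hz
          rw [mem_closedBall_zero_iff] at h1 ⊢
          have h2 : ‖x.1‖ ≤ r := by
            rw [← ZSpan.fract_eq_self.2 hx]
            exact ZSpan.norm_fract_le b _
          calc ‖x.2‖ = ‖(x.2 + ε • x.1) - ε • x.1‖ := by rw [add_sub_cancel_right]
            _ ≤ ‖x.2 + ε • x.1‖ + ‖ε • x.1‖ := norm_sub_le _ _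
            _ ≤ R + ε * r := by
              rw [norm_smul, Real.norm_of_nonneg hε.le]
              gcongr
        rw [h0, norm_zero, mul_zero]
        exact Set.indicator_nonneg (fun _ _ => mul_nonneg hC ((norm_nonneg _).trans (hG 0))) _
  calc ∫ z, A z (ε⁻¹ • z) * g z ∂μ = ∫ _ in Y, ∫ z, A z (ε⁻¹ • z) * g z ∂μ ∂μ := by
        rw [setIntegral_const, measureReal_def, hY]; simp
    _ = ∫ y in Y, ∫ z, A (z + ε • y) (ε⁻¹ • z + y) * g (z + ε • y) ∂μ ∂μ := by
        simp only [← hshift]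
    _ = ∫ z, ∫ y in Y, A (z + ε • y) (ε⁻¹ • z + y) * g (z + ε • y) ∂μ ∂μ :=
        integral_integral_swap hint
    _ = _ := by
        congr 1
        funext z
        -- Substitution `ζ = ε⁻¹ • z + y`: for `y` in the cell, `y` is the fractional part of `ζ -
        -- ε⁻¹ • z`, which makes the integrand periodic in `ζ`.
        rw [← setIntegral_fundamentalDomain_add (b := b) (μ := μ) (s := ε⁻¹ • z) (P := fun ζ =>
          A (z + ε • ZSpan.fract b (ζ - ε⁻¹ • z)) ζ * g (z + ε • ZSpan.fract b (ζ - ε⁻¹ • z)))]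
        · refine setIntegral_congr_fun (ZSpan.fundamentalDomain_measurableSet b) fun y hy => ?_
          simp only [add_sub_cancel_left, ZSpan.fract_eq_self.2 hy]
        · intro i ζ
          have : ζ + b i - ε⁻¹ • z = (ζ - ε⁻¹ • z) + b i := by abel
          simp only [this, ZSpan.fract_add_ZSpan b _ (Submodule.subset_span ⟨i, rfl⟩),
            hA.periodic]

/-- After unfolding, `ε` occurs only in the slow argument, which differs from `z` by at most `ε *
r`. Continuity in `z` and dominated convergence then suffice, although `A` is only measurable in the
fast variable. -/
lemma tendsto_integral_of_continuous (hA : IsOscillating μ b C A)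
    (hY : μ (ZSpan.fundamentalDomain b) = 1)
    {g : E → ℝ} (hg : Continuous g) (hgs : HasCompactSupport g) :
    Tendsto (fun ε : ℝ => ∫ z, A z (ε⁻¹ • z) * g z ∂μ) (𝓝[>] 0)
      (𝓝 (∫ z, (∫ ζ in ZSpan.fundamentalDomain b, A z ζ ∂μ) * g z ∂μ)) := by
  set Y := ZSpan.fundamentalDomain b with hYdef
  have : IsFiniteMeasure (μ.restrict Y) := ⟨by simp [hY]⟩
  obtain ⟨T, B, hT, hT0, hB, hAB⟩ := exists_measurable_modification hA.cont hA.meas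
  obtain ⟨G, hG⟩ := hgs.exists_bound_of_continuous hg
  have hC : 0 ≤ C := (abs_nonneg _).trans (hA.bound 0 0)
  obtain ⟨R, hR⟩ := hgs.isCompact.isBounded.subset_closedBall (0 : E)
  set r := ∑ i, ‖b i‖
  set S : ℝ → E × E → E := fun ε x => x.1 + ε • ZSpan.fract b (x.2 - ε⁻¹ • x.1)
  have hS : ∀ ε, Measurable (S ε) := fun ε =>
    measurable_fst.add ((measurable_zspan_fract.comp (by fun_prop)).const_smul ε)
  have hSn : ∀ ε x, ‖S ε x - x.1‖ ≤ |ε| * r := fun ε x => by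
    simp only [S, add_sub_cancel_left, norm_smul, Real.norm_eq_abs]
    exact mul_le_mul_of_nonneg_left (ZSpan.norm_fract_le b _) (abs_nonneg _)
  have hSlim : ∀ x, Tendsto (fun ε => S ε x) (𝓝[>] 0) (𝓝 x.1) := fun x => by
    rw [tendsto_iff_norm_sub_tendsto_zero]
    have h0 : Tendsto (fun ε : ℝ => |ε| * r) (𝓝[>] 0) (𝓝 0) := by
      have : Continuous fun ε : ℝ => |ε| * r := by fun_prop
      simpa using (this.tendsto 0).mono_left nhdsWithin_le_nhds
    exact squeeze_zero (fun _ => norm_nonneg _) (fun ε => hSn ε x) h0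
  set π := μ.prod (μ.restrict Y)
  have hae : ∀ᵐ x ∂π, x.2 ∉ T := Measure.quasiMeasurePreserving_snd.ae
    (ae_restrict_of_ae (measure_eq_zero_iff_ae_notMem.1 hT0))
  have hdom : Integrable (fun x : E × E =>
      (Metric.closedBall (0 : E) (R + r)).indicator (fun _ => C * G) x.1 * (1 : ℝ)) π := by
    refine Integrable.mul_prod ?_ (integrable_const (1 : ℝ))
    exact (integrable_indicator_iff measurableSet_closedBall).2
      (integrableOn_const measure_closedBall_lt_top.ne)
  have hmeas : ∀ ε, AEStronglyMeasurable (fun x => A (S ε x) x.2 * g (S ε x)) π := fun ε => by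
    have hm : Measurable fun x : E × E => B (S ε x) x.2 * g (S ε x) :=
      (hB.comp ((hS ε).prodMk measurable_snd)).mul (hg.measurable.comp (hS ε))
    refine hm.aestronglyMeasurable.congr ?_
    filter_upwards [hae] with x hx
    rw [hAB _ hx]
  have hbound : ∀ ε, |ε| ≤ 1 → ∀ x, ‖A (S ε x) x.2 * g (S ε x)‖ ≤
      (Metric.closedBall (0 : E) (R + r)).indicator (fun _ => C * G) x.1 * (1 : ℝ) := by
    intro ε hε x
    rw [mul_one, norm_mul]
    by_cases hz : x.1 ∈ Metric.closedBall (0 : E) (R + r)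
    · rw [Set.indicator_of_mem hz]
      exact mul_le_mul (hA.bound _ _) (hG _) (norm_nonneg _) hC
    · have h0 : g (S ε x) = 0 := by
        by_contra hne
        have h1 := hR (subset_tsupport g hne)
        apply hz
        rw [mem_closedBall_zero_iff] at h1 ⊢
        have hr : 0 ≤ r := Finset.sum_nonneg fun _ _ => norm_nonneg _
        have h2 := (hSn ε x).trans (mul_le_of_le_one_left hr hε)
        calc ‖x.1‖ = ‖S ε x - (S ε x - x.1)‖ := by rw [sub_sub_cancel]
          _ ≤ ‖S ε x‖ + ‖S ε x - x.1‖ := norm_sub_le _ _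
          _ ≤ R + r := add_le_add h1 h2
      rw [h0, norm_zero, mul_zero]
      exact Set.indicator_nonneg (fun _ _ => mul_nonneg hC ((norm_nonneg _).trans (hG 0))) _
  have hsmall : ∀ᶠ ε : ℝ in 𝓝[>] 0, 0 < ε ∧ |ε| ≤ 1 := by
    filter_upwards [Ioc_mem_nhdsGT (show (0 : ℝ) < 1 by norm_num)] with t ht
    exact ⟨ht.1, by rw [abs_of_pos ht.1]; exact ht.2⟩
  have hlim : Tendsto (fun ε : ℝ => ∫ x, A (S ε x) x.2 * g (S ε x) ∂π) (𝓝[>] 0)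
      (𝓝 (∫ x, A x.1 x.2 * g x.1 ∂π)) := by
    refine tendsto_integral_filter_of_dominated_convergence _ (.of_forall hmeas) ?_ hdom ?_
    · filter_upwards [hsmall] with ε hε
      exact .of_forall (hbound ε hε.2)
    · exact .of_forall fun x => (((hA.cont x.2).tendsto _).comp (hSlim x)).mul
        ((hg.tendsto _).comp (hSlim x))
  -- The limit integrand is the case `ε = 0`, so its measurability and its bound are already
  -- available.
  have hS0 : ∀ x, S 0 x = x.1 := fun x => by simp [S]
  have hlast : ∫ x, A x.1 x.2 * g x.1 ∂π = ∫ z, (∫ ζ in Y, A z ζ ∂μ) * g z ∂μ := by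
    rw [integral_prod]
    · simp only [integral_mul_const]
    · have hm := hmeas 0
      have hb := hbound 0 (by simp)
      simp only [hS0] at hm hb
      exact hdom.mono' hm (.of_forall hb)
  rw [← hlast]
  refine hlim.congr' ?_
  filter_upwards [hsmall] with ε hε
  rw [hA.integral_unfold hY hg hgs hε.1,
    integral_prod _ (hdom.mono' (hmeas ε) (.of_forall (hbound ε hε.2)))]

/-- Weak-* convergence of `A (z, z/ε)` to the mean of `A z` over a period. -/
theorem tendsto_integral (hA : IsOscillating μ b C A) (hY : μ (ZSpan.fundamentalDomain b) = 1)
    {g : E → ℝ} (hg : Integrable g μ) :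
    Tendsto (fun ε : ℝ => ∫ z, (A z (ε⁻¹ • z) - ∫ ζ in ZSpan.fundamentalDomain b, A z ζ ∂μ)
      * g z ∂μ) (𝓝[>] 0) (𝓝 0) := by
  have : IsProbabilityMeasure (μ.restrict (ZSpan.fundamentalDomain b)) := ⟨by simp [hY]⟩
  have hC : 0 ≤ C := (abs_nonneg _).trans (hA.bound 0 0)
  set M : E → ℝ := fun z => ∫ ζ in ZSpan.fundamentalDomain b, A z ζ ∂μ
  have hM : ∀ z, |M z| ≤ C := fun z => by
    have := norm_integral_le_of_norm_le_const (μ := μ.restrict (ZSpan.fundamentalDomain b))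
      (f := A z) (C := C) (.of_forall (hA.bound z))
    simpa using this
  have hMm : AEStronglyMeasurable M μ := hA.aestronglyMeasurable_mean _
  have hint : ∀ ε : ℝ, 0 < ε → ∀ h : E → ℝ, Integrable h μ →
      Integrable (fun z => (A z (ε⁻¹ • z) - M z) * h z) μ := fun ε hε h hh =>
    hh.bdd_mul ((hA.aestronglyMeasurable_diag hε.ne').sub hMm) (c := C + C)
      (.of_forall fun z => (norm_sub_le _ _).trans (add_le_add (hA.bound _ _) (hM z)))
  rw [Metric.tendsto_nhds]
  intro τ hτ
  -- Approximation in `L¹` by a compactly supported continuous function; the tolerance accounts for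
  -- `|A - M| ≤ 2 * C`.
  obtain ⟨h, hhs, hgh, hhc, hhi⟩ := hg.exists_hasCompactSupport_integral_sub_le
    (show 0 < τ / (2 * (2 * C + 1)) by positivity)
  have hlim := hA.tendsto_integral_of_continuous hY hhc hhs
  have hlim2 := (Metric.tendsto_nhds.1 hlim) (τ / 2) (by positivity)
  filter_upwards [hlim2, self_mem_nhdsWithin] with ε hε hε0
  have hε0 : 0 < ε := hε0
  rw [dist_zero_right]
  have i1 : Integrable (fun z => A z (ε⁻¹ • z) * h z) μ :=
    hhi.bdd_mul (hA.aestronglyMeasurable_diag hε0.ne') (.of_forall fun z => hA.bound _ _)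
  have i2 : Integrable (fun z => M z * h z) μ := hhi.bdd_mul hMm (.of_forall hM)
  have e1 : ∫ z, (A z (ε⁻¹ • z) - M z) * g z ∂μ =
      (∫ z, (A z (ε⁻¹ • z) - M z) * (g z - h z) ∂μ) +
        ((∫ z, A z (ε⁻¹ • z) * h z ∂μ) - ∫ z, M z * h z ∂μ) := by
    rw [← integral_sub i1 i2, ← integral_add (by exact hint ε hε0 _ (hg.sub hhi))
      (by exact i1.sub i2)]
    congr 1; funext z; ring
  rw [e1]
  refine (norm_add_le _ _).trans_lt ?_
  have e2 : ‖∫ z, (A z (ε⁻¹ • z) - M z) * (g z - h z) ∂μ‖ ≤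
      2 * C * (τ / (2 * (2 * C + 1))) := by
    refine (norm_integral_le_integral_norm _).trans ?_
    refine le_trans ?_ (mul_le_mul_of_nonneg_left hgh (by positivity))
    rw [← integral_const_mul]
    refine integral_mono (hint ε hε0 _ (hg.sub hhi)).norm ((hg.sub hhi).norm.const_mul _)
      fun z => ?_
    simp only [norm_mul]
    refine mul_le_mul_of_nonneg_right ?_ (norm_nonneg _)
    exact (norm_sub_le _ _).trans (by
      have := hA.bound z (ε⁻¹ • z)
      have := hM z
      simp only [Real.norm_eq_abs]; linarith)
  have e3 : 2 * C * (τ / (2 * (2 * C + 1))) ≤ τ / 2 := by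
    rw [mul_div_assoc', div_le_div_iff₀ (by positivity) (by positivity)]
    nlinarith
  rw [dist_eq_norm] at hε
  linarith

end IsOscillating

end Oscillation

/-! ### The fractional Sobolev space as a closed subspace of an `L^p` space -/

section SobolevSpace

variable {d : ℕ} {α p : ℝ}

/-- The density `|x - y|^(-d-α)`. -/
def singularKernel (α : ℝ) (z : Rd d × Rd d) : NNReal :=
  Real.toNNReal (‖z.1 - z.2‖ ^ ((d : ℝ) + α))⁻¹

lemma coe_singularKernel (α : ℝ) (z : Rd d × Rd d) :
    (singularKernel α z : ℝ) = (‖z.1 - z.2‖ ^ ((d : ℝ) + α))⁻¹ :=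
  Real.coe_toNNReal _ (by positivity)

lemma measurable_singularKernel (α : ℝ) : Measurable (singularKernel (d := d) α) := by
  unfold singularKernel; fun_prop

/-- The measure `|x - y|^(-d-α) dx dy`. -/
def gagliardoMeasure (d : ℕ) (α : ℝ) : Measure (Rd d × Rd d) :=
  volume.withDensity fun z => (singularKernel α z : ENNReal)

lemma gagliardoMeasure_absolutelyContinuous : gagliardoMeasure d α ≪ volume :=
  withDensity_absolutelyContinuous _ _

lemma integral_gagliardoMeasure (g : Rd d × Rd d → ℝ) :
    ∫ z, g z ∂(gagliardoMeasure d α) = ∫ z, (‖z.1 - z.2‖ ^ ((d : ℝ) + α))⁻¹ * g z := by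
  rw [gagliardoMeasure, integral_withDensity_eq_integral_smul (measurable_singularKernel α)]
  simp only [NNReal.smul_def, coe_singularKernel, smul_eq_mul]

/-- The difference `u y - u x`. -/
def increment (u : Rd d → ℝ) (z : Rd d × Rd d) : ℝ := u z.2 - u z.1

lemma increment_ae_eq {u v : Rd d → ℝ} (h : u =ᵐ[volume] v) :
    increment u =ᵐ[gagliardoMeasure d α] increment v := by
  have h1 : ∀ᵐ z : Rd d × Rd d, u z.1 = v z.1 := Measure.quasiMeasurePreserving_fst.ae h
  have h2 : ∀ᵐ z : Rd d × Rd d, u z.2 = v z.2 := Measure.quasiMeasurePreserving_snd.ae h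
  refine gagliardoMeasure_absolutelyContinuous.ae_le ?_
  filter_upwards [h1, h2] with z hz1 hz2
  rw [increment, hz1, hz2, increment]

lemma aestronglyMeasurable_increment {u : Rd d → ℝ} (hu : AEStronglyMeasurable u volume) :
    AEStronglyMeasurable (increment u) volume :=
  (hu.comp_quasiMeasurePreserving Measure.quasiMeasurePreserving_snd).sub
    (hu.comp_quasiMeasurePreserving Measure.quasiMeasurePreserving_fst)

lemma gagliardoEnergy_eq (u : Rd d → ℝ) : gagliardoEnergy α p u =
    ∫⁻ z, ENNReal.ofReal (|increment u z| ^ p) ∂(gagliardoMeasure d α) := by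
  rw [gagliardoMeasure, lintegral_withDensity_eq_lintegral_mul_non_measurable _
    (measurable_singularKernel α).coe_nnreal_ennreal (.of_forall fun z => ENNReal.coe_lt_top)]
  refine lintegral_congr fun z => ?_
  rw [Pi.mul_apply, singularKernel, ← ENNReal.ofReal, ← ENNReal.ofReal_mul (by positivity),
    div_eq_inv_mul]
  rfl

/-- This turns the Sobolev condition into membership of the increment in an `L^p` space, where
Hölder's inequality and completeness apply. -/
lemma memLp_increment_iff (hp : 0 < p) {u : Rd d → ℝ} (hu : AEStronglyMeasurable u volume) :
    MemLp (increment u) (ENNReal.ofReal p) (gagliardoMeasure d α) ↔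
      gagliardoEnergy α p u < ⊤ := by
  have hm := (aestronglyMeasurable_increment hu).mono_ac
    (gagliardoMeasure_absolutelyContinuous (α := α))
  rw [memLp_iff_integrable_abs_rpow hp hm, gagliardoEnergy_eq]
  have hm2 : AEStronglyMeasurable (fun z => |increment u z| ^ p) (gagliardoMeasure d α) :=
    ((continuous_abs.rpow_const fun _ => Or.inr hp.le).comp_aestronglyMeasurable hm)
  rw [lt_top_iff_ne_top, lintegral_ofReal_ne_top_iff_integrable hm2
    (.of_forall fun z => by positivity)]

lemma integral_increment_eq (hp : 0 < p) {u : Rd d → ℝ} (hu : AEStronglyMeasurable u volume) :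
    ∫ z, |increment u z| ^ p ∂(gagliardoMeasure d α) = (gagliardoEnergy α p u).toReal := by
  have hm := (aestronglyMeasurable_increment hu).mono_ac
    (gagliardoMeasure_absolutelyContinuous (α := α))
  rw [gagliardoEnergy_eq, integral_eq_lintegral_of_nonneg_ae (.of_forall fun z => by positivity)]
  exact (continuous_abs.rpow_const fun _ => Or.inr hp.le).comp_aestronglyMeasurable hm

/-- Lebesgue measure and `|x - y|^(-d-α) dx dy` on the disjoint union `ℝ^d ⊕ ℝ^d × ℝ^d`. -/
def sobolevMeasure (d : ℕ) (α : ℝ) : Measure (Rd d ⊕ (Rd d × Rd d)) :=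
  (volume : Measure (Rd d)).map Sum.inl + (gagliardoMeasure d α).map Sum.inr

lemma measurableEmbedding_inl {X Y : Type*} [MeasurableSpace X] [MeasurableSpace Y] :
    MeasurableEmbedding (Sum.inl : X → X ⊕ Y) :=
  ⟨Sum.inl_injective, measurable_inl, fun _ hs => measurableSet_inl_image.2 hs⟩

lemma measurableEmbedding_inr {X Y : Type*} [MeasurableSpace X] [MeasurableSpace Y] :
    MeasurableEmbedding (Sum.inr : Y → X ⊕ Y) :=
  ⟨Sum.inr_injective, measurable_inr, fun _ hs => measurableSet_inr_image.2 hs⟩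

lemma ae_sobolevMeasure_iff {P : Rd d ⊕ (Rd d × Rd d) → Prop} :
    (∀ᵐ x ∂(sobolevMeasure d α), P x) ↔
      (∀ᵐ x, P (Sum.inl x)) ∧ ∀ᵐ z ∂(gagliardoMeasure d α), P (Sum.inr z) := by
  rw [sobolevMeasure, ae_add_measure_iff, measurableEmbedding_inl.ae_map_iff,
    measurableEmbedding_inr.ae_map_iff]

lemma aestronglyMeasurable_sobolevMeasure_iff {F : Rd d ⊕ (Rd d × Rd d) → ℝ} :
    AEStronglyMeasurable F (sobolevMeasure d α) ↔
      AEStronglyMeasurable (fun x => F (Sum.inl x)) volume ∧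
        AEStronglyMeasurable (fun z => F (Sum.inr z)) (gagliardoMeasure d α) := by
  rw [sobolevMeasure, aestronglyMeasurable_add_measure_iff,
    measurableEmbedding_inl.aestronglyMeasurable_map_iff,
    measurableEmbedding_inr.aestronglyMeasurable_map_iff]
  rfl

lemma integrable_sobolevMeasure_iff {F : Rd d ⊕ (Rd d × Rd d) → ℝ} :
    Integrable F (sobolevMeasure d α) ↔
      Integrable (fun x => F (Sum.inl x)) volume ∧
        Integrable (fun z => F (Sum.inr z)) (gagliardoMeasure d α) := by
  rw [sobolevMeasure, integrable_add_measure, measurableEmbedding_inl.integrable_map_iff,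
    measurableEmbedding_inr.integrable_map_iff]
  rfl

lemma integral_sobolevMeasure {F : Rd d ⊕ (Rd d × Rd d) → ℝ}
    (hF : Integrable F (sobolevMeasure d α)) :
    ∫ x, F x ∂(sobolevMeasure d α) =
      (∫ x, F (Sum.inl x)) + ∫ z, F (Sum.inr z) ∂(gagliardoMeasure d α) := by
  have h := hF
  rw [sobolevMeasure, integrable_add_measure] at h
  rw [sobolevMeasure, integral_add_measure h.1 h.2, measurableEmbedding_inl.integral_map,
    measurableEmbedding_inr.integral_map]

lemma memLp_sobolevMeasure_iff (hp : 0 < p) {F : Rd d ⊕ (Rd d × Rd d) → ℝ} :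
    MemLp F (ENNReal.ofReal p) (sobolevMeasure d α) ↔
      MemLp (fun x => F (Sum.inl x)) (ENNReal.ofReal p) volume ∧
        MemLp (fun z => F (Sum.inr z)) (ENNReal.ofReal p) (gagliardoMeasure d α) := by
  by_cases hF : AEStronglyMeasurable F (sobolevMeasure d α)
  · have h := aestronglyMeasurable_sobolevMeasure_iff.1 hF
    rw [memLp_iff_integrable_abs_rpow hp hF, memLp_iff_integrable_abs_rpow hp h.1,
      memLp_iff_integrable_abs_rpow hp h.2, integrable_sobolevMeasure_iff]
  · refine ⟨fun h => absurd h.1 hF, fun h => absurd ?_ hF⟩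
    exact aestronglyMeasurable_sobolevMeasure_iff.2 ⟨h.1.1, h.2.1⟩

/-- The function `u` on `ℝ^d` together with its increments on `ℝ^d × ℝ^d`. -/
def withIncrement (u : Rd d → ℝ) : Rd d ⊕ (Rd d × Rd d) → ℝ := Sum.elim u (increment u)

lemma withIncrement_ae_eq {u v : Rd d → ℝ} (h : u =ᵐ[volume] v) :
    withIncrement u =ᵐ[sobolevMeasure d α] withIncrement v :=
  ae_sobolevMeasure_iff.2 ⟨h, increment_ae_eq h⟩

lemma memLp_withIncrement {hp : 1 < p} (u : Sobolev d α p hp) :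
    MemLp (withIncrement u.1) (ENNReal.ofReal p) (sobolevMeasure d α) :=
  (memLp_sobolevMeasure_iff (by linarith)).2
    ⟨Lp.memLp u.1, (memLp_increment_iff (by linarith) (Lp.memLp u.1).1).2 u.2⟩

/-- Taken from the definition of the norm, so that no instance of `Fact (1 ≤ q)` is required. -/
lemma Lp_norm_nonneg {Ω : Type*} [MeasurableSpace Ω] {ρ : Measure Ω} {q : ENNReal}
    {u : Lp ℝ q ρ} : 0 ≤ ‖u‖ := ENNReal.toReal_nonneg

/-- The embedding `u ↦ (u, u y - u x)` of the Sobolev space into an `L^p` space. -/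
def sobolevEmbedding (d : ℕ) (α p : ℝ) (hp : 1 < p) :
    Sobolev d α p hp →ₗ[ℝ] Lp ℝ (ENNReal.ofReal p) (sobolevMeasure d α) where
  toFun u := (memLp_withIncrement u).toLp
  map_add' u v := by
    rw [← MemLp.toLp_add]
    refine MemLp.toLp_congr _ _ ((withIncrement_ae_eq (Lp.coeFn_add u.1 v.1)).trans ?_)
    refine .of_forall fun x => ?_
    cases x <;> simp [withIncrement, increment]
    ring
  map_smul' c u := by
    rw [RingHom.id_apply, ← MemLp.toLp_const_smul]
    refine MemLp.toLp_congr _ _ ((withIncrement_ae_eq (Lp.coeFn_smul c u.1)).trans ?_)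
    refine .of_forall fun x => ?_
    cases x <;> simp [withIncrement, increment]
    ring

lemma coeFn_sobolevEmbedding {hp : 1 < p} (u : Sobolev d α p hp) :
    sobolevEmbedding d α p hp u =ᵐ[sobolevMeasure d α] withIncrement u.1 :=
  (memLp_withIncrement u).coeFn_toLp

lemma norm_sobolevEmbedding_rpow {hp : 1 < p} (u : Sobolev d α p hp) :
    ‖sobolevEmbedding d α p hp u‖ ^ p = (∫ x, |u.1 x| ^ p) +
      ∫ z, |increment u.1 z| ^ p ∂(gagliardoMeasure d α) := by
  have hp0 : 0 < p := by linarith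
  have h := integrable_abs_rpow hp0 (memLp_withIncrement u)
  rw [Lp_norm_rpow hp0]
  refine Eq.trans (integral_congr_ae ?_) (integral_sobolevMeasure h)
  filter_upwards [coeFn_sobolevEmbedding u] with x hx
  rw [hx]

lemma norm_sobolevEmbedding {hp : 1 < p} (u : Sobolev d α p hp) :
    ‖sobolevEmbedding d α p hp u‖ = sobolevNorm u := by
  have hp0 : 0 < p := by linarith
  have h := norm_sobolevEmbedding_rpow u
  rw [← Lp_norm_rpow hp0, integral_increment_eq hp0 (Lp.memLp u.1).1] at h
  rw [sobolevNorm, ← h, ← Real.rpow_mul Lp_norm_nonneg, mul_one_div_cancel hp0.ne',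
    Real.rpow_one]

lemma norm_le_norm_sobolevEmbedding {hp : 1 < p} (u : Sobolev d α p hp) :
    (∫ x, |u.1 x| ^ p) ^ (1 / p) ≤ ‖sobolevEmbedding d α p hp u‖ ∧
    (∫ z, |increment u.1 z| ^ p ∂(gagliardoMeasure d α)) ^ (1 / p) ≤
      ‖sobolevEmbedding d α p hp u‖ := by
  have hp0 : 0 < p := by linarith
  have h := norm_sobolevEmbedding_rpow u
  have h1 : 0 ≤ ∫ x, |u.1 x| ^ p := integral_nonneg fun x => by positivity
  have h2 : 0 ≤ ∫ z, |increment u.1 z| ^ p ∂(gagliardoMeasure d α) :=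
    integral_nonneg fun x => by positivity
  have h3 : ‖sobolevEmbedding d α p hp u‖ = (‖sobolevEmbedding d α p hp u‖ ^ p) ^ (1 / p) := by
    rw [← Real.rpow_mul Lp_norm_nonneg, mul_one_div_cancel hp0.ne', Real.rpow_one]
  rw [h3, h]
  constructor <;> exact Real.rpow_le_rpow (by assumption) (by linarith) (by positivity)

lemma injective_sobolevEmbedding {hp : 1 < p} :
    Function.Injective (sobolevEmbedding d α p hp) := by
  intro u v h
  refine Subtype.ext (Lp.ext ?_)
  have h1 := (coeFn_sobolevEmbedding u).symm.trans ((Eq.eventuallyEq (by rw [h])).trans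
    (coeFn_sobolevEmbedding v))
  exact (ae_sobolevMeasure_iff.1 h1).1

/-- Completeness of the Sobolev space in disguise: along an almost everywhere convergent
subsequence, the limit of the increments is the increment of the limit. -/
lemma isClosed_range_sobolevEmbedding {hp : 1 < p} [Fact (1 ≤ ENNReal.ofReal p)] :
    IsClosed (Set.range (sobolevEmbedding d α p hp)) := by
  have hp0 : 0 < p := by linarith
  refine IsSeqClosed.isClosed fun x g hx hg => ?_
  choose u hu using hx
  obtain ⟨ns, -, hns⟩ := (tendstoInMeasure_of_tendsto_Lp hg).exists_seq_tendsto_ae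
  have hall : ∀ᵐ y ∂(sobolevMeasure d α), ∀ n, x n y = withIncrement (u n).1 y := by
    rw [ae_all_iff]
    intro n
    rw [← hu n]
    exact coeFn_sobolevEmbedding (u n)
  have hlim : ∀ᵐ y ∂(sobolevMeasure d α),
      Tendsto (fun k => withIncrement (u (ns k)).1 y) atTop (𝓝 (g y)) := by
    filter_upwards [hns, hall] with y h1 h2
    simpa only [h2] using h1
  obtain ⟨hl, hr⟩ := ae_sobolevMeasure_iff.1 hlim
  obtain ⟨g1, g2⟩ := (memLp_sobolevMeasure_iff hp0).1 (Lp.memLp g)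
  have hl1 : ∀ᵐ z : Rd d × Rd d, Tendsto (fun k => (u (ns k)).1 z.1) atTop
      (𝓝 (g (Sum.inl z.1))) := Measure.quasiMeasurePreserving_fst.ae hl
  have hl2 : ∀ᵐ z : Rd d × Rd d, Tendsto (fun k => (u (ns k)).1 z.2) atTop
      (𝓝 (g (Sum.inl z.2))) := Measure.quasiMeasurePreserving_snd.ae hl
  have hl12 := gagliardoMeasure_absolutelyContinuous (d := d) (α := α) |>.ae_le (hl1.and hl2)
  have hinc : (fun z => g (Sum.inr z)) =ᵐ[gagliardoMeasure d α]
      increment fun x => g (Sum.inl x) := by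
    filter_upwards [hr, hl12] with z h1 h2
    exact tendsto_nhds_unique h1 (h2.2.sub h2.1)
  have hco := g1.coeFn_toLp
  have hmem : g1.toLp ∈ Sobolev d α p hp := by
    refine (memLp_increment_iff hp0 (Lp.memLp _).1).1 ?_
    exact g2.ae_eq (hinc.trans (increment_ae_eq hco).symm)
  refine ⟨⟨g1.toLp, hmem⟩, Lp.ext ((coeFn_sobolevEmbedding _).trans ?_)⟩
  exact ae_sobolevMeasure_iff.2 ⟨hco, (increment_ae_eq hco).trans hinc.symm⟩

/-- The weight on `ℝ^d ⊕ ℝ^d × ℝ^d` belonging to the mass coefficient `ν` and the kernel `a`. -/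
def sumWeight (m : ℝ) (ν : Rd d → ℝ) (a : Rd d × Rd d → ℝ) : Rd d ⊕ (Rd d × Rd d) → ℝ :=
  Sum.elim (fun x => m * ν x) fun z => a z / 2

lemma aestronglyMeasurable_sumWeight (m : ℝ) {ν : Rd d → ℝ} {a : Rd d × Rd d → ℝ}
    (hν : AEStronglyMeasurable ν volume) (ha : AEStronglyMeasurable a volume) :
    AEStronglyMeasurable (sumWeight m ν a) (sobolevMeasure d α) :=
  aestronglyMeasurable_sobolevMeasure_iff.2 ⟨hν.const_mul m, by
    have h := (ha.mul (aestronglyMeasurable_const (b := (2 : ℝ)⁻¹))).mono_ac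
      (gagliardoMeasure_absolutelyContinuous (d := d) (α := α))
    exact h⟩

lemma weightedForm_sobolevEmbedding {hp : 1 < p} {m C : ℝ} {ν : Rd d → ℝ} {a : Rd d × Rd d → ℝ}
    (hν : AEStronglyMeasurable ν volume) (ha : AEStronglyMeasurable a volume)
    (hC : ∀ y, |sumWeight m ν a y| ≤ C) (u v : Sobolev d α p hp) :
    weightedForm (sobolevEmbedding d α p hp) (sumWeight m ν a) u v =
      (∫ x, m * ν x * signedPow p (u.1 x) * v.1 x) +
      ∫ z, a z / 2 * signedPow p (increment u.1 z) * increment v.1 z ∂(gagliardoMeasure d α) := by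
  have hint := integrable_form hp (aestronglyMeasurable_sumWeight m hν ha) hC
    (memLp_withIncrement u) (memLp_withIncrement v)
  refine Eq.trans (integral_congr_ae ?_) (integral_sobolevMeasure hint)
  filter_upwards [coeFn_sobolevEmbedding u, coeFn_sobolevEmbedding v] with x h1 h2
  rw [h1, h2]

/-- The bridge to the abstract problem: the mass term and the energy, with its factor `1/2`, merge
into one form, and the signs move to the source. -/
lemma isWeakSolution_iff {hp : 1 < p} {m C : ℝ} {Λ : Rd d → Rd d → ℝ} {ν f : Rd d → ℝ}
    (hν : AEStronglyMeasurable ν volume)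
    (ha : AEStronglyMeasurable (fun z : Rd d × Rd d => ν z.1 * Λ z.1 z.2) volume)
    (hC : ∀ y, |sumWeight m ν (fun z => ν z.1 * Λ z.1 z.2) y| ≤ C) (u : Sobolev d α p hp) :
    IsWeakSolution m Λ ν f u ↔ ∀ v, weightedForm (sobolevEmbedding d α p hp)
      (sumWeight m ν fun z => ν z.1 * Λ z.1 z.2) u v = -∫ x, ν x * f x * v.1 x := by
  refine forall_congr' fun v => ?_
  rw [weightedForm_sobolevEmbedding hν ha hC, integral_gagliardoMeasure, energyForm,
    ← integral_const_mul, ← integral_const_mul]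
  have e1 : ∀ x, m * (signedPow p (u.1 x) * v.1 x * ν x) =
      m * ν x * signedPow p (u.1 x) * v.1 x := fun x => by ring
  have e2 : ∀ x, f x * v.1 x * ν x = ν x * f x * v.1 x := fun x => by ring
  have e3 : ∀ z : Rd d × Rd d, 1 / 2 * (ν z.1 * Λ z.1 z.2 * signedPow p (u.1 z.2 - u.1 z.1) *
      (v.1 z.2 - v.1 z.1) / ‖z.1 - z.2‖ ^ ((d : ℝ) + α)) =
      (‖z.1 - z.2‖ ^ ((d : ℝ) + α))⁻¹ * (ν z.1 * Λ z.1 z.2 / 2 *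
        signedPow p (increment u.1 z) * increment v.1 z) := fun z => by
    simp only [increment]; ring
  simp only [e1, e2, e3]
  constructor <;> intro h <;> linarith

end SobolevSpace

/-! ### Uniform convergence of weakly convergent functionals on the Sobolev space -/

section UniformConvergence

variable {d : ℕ} {α p : ℝ}

/-- The indicator function of the strip `|x - y| < r`. -/
def strip (r : ℝ) (z : Rd d × Rd d) : ℝ := {z : Rd d × Rd d | dist z.1 z.2 < r}.indicator 1 z

lemma measurable_strip (r : ℝ) : Measurable (strip (d := d) r) :=
  measurable_one.indicator (measurableSet_lt (by fun_prop) measurable_const)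

lemma strip_nonneg (r : ℝ) (z : Rd d × Rd d) : 0 ≤ strip r z :=
  Set.indicator_nonneg (fun _ _ => zero_le_one) _

lemma strip_le_one (r : ℝ) (z : Rd d × Rd d) : strip r z ≤ 1 :=
  Set.indicator_le_self' (fun _ _ => zero_le_one) _

lemma abs_strip_le_one (r : ℝ) (z : Rd d × Rd d) : |strip r z| ≤ 1 := by
  rw [abs_of_nonneg (strip_nonneg r z)]; exact strip_le_one r z

lemma strip_mk_left (r : ℝ) (x : Rd d) :
    (fun y => strip r (x, y)) = (Metric.ball x r).indicator 1 := by
  funext y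
  by_cases h : dist x y < r
  · rw [Set.indicator_of_mem (Metric.mem_ball'.2 h)]; simp [strip, h]
  · rw [Set.indicator_of_notMem fun h' => h (Metric.mem_ball'.1 h')]; simp [strip, h]

lemma strip_mk_right (r : ℝ) (y : Rd d) :
    (fun x => strip r (x, y)) = (Metric.ball y r).indicator 1 := by
  funext x
  by_cases h : dist x y < r
  · rw [Set.indicator_of_mem (Metric.mem_ball.2 h)]; simp [strip, h]
  · rw [Set.indicator_of_notMem fun h' => h (Metric.mem_ball.1 h')]; simp [strip, h]

lemma integral_strip_left (r : ℝ) (x : Rd d) :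
    ∫ y, strip r (x, y) = volume.real (Metric.ball (0 : Rd d) r) := by
  rw [strip_mk_left, integral_indicator_one measurableSet_ball, measureReal_def,
    Measure.addHaar_ball_center, measureReal_def]

lemma integral_strip_mul_right (r : ℝ) (y : Rd d) (B : Rd d → ℝ) :
    ∫ x, strip r (x, y) * B x = ∫ x in Metric.ball y r, B x := by
  rw [← integral_indicator measurableSet_ball]
  congr 1
  funext x
  rw [congrFun (strip_mk_right r y) x]
  by_cases h : x ∈ Metric.ball y r <;> simp [h]

lemma integral_strip_mul_left (r : ℝ) (y : Rd d) (B : Rd d → ℝ) :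
    ∫ x, strip r (y, x) * B x = ∫ x in Metric.ball y r, B x := by
  rw [← integral_strip_mul_right]
  congr 1
  funext x
  rw [congrFun (strip_mk_right r y) x, congrFun (strip_mk_left r y) x]

lemma strip_eq_zero {r R : ℝ} {z : Rd d × Rd d} (h1 : z.1 ∈ Metric.closedBall (0 : Rd d) R)
    (h2 : z.2 ∉ Metric.closedBall (0 : Rd d) (R + r)) : strip r z = 0 := by
  refine Set.indicator_of_notMem (fun h => h2 ?_) _
  rw [mem_closedBall_zero_iff] at h1 ⊢
  have h : dist z.1 z.2 < r := h
  rw [dist_comm, dist_eq_norm] at h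
  have := norm_add_le (z.2 - z.1) z.1
  rw [sub_add_cancel] at this
  linarith

lemma integrableOn_closedBall_of_memLp (hp : 1 < p) {v : Rd d → ℝ}
    (hv : MemLp v (ENNReal.ofReal p) volume) (R : ℝ) :
    IntegrableOn v (Metric.closedBall 0 R) := by
  have : IsFiniteMeasure (volume.restrict (Metric.closedBall (0 : Rd d) R)) :=
    ⟨by simpa using measure_closedBall_lt_top⟩
  exact (hv.restrict _).integrable (by rw [ENNReal.one_le_ofReal]; exact hp.le)

/-- Comparison of `∫ B v` with the integral against averages of `B` over balls. -/
lemma abs_integral_sub_average_le (hα : 0 < α) {hp : 1 < p} {M R r : ℝ} (hr : 0 < r)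
    {B : Rd d → ℝ}
    (hB : AEStronglyMeasurable B volume) (hBM : ∀ x, |B x| ≤ M)
    (hBR : ∀ x ∉ Metric.closedBall (0 : Rd d) R, B x = 0) (v : Sobolev d α p hp) :
    |volume.real (Metric.ball (0 : Rd d) r) * (∫ x, B x * v.1 x)
      - ∫ y, (∫ x in Metric.ball y r, B x) * v.1 y| ≤
    ((r ^ ((d : ℝ) + α)) ^ (p / (p - 1) - 1) * M ^ (p / (p - 1)) *
      (volume.real (Metric.closedBall (0 : Rd d) R) * volume.real (Metric.ball (0 : Rd d) r)))
        ^ (1 / (p / (p - 1))) * ‖sobolevEmbedding d α p hp v‖ := by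
  have hp0 : 0 < p := by linarith
  set q := p / (p - 1) with hq
  have hq1 : 1 < q := by rw [hq, one_lt_div (by linarith)]; linarith
  have hM : 0 ≤ M := (abs_nonneg _).trans (hBM 0)
  have hv := Lp.memLp v.1
  have hB1 : AEStronglyMeasurable (fun z : Rd d × Rd d => B z.1) volume :=
    hB.comp_quasiMeasurePreserving Measure.quasiMeasurePreserving_fst
  have hv1 : AEStronglyMeasurable (fun z : Rd d × Rd d => v.1 z.1) volume :=
    hv.1.comp_quasiMeasurePreserving Measure.quasiMeasurePreserving_fst
  have hv2 : AEStronglyMeasurable (fun z : Rd d × Rd d => v.1 z.2) volume :=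
    hv.1.comp_quasiMeasurePreserving Measure.quasiMeasurePreserving_snd
  have hs := (measurable_strip (d := d) r).aestronglyMeasurable (μ := volume)
  have hballfin : ∀ R' : ℝ, Integrable
      ((Metric.closedBall (0 : Rd d) R').indicator fun _ => (1 : ℝ)) volume := fun R' =>
    (integrable_indicator_iff measurableSet_closedBall).2
      (integrableOn_const measure_closedBall_lt_top.ne)
  have hvball : ∀ R' : ℝ, Integrable ((Metric.closedBall (0 : Rd d) R').indicator v.1) volume :=
    fun R' => (integrable_indicator_iff measurableSet_closedBall).2
      (integrableOn_closedBall_of_memLp hp hv R')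
  have i1 : Integrable (fun z : Rd d × Rd d => strip r z * (B z.1 * v.1 z.1)) volume := by
    have h := (((hvball R).norm.const_mul M).mul_prod (hballfin (R + r)))
    refine h.mono' (hs.mul (hB1.mul hv1)) (.of_forall fun z => ?_)
    by_cases h1 : z.1 ∈ Metric.closedBall (0 : Rd d) R
    · by_cases h2 : z.2 ∈ Metric.closedBall (0 : Rd d) (R + r)
      · rw [Set.indicator_of_mem h1, Set.indicator_of_mem h2, mul_one, norm_mul, norm_mul]
        exact (mul_le_of_le_one_left (by positivity) (abs_strip_le_one r z)).trans
          (mul_le_mul_of_nonneg_right (hBM _) (norm_nonneg _))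
      · rw [strip_eq_zero h1 h2, zero_mul, norm_zero, Set.indicator_of_notMem h2, mul_zero]
    · rw [hBR _ h1, zero_mul, mul_zero, norm_zero, Set.indicator_of_notMem h1]
      simp
  have i2 : Integrable (fun z : Rd d × Rd d => strip r z * B z.1 * v.1 z.2) volume := by
    have h := (((hballfin R).const_mul M).mul_prod (hvball (R + r)).norm)
    refine h.mono' ((hs.mul hB1).mul hv2) (.of_forall fun z => ?_)
    by_cases h1 : z.1 ∈ Metric.closedBall (0 : Rd d) R
    · by_cases h2 : z.2 ∈ Metric.closedBall (0 : Rd d) (R + r)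
      · rw [Set.indicator_of_mem h1, Set.indicator_of_mem h2, mul_one, norm_mul, norm_mul,
          mul_assoc]
        exact (mul_le_of_le_one_left (by positivity) (abs_strip_le_one r z)).trans
          (mul_le_mul_of_nonneg_right (hBM _) (norm_nonneg _))
      · rw [strip_eq_zero h1 h2, zero_mul, zero_mul, norm_zero, Set.indicator_of_notMem h2]
        simp
    · rw [hBR _ h1, mul_zero, zero_mul, norm_zero, Set.indicator_of_notMem h1]
      simp
  have e1 : ∫ z : Rd d × Rd d, strip r z * (B z.1 * v.1 z.1) =
      volume.real (Metric.ball (0 : Rd d) r) * ∫ x, B x * v.1 x := by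
    rw [Measure.volume_eq_prod, integral_prod _ i1]
    simp only [integral_mul_const, integral_strip_left, integral_const_mul]
  have e2 : ∫ z : Rd d × Rd d, strip r z * B z.1 * v.1 z.2 =
      ∫ y, (∫ x in Metric.ball y r, B x) * v.1 y := by
    rw [Measure.volume_eq_prod, integral_prod_symm _ i2]
    simp only [integral_mul_const, integral_strip_mul_right]
  -- The factor cancels the density of the Gagliardo measure, so the difference to be estimated is
  -- the pairing of `Q` with the increment of `v`, ready for Hölder's inequality.
  let Q : Rd d × Rd d → ℝ := fun z => ‖z.1 - z.2‖ ^ ((d : ℝ) + α) * (strip r z * B z.1)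
  have e3 : ∫ z, (1 : ℝ) * Q z * increment v.1 z ∂(gagliardoMeasure d α) =
      (∫ y, (∫ x in Metric.ball y r, B x) * v.1 y) -
        volume.real (Metric.ball (0 : Rd d) r) * ∫ x, B x * v.1 x := by
    rw [← e1, ← e2, ← integral_sub i2 i1, integral_gagliardoMeasure]
    congr 1
    funext z
    rcases eq_or_ne z.1 z.2 with h | h
    · simp [increment, h]
      ring
    · have : ‖z.1 - z.2‖ ^ ((d : ℝ) + α) ≠ 0 :=
        (Real.rpow_pos_of_pos (norm_pos_iff.2 (sub_ne_zero.2 h)) _).ne'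
      simp only [Q, increment]
      field_simp
  have hQm : AEStronglyMeasurable Q volume := by
    refine AEStronglyMeasurable.mul ?_ (hs.mul hB1)
    exact Measurable.aestronglyMeasurable (by fun_prop)
  have hI : Integrable (fun z : Rd d × Rd d => strip r z *
      (Metric.closedBall (0 : Rd d) R).indicator (fun _ => (1 : ℝ)) z.1) volume := by
    have h := (hballfin R).mul_prod (hballfin (R + r))
    refine h.mono' (hs.mul ((hballfin R).1.comp_quasiMeasurePreserving
      Measure.quasiMeasurePreserving_fst)) (.of_forall fun z => ?_)
    by_cases h1 : z.1 ∈ Metric.closedBall (0 : Rd d) R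
    · by_cases h2 : z.2 ∈ Metric.closedBall (0 : Rd d) (R + r)
      · rw [Set.indicator_of_mem h1, Set.indicator_of_mem h2, mul_one, mul_one]
        exact abs_strip_le_one r z
      · rw [strip_eq_zero h1 h2, zero_mul, norm_zero, Set.indicator_of_notMem h2, mul_zero]
    · rw [Set.indicator_of_notMem h1]
      simp
  have hdomI := hI.const_mul ((r ^ ((d : ℝ) + α)) ^ (q - 1) * M ^ q)
  -- One power of the singular factor cancels, and the remaining power `q - 1 > 0` is at most its
  -- value at distance `r` on the strip.
  have hpt : ∀ z : Rd d × Rd d, (‖z.1 - z.2‖ ^ ((d : ℝ) + α))⁻¹ * |Q z| ^ q ≤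
      (r ^ ((d : ℝ) + α)) ^ (q - 1) * M ^ q *
      (strip r z * (Metric.closedBall (0 : Rd d) R).indicator (fun _ => (1 : ℝ)) z.1) := by
    intro z
    have hnn : 0 ≤ (r ^ ((d : ℝ) + α)) ^ (q - 1) * M ^ q *
      (strip r z * (Metric.closedBall (0 : Rd d) R).indicator (fun _ => (1 : ℝ)) z.1) :=
      mul_nonneg (by positivity) (mul_nonneg (strip_nonneg r z)
        (Set.indicator_nonneg (fun _ _ => zero_le_one) _))
    by_cases h1 : z.1 ∈ Metric.closedBall (0 : Rd d) R
    swap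
    · have : Q z = 0 := by simp [Q, hBR _ h1]
      rw [this, abs_zero, Real.zero_rpow (by linarith), mul_zero]
      exact hnn
    by_cases h2 : dist z.1 z.2 < r
    swap
    · have : Q z = 0 := by simp [Q, strip, h2]
      rw [this, abs_zero, Real.zero_rpow (by linarith), mul_zero]
      exact hnn
    have hst : strip r z = 1 := by simp [strip, h2]
    rw [hst, Set.indicator_of_mem h1, mul_one, mul_one]
    simp only [Q, hst, one_mul]
    rw [abs_mul, abs_of_nonneg (by positivity : 0 ≤ ‖z.1 - z.2‖ ^ ((d : ℝ) + α)),
      Real.mul_rpow (by positivity) (abs_nonneg _), ← mul_assoc]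
    refine mul_le_mul ?_ (Real.rpow_le_rpow (abs_nonneg _) (hBM _) (by linarith)) (by positivity)
      (by positivity)
    have hs0 : 0 ≤ ‖z.1 - z.2‖ ^ ((d : ℝ) + α) := by positivity
    rcases hs0.eq_or_lt with h0 | h0
    · rw [← h0]; simp; positivity
    · have : (‖z.1 - z.2‖ ^ ((d : ℝ) + α))⁻¹ * (‖z.1 - z.2‖ ^ ((d : ℝ) + α)) ^ q =
          (‖z.1 - z.2‖ ^ ((d : ℝ) + α)) ^ (q - 1) := by
        rw [Real.rpow_sub h0, Real.rpow_one, div_eq_inv_mul]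
      rw [this]
      refine Real.rpow_le_rpow h0.le (Real.rpow_le_rpow (norm_nonneg _) ?_ (by positivity))
        (by linarith)
      rw [← dist_eq_norm]; exact h2.le
  have hQi : Integrable (fun z : Rd d × Rd d =>
      (‖z.1 - z.2‖ ^ ((d : ℝ) + α))⁻¹ * |Q z| ^ q) volume := by
    refine hdomI.mono' ?_ (.of_forall fun z => ?_)
    · refine AEStronglyMeasurable.mul (Measurable.aestronglyMeasurable (by fun_prop)) ?_
      exact (continuous_abs_rpow hq1).comp_aestronglyMeasurable hQm
    · rw [Real.norm_of_nonneg (by positivity)]; exact hpt z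
  have hQmem : MemLp Q (ENNReal.ofReal q) (gagliardoMeasure d α) := by
    rw [memLp_iff_integrable_abs_rpow (by linarith)
      (hQm.mono_ac gagliardoMeasure_absolutelyContinuous), gagliardoMeasure,
      integrable_withDensity_iff_integrable_smul (measurable_singularKernel α)]
    refine hQi.congr (.of_forall fun z => ?_)
    simp only [NNReal.smul_def, coe_singularKernel, smul_eq_mul]
  have hfin := abs_integral_bdd_mul_le hp (C := 1)
    (aestronglyMeasurable_const (b := (1 : ℝ))) (by simp) hQmem
    ((memLp_increment_iff (α := α) hp0 hv.1).2 v.2)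
  rw [abs_sub_comm, ← e3]
  refine hfin.trans ?_
  rw [one_mul]
  refine mul_le_mul ?_ (norm_le_norm_sobolevEmbedding v).2 (by positivity) (by positivity)
  refine Real.rpow_le_rpow (integral_nonneg fun z => by positivity) ?_ (by positivity)
  rw [integral_gagliardoMeasure]
  refine (integral_mono hQi hdomI hpt).trans (le_of_eq ?_)
  rw [integral_const_mul]
  congr 1
  rw [Measure.volume_eq_prod, integral_prod _ hI]
  simp only [integral_mul_const, integral_strip_left, integral_const_mul]
  rw [mul_comm, integral_indicator measurableSet_closedBall]
  simp

lemma volume_real_ball {r : ℝ} (hr : 0 < r) : volume.real (Metric.ball (0 : Rd d) r) =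
    r ^ (d : ℝ) * volume.real (Metric.ball (0 : Rd d) 1) := by
  rw [measureReal_def, Measure.addHaar_ball_of_pos volume (0 : Rd d) hr, ENNReal.toReal_mul,
    ENNReal.toReal_ofReal (by positivity), finrank_euclideanSpace_fin, Real.rpow_natCast,
    measureReal_def]

lemma volume_real_ball_pos {r : ℝ} (hr : 0 < r) : 0 < volume.real (Metric.ball (0 : Rd d) r) :=
  ENNReal.toReal_pos (Metric.measure_ball_pos _ _ hr).ne' measure_ball_lt_top.ne

/-- Counting powers of `r` with `q = p/(p-1)`: `((d + α) (q - 1) + d) / q = d + α/p`, and the volume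
of the ball removes `r^d`. What remains is `r^(α/p)`, the gain from fractional smoothness. -/
lemma tendsto_average_error (hα : 0 < α) (hp : 1 < p) {M V : ℝ} (hM : 0 ≤ M) (hV : 0 ≤ V) :
    Tendsto (fun r : ℝ => ((r ^ ((d : ℝ) + α)) ^ (p / (p - 1) - 1) * M ^ (p / (p - 1)) *
      (V * volume.real (Metric.ball (0 : Rd d) r))) ^ (1 / (p / (p - 1))) /
        volume.real (Metric.ball (0 : Rd d) r)) (𝓝[>] 0) (𝓝 0) := by
  have hp0 : 0 < p := by linarith
  have hp1 : 0 < p - 1 := by linarith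
  set β := volume.real (Metric.ball (0 : Rd d) 1) with hβ
  have hβ0 : 0 < β := volume_real_ball_pos one_pos
  set q := p / (p - 1) with hq
  have hq0 : 0 < q := by positivity
  have h0 : Tendsto (fun r : ℝ => (M ^ q * (V * β)) ^ (1 / q) / β * r ^ (α / p)) (𝓝[>] 0)
      (𝓝 0) := by
    have hc : Continuous fun r : ℝ => (M ^ q * (V * β)) ^ (1 / q) / β * r ^ (α / p) :=
      (continuous_id.rpow_const fun _ => Or.inr (by positivity)).const_mul _
    have h := hc.tendsto 0
    rw [Real.zero_rpow (by positivity), mul_zero] at h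
    exact h.mono_left nhdsWithin_le_nhds
  refine h0.congr' ?_
  filter_upwards [self_mem_nhdsWithin] with r hr
  have hr : 0 < r := hr
  rw [volume_real_ball hr, ← hβ]
  have e1 : (r ^ ((d : ℝ) + α)) ^ (q - 1) * M ^ q * (V * (r ^ (d : ℝ) * β)) =
      r ^ (((d : ℝ) + α) * (q - 1) + d) * (M ^ q * (V * β)) := by
    rw [Real.rpow_add hr (((d : ℝ) + α) * (q - 1)), Real.rpow_mul hr.le]; ring
  rw [e1, Real.mul_rpow (x := r ^ _) (by positivity) (by positivity), ← Real.rpow_mul hr.le]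
  have e2 : (((d : ℝ) + α) * (q - 1) + d) * (1 / q) = α / p + d := by
    rw [hq]; field_simp; ring
  rw [e2, Real.rpow_add hr]
  field_simp

lemma aestronglyMeasurable_ball_integral {B : Rd d → ℝ} (hB : AEStronglyMeasurable B volume)
    (r : ℝ) : AEStronglyMeasurable (fun y => ∫ x in Metric.ball y r, B x) volume := by
  simp only [← integral_strip_mul_left]
  have h : AEStronglyMeasurable (fun z : Rd d × Rd d => strip r z * B z.2)
      ((volume : Measure (Rd d)).prod volume) :=
    (measurable_strip r).aestronglyMeasurable.mul
      (hB.comp_quasiMeasurePreserving Measure.quasiMeasurePreserving_snd)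
  exact h.integral_prod_right'

/-- Weak convergence to zero of bounded functions with support in a fixed ball implies uniform
convergence of the corresponding functionals on bounded sets of the Sobolev space. -/
lemma eventually_abs_integral_le (hα : 0 < α) {hp : 1 < p} {ι : Type*} {l : Filter ι}
    [l.IsCountablyGenerated] {B : ι → Rd d → ℝ} {M R : ℝ}
    (hB : ∀ᶠ i in l, AEStronglyMeasurable (B i) volume) (hBM : ∀ i x, |B i x| ≤ M)
    (hBR : ∀ i, ∀ x ∉ Metric.closedBall (0 : Rd d) R, B i x = 0)
    (hlim : ∀ y r, Tendsto (fun i => ∫ x in Metric.ball y r, B i x) l (𝓝 0))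
    {τ : ℝ} (hτ : 0 < τ) :
    ∀ᶠ i in l, ∀ v : Sobolev d α p hp,
      |∫ x, B i x * v.1 x| ≤ τ * ‖sobolevEmbedding d α p hp v‖ := by
  rcases l.eq_or_neBot with rfl | hne
  · exact eventually_bot
  obtain ⟨i₀⟩ : Nonempty ι := hne.nonempty
  have hM : 0 ≤ M := (abs_nonneg _).trans (hBM i₀ 0)
  have hp0 : 0 < p := by linarith
  have hp1 : 0 < p - 1 := by linarith
  -- The radius is fixed first, from the bounds `M` and `R` alone, so the averaging error is at most
  -- half of the tolerance for all `i` and `v`.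
  obtain ⟨r, hrτ, hr⟩ := (((tendsto_average_error (d := d) hα hp hM
    (V := volume.real (Metric.closedBall (0 : Rd d) R)) measureReal_nonneg).eventually
    (gt_mem_nhds (half_pos hτ))).and self_mem_nhdsWithin).exists
  have hr : 0 < r := hr
  set β := volume.real (Metric.ball (0 : Rd d) r) with hβ
  have hβ0 : 0 < β := volume_real_ball_pos hr
  set q := p / (p - 1) with hq
  have hq1 : 1 < q := by rw [hq, one_lt_div hp1]; linarith
  have hq0 : 0 < q := by linarith
  rw [div_lt_iff₀ hβ0] at hrτ
  let N : ι → Rd d → ℝ := fun i y => ∫ x in Metric.ball y r, B i x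
  have hNM : ∀ i y, |N i y| ≤ M * β := fun i y => by
    have h := norm_setIntegral_le_of_norm_le_const (μ := volume) (s := Metric.ball y r)
      (f := B i) (C := M) measure_ball_lt_top (fun x _ => hBM i x)
    rwa [measureReal_def, Measure.addHaar_ball_center, ← measureReal_def] at h
  have hNR : ∀ i, ∀ y ∉ Metric.closedBall (0 : Rd d) (R + r), N i y = 0 := fun i y hy => by
    refine setIntegral_eq_zero_of_forall_eq_zero fun x hx => hBR i x fun hx' => hy ?_
    rw [mem_closedBall_zero_iff] at hx' ⊢
    rw [Metric.mem_ball', dist_eq_norm] at hx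
    have := norm_add_le (y - x) x
    rw [sub_add_cancel] at this
    linarith
  have hdom : Integrable ((Metric.closedBall (0 : Rd d) (R + r)).indicator
      fun _ => (M * β) ^ q) volume :=
    (integrable_indicator_iff measurableSet_closedBall).2
      (integrableOn_const measure_closedBall_lt_top.ne)
  have hNbd : ∀ i y, ‖|N i y| ^ q‖ ≤ (Metric.closedBall (0 : Rd d) (R + r)).indicator
      (fun _ => (M * β) ^ q) y := fun i y => by
    rw [Real.norm_of_nonneg (by positivity)]
    by_cases hy : y ∈ Metric.closedBall (0 : Rd d) (R + r)
    · rw [Set.indicator_of_mem hy]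
      exact Real.rpow_le_rpow (abs_nonneg _) (hNM i y) hq0.le
    · rw [Set.indicator_of_notMem hy, hNR i y hy, abs_zero, Real.zero_rpow hq0.ne']
  have hNm : ∀ᶠ i in l, AEStronglyMeasurable (fun y => |N i y| ^ q) volume := by
    filter_upwards [hB] with i hi
    exact (continuous_abs_rpow hq1).comp_aestronglyMeasurable
      (aestronglyMeasurable_ball_integral hi r)
  -- At fixed radius the ball integrals tend to zero pointwise and are bounded with support in a
  -- fixed ball, so the convergence is strong in `L^q`.
  have hNlim : Tendsto (fun i => (∫ y, |N i y| ^ q) ^ (1 / q)) l (𝓝 0) := by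
    have h1 : Tendsto (fun i => ∫ y, |N i y| ^ q) l (𝓝 (∫ _ : Rd d, (0 : ℝ))) := by
      refine tendsto_integral_filter_of_dominated_convergence _ hNm
        (.of_forall fun i => .of_forall (hNbd i)) hdom (.of_forall fun y => ?_)
      have h := ((continuous_abs_rpow hq1).tendsto 0).comp (hlim y r)
      rwa [abs_zero, Real.zero_rpow hq0.ne'] at h
    rw [integral_zero] at h1
    have h2 := h1.rpow_const (p := 1 / q) (Or.inr (by positivity))
    rwa [Real.zero_rpow (by positivity)] at h2
  filter_upwards [hB, hNm, hNlim.eventually (gt_mem_nhds (show 0 < τ / 2 * β by positivity))]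
    with i hBi hNi hNl v
  have hmem : MemLp (N i) (ENNReal.ofReal q) volume := by
    rw [memLp_iff_integrable_abs_rpow hq0 (aestronglyMeasurable_ball_integral hBi r)]
    exact hdom.mono' hNi (.of_forall (hNbd i))
  have h1 := abs_integral_sub_average_le hα hr hBi (hBM i) (hBR i) v
  rw [← hq, ← hβ] at h1
  have h2 := abs_integral_bdd_mul_le hp (C := 1) (aestronglyMeasurable_const (b := (1 : ℝ)))
    (by simp) hmem (Lp.memLp v.1)
  simp only [one_mul] at h2
  have hD : 0 ≤ ‖sobolevEmbedding d α p hp v‖ := Lp_norm_nonneg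
  have h3 := h2.trans (mul_le_mul hNl.le (norm_le_norm_sobolevEmbedding v).1 (by positivity)
    (by positivity))
  have h4 := h1.trans (mul_le_mul_of_nonneg_right hrτ.le hD)
  have h5 : |β * ∫ x, B i x * v.1 x| ≤ β * (τ * ‖sobolevEmbedding d α p hp v‖) := by
    have h6 := abs_add_le (β * (∫ x, B i x * v.1 x) -
      ∫ y, (∫ x in Metric.ball y r, B i x) * v.1 y) (∫ y, (∫ x in Metric.ball y r, B i x) * v.1 y)
    rw [sub_add_cancel] at h6
    refine h6.trans ((add_le_add h4 h3).trans (le_of_eq ?_))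
    ring
  rw [abs_mul, abs_of_pos hβ0] at h5
  exact le_of_mul_le_mul_left h5 hβ0

/-- Cutting off to `S n` and to the sublevel `|h| ≤ n` of a measurable representative leaves a tail
over sets that decrease to the empty set. -/
lemma exists_truncation {Ω : Type*} [MeasurableSpace Ω] {ρ : Measure Ω} {q : ℝ} (hq : 0 < q)
    {g : Ω → ℝ} (hg : MemLp g (ENNReal.ofReal q) ρ) {S : ℕ → Set Ω}
    (hS : ∀ n, MeasurableSet (S n)) (hmono : Monotone S) (hU : ∀ x, ∃ n, x ∈ S n)
    {τ : ℝ} (hτ : 0 < τ) :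
    ∃ (n : ℕ) (g' : Ω → ℝ), Measurable g' ∧ (∀ x, |g' x| ≤ n) ∧ (∀ x ∉ S n, g' x = 0) ∧
      MemLp (fun x => g x - g' x) (ENNReal.ofReal q) ρ ∧
      (∫ x, |g x - g' x| ^ q ∂ρ) ^ (1 / q) ≤ τ := by
  set h := hg.1.aemeasurable.mk g with hh
  have hhm : Measurable h := hg.1.aemeasurable.measurable_mk
  have hgh : g =ᵐ[ρ] h := hg.1.aemeasurable.ae_eq_mk
  let T : ℕ → Set Ω := fun n => S n ∩ {x | |h x| ≤ n}
  have hT : ∀ n, MeasurableSet (T n) := fun n =>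
    (hS n).inter (measurableSet_le (by fun_prop) measurable_const)
  have hTmono : Monotone T := fun n k hnk x hx =>
    ⟨hmono hnk hx.1, le_trans (show |h x| ≤ n from hx.2) (Nat.cast_le.2 hnk)⟩
  have hTU : ⋂ n, (T n)ᶜ = ∅ := by
    rw [← Set.compl_iUnion, Set.compl_empty_iff, Set.eq_univ_iff_forall]
    intro x
    obtain ⟨n, hn⟩ := hU x
    obtain ⟨k, hk⟩ := exists_nat_ge |h x|
    refine Set.mem_iUnion.2 ⟨max n k, hmono (le_max_left _ _) hn, hk.trans ?_⟩
    exact Nat.cast_le.2 (le_max_right _ _)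
  have hint : Integrable (fun x => |h x| ^ q) ρ := by
    refine (integrable_abs_rpow hq hg).congr ?_
    filter_upwards [hgh] with x hx
    rw [hx]
  have hlim := tendsto_setIntegral_of_antitone (fun n => (hT n).compl)
    (fun n k hnk => Set.compl_subset_compl.2 (hTmono hnk)) ⟨0, hint.integrableOn⟩
  rw [hTU, setIntegral_empty] at hlim
  have hlim2 := hlim.rpow_const (p := 1 / q) (Or.inr (by positivity))
  rw [Real.zero_rpow (by positivity)] at hlim2
  obtain ⟨n, hn⟩ := (hlim2.eventually (gt_mem_nhds hτ)).exists
  have hsub : (fun x => g x - (T n).indicator h x) =ᵐ[ρ] (T n)ᶜ.indicator h := by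
    filter_upwards [hgh] with x hx
    rw [hx]
    by_cases hxT : x ∈ T n
    · simp [hxT]
    · simp [hxT]
  refine ⟨n, (T n).indicator h, hhm.indicator (hT n), fun x => ?_, fun x hx => ?_, ?_, ?_⟩
  · by_cases hxT : x ∈ T n
    · rw [Set.indicator_of_mem hxT]; exact hxT.2
    · rw [Set.indicator_of_notMem hxT, abs_zero]; positivity
  · exact Set.indicator_of_notMem (fun h => hx h.1) _
  · exact ((hg.ae_eq hgh).indicator (hT n).compl).ae_eq hsub.symm
  · refine le_trans (le_of_eq ?_) hn.le
    rw [← integral_indicator (hT n).compl]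
    congr 1
    refine integral_congr_ae ?_
    filter_upwards [hsub] with x hx
    rw [hx]
    by_cases hxT : x ∈ (T n)ᶜ
    · simp only [Set.indicator_of_mem hxT]
    · simp only [Set.indicator_of_notMem hxT, abs_zero, Real.zero_rpow hq.ne']

/-- If `b i → 0` weakly-*, then `∫ b i g v → 0` uniformly for `v` in bounded sets. -/
lemma eventually_abs_integral_mul_le (hα : 0 < α) {hp : 1 < p} {ι : Type*} {l : Filter ι}
    [l.IsCountablyGenerated] {b : ι → Rd d → ℝ} {C : ℝ}
    (hb : ∀ᶠ i in l, AEStronglyMeasurable (b i) volume) (hbC : ∀ i x, |b i x| ≤ C)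
    (hlim : ∀ h : Rd d → ℝ, Integrable h → Tendsto (fun i => ∫ x, b i x * h x) l (𝓝 0))
    {g : Rd d → ℝ} (hg : MemLp g (ENNReal.ofReal (p / (p - 1))) volume) {τ : ℝ} (hτ : 0 < τ) :
    ∀ᶠ i in l, ∀ v : Sobolev d α p hp,
      |∫ x, b i x * g x * v.1 x| ≤ τ * ‖sobolevEmbedding d α p hp v‖ := by
  rcases l.eq_or_neBot with rfl | hne
  · exact eventually_bot
  obtain ⟨i₀⟩ : Nonempty ι := hne.nonempty
  have hC : 0 ≤ C := (abs_nonneg _).trans (hbC i₀ 0)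
  have hp1 : 0 < p - 1 := by linarith
  -- The tail contributes at most `C * τ / (2 * (C + 1)) ≤ τ / 2` times the norm by Hölder; the
  -- truncated part is bounded with support in a ball, as `eventually_abs_integral_le` requires.
  obtain ⟨n, g', hg'm, hg'n, hg'S, hgg', hgτ⟩ := exists_truncation (by positivity) hg
    (S := fun n : ℕ => Metric.closedBall (0 : Rd d) n) (fun n => measurableSet_closedBall)
    (fun n k hnk => Metric.closedBall_subset_closedBall (Nat.cast_le.2 hnk))
    (fun x => (exists_nat_ge ‖x‖).imp fun n hn => mem_closedBall_zero_iff.2 hn)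
    (show 0 < τ / (2 * (C + 1)) by positivity)
  have hgi : Integrable g' volume := by
    have h : Integrable ((Metric.closedBall (0 : Rd d) n).indicator fun _ => (n : ℝ)) volume :=
      (integrable_indicator_iff measurableSet_closedBall).2
        (integrableOn_const measure_closedBall_lt_top.ne)
    refine h.mono' hg'm.aestronglyMeasurable (.of_forall fun x => ?_)
    by_cases hx : x ∈ Metric.closedBall (0 : Rd d) n
    · rw [Set.indicator_of_mem hx]; exact hg'n x
    · rw [Set.indicator_of_notMem hx, hg'S x hx, norm_zero]
  have hY := eventually_abs_integral_le (B := fun i x => b i x * g' x) (M := C * n) (R := n)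
    (l := l) hα (hp := hp) (hb.mono fun i hi => hi.mul hg'm.aestronglyMeasurable)
    (fun i x => by
      rw [abs_mul]; exact mul_le_mul (hbC i x) (hg'n x) (abs_nonneg _) hC)
    (fun i x hx => by rw [hg'S x hx, mul_zero])
    (fun y r => by
      refine (hlim _ (hgi.indicator (measurableSet_ball (x := y) (ε := r)))).congr fun i => ?_
      rw [← integral_indicator measurableSet_ball]
      congr 1; funext x
      by_cases hx : x ∈ Metric.ball y r <;> simp [hx])
    (half_pos hτ)
  filter_upwards [hb, hY] with i hbi hYi v
  have hv := Lp.memLp v.1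
  have hD : 0 ≤ ‖sobolevEmbedding d α p hp v‖ := Lp_norm_nonneg
  have hg'mem : MemLp g' (ENNReal.ofReal (p / (p - 1))) volume := by
    refine (hg.sub hgg').ae_eq (.of_forall fun x => ?_)
    simp
  have i1 := integrable_mul_of_holder hp (memLp_bdd_mul hbi (hbC i) hgg') hv
  have i2 := integrable_mul_of_holder hp (memLp_bdd_mul hbi (hbC i) hg'mem) hv
  have e : ∫ x, b i x * g x * v.1 x =
      (∫ x, b i x * (g x - g' x) * v.1 x) + ∫ x, b i x * g' x * v.1 x := by
    rw [← integral_add i1 i2]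
    congr 1; funext x; ring
  have h1 := abs_integral_bdd_mul_le hp hbi (hbC i) hgg' hv
  have h2 := h1.trans (mul_le_mul_of_nonneg_left (mul_le_mul hgτ
    (norm_le_norm_sobolevEmbedding v).1 (by positivity) (by positivity)) hC)
  have h3 : C * (τ / (2 * (C + 1))) ≤ τ / 2 := by
    rw [mul_div_assoc', div_le_div_iff₀ (by positivity) (by positivity)]
    nlinarith
  rw [e]
  refine (abs_add_le _ _).trans ((add_le_add h2 (hYi v)).trans ?_)
  rw [← mul_assoc]
  nlinarith

lemma integrable_of_bounded_support {H : Rd d × Rd d → ℝ} {M R : ℝ}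
    (hH : AEStronglyMeasurable H volume) (hHM : ∀ z, |H z| ≤ M)
    (hHR : ∀ z, ¬ (z.1 ∈ Metric.closedBall (0 : Rd d) R ∧ z.2 ∈ Metric.closedBall (0 : Rd d) R) →
      H z = 0) {v : Rd d → ℝ} (hv : AEStronglyMeasurable v volume)
    (hvR : IntegrableOn v (Metric.closedBall 0 R)) :
    Integrable (fun z : Rd d × Rd d => H z * v z.1) volume := by
  have hball : Integrable ((Metric.closedBall (0 : Rd d) R).indicator fun _ => M) volume :=
    (integrable_indicator_iff measurableSet_closedBall).2
      (integrableOn_const measure_closedBall_lt_top.ne)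
  have hvi := ((integrable_indicator_iff measurableSet_closedBall).2 hvR).norm
  have hM : 0 ≤ M := (abs_nonneg _).trans (hHM 0)
  refine (hvi.mul_prod hball).mono' (hH.mul
    (hv.comp_quasiMeasurePreserving Measure.quasiMeasurePreserving_fst)) (.of_forall fun z => ?_)
  by_cases h : z.1 ∈ Metric.closedBall (0 : Rd d) R ∧ z.2 ∈ Metric.closedBall (0 : Rd d) R
  · rw [Set.indicator_of_mem h.1, Set.indicator_of_mem h.2, norm_mul, mul_comm]
    exact mul_le_mul_of_nonneg_left (hHM z) (norm_nonneg _)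
  · rw [hHR z h, zero_mul, norm_zero]
    exact mul_nonneg (norm_nonneg _) (Set.indicator_nonneg (fun _ _ => hM) _)

/-- As `v` depends on the first variable only, the second is integrated out. The resulting function
of `x` is bounded, supported in a ball and weakly null, which reduces the claim to
`eventually_abs_integral_le`. -/
lemma eventually_abs_integral_fst_le (hα : 0 < α) {hp : 1 < p} {ι : Type*} {l : Filter ι}
    [l.IsCountablyGenerated] {b : ι → Rd d × Rd d → ℝ} {C : ℝ}
    (hb : ∀ᶠ i in l, AEStronglyMeasurable (b i) volume) (hbC : ∀ i z, |b i z| ≤ C)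
    (hlim : ∀ h : Rd d × Rd d → ℝ, Integrable h → Tendsto (fun i => ∫ z, b i z * h z) l (𝓝 0))
    {H : Rd d × Rd d → ℝ} {M R : ℝ} (hH : Measurable H) (hHM : ∀ z, |H z| ≤ M)
    (hHR : ∀ z, ¬ (z.1 ∈ Metric.closedBall (0 : Rd d) R ∧ z.2 ∈ Metric.closedBall (0 : Rd d) R) →
      H z = 0) {τ : ℝ} (hτ : 0 < τ) :
    ∀ᶠ i in l, ∀ v : Sobolev d α p hp,
      |∫ z, b i z * H z * v.1 z.1| ≤ τ * ‖sobolevEmbedding d α p hp v‖ := by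
  rcases l.eq_or_neBot with rfl | hne
  · exact eventually_bot
  obtain ⟨i₀⟩ : Nonempty ι := hne.nonempty
  have hC : 0 ≤ C := (abs_nonneg _).trans (hbC i₀ 0)
  have hM : 0 ≤ M := (abs_nonneg _).trans (hHM 0)
  have hbH : ∀ i z, |b i z * H z| ≤ C * M := fun i z => by
    rw [abs_mul]; exact mul_le_mul (hbC i z) (hHM z) (abs_nonneg _) hC
  have hbHR : ∀ i z, ¬ (z.1 ∈ Metric.closedBall (0 : Rd d) R ∧
      z.2 ∈ Metric.closedBall (0 : Rd d) R) → b i z * H z = 0 := fun i z hz => by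
    rw [hHR z hz, mul_zero]
  have hbHm : ∀ᶠ i in l, AEStronglyMeasurable (fun z => b i z * H z) volume :=
    hb.mono fun i hi => hi.mul hH.aestronglyMeasurable
  have hY := eventually_abs_integral_le (B := fun i x => ∫ y, b i (x, y) * H (x, y))
    (M := C * M * volume.real (Metric.closedBall (0 : Rd d) R)) (R := R) (l := l) hα (hp := hp)
    (hbHm.mono fun i hi => by
      rw [Measure.volume_eq_prod] at hi
      exact hi.integral_prod_right')
    (fun i x => by
      have h := norm_setIntegral_le_of_norm_le_const (μ := volume)
        (s := Metric.closedBall (0 : Rd d) R) (f := fun y => b i (x, y) * H (x, y)) (C := C * M)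
        measure_closedBall_lt_top (fun y _ => hbH i (x, y))
      rwa [setIntegral_eq_integral_of_forall_compl_eq_zero
        fun y hy => hbHR i (x, y) fun h => hy h.2] at h)
    (fun i x hx => by
      simp only [fun y => hbHR i (x, y) fun h => hx h.1, integral_zero])
    (fun y r => by
      have hint : ∀ J : Rd d × Rd d → ℝ, AEStronglyMeasurable J volume → (M' : ℝ) →
          (∀ z, |J z| ≤ M') → (∀ z, ¬ (z.1 ∈ Metric.closedBall (0 : Rd d) R ∧
            z.2 ∈ Metric.closedBall (0 : Rd d) R) → J z = 0) →
          Integrable (fun z => J z * (Metric.ball y r).indicator (fun _ => (1 : ℝ)) z.1) volume :=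
        fun J hJ M' hJM hJR => integrable_of_bounded_support hJ hJM hJR
          (measurable_const.indicator measurableSet_ball).aestronglyMeasurable
          (Integrable.integrableOn ((integrable_indicator_iff measurableSet_ball).2
            (integrableOn_const measure_ball_lt_top.ne)))
      -- By Fubini, integrating the reduced function over a ball means testing `b i` with `H` times
      -- the indicator of that ball in the first variable.
      refine (hlim _ (hint H hH.aestronglyMeasurable M hHM hHR)).congr' ?_
      filter_upwards [hbHm] with i hi
      have hi2 := hint _ hi _ (hbH i) (hbHR i)
      simp only [← mul_assoc]
      rw [Measure.volume_eq_prod, integral_prod _ hi2, ← integral_indicator measurableSet_ball]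
      congr 1; funext x
      simp only [integral_mul_const]
      by_cases hx : x ∈ Metric.ball y r <;> simp [hx])
    hτ
  filter_upwards [hbHm, hY] with i hi hYi v
  have hint := integrable_of_bounded_support hi (hbH i) (hbHR i) (Lp.memLp v.1).1
    (integrableOn_closedBall_of_memLp hp (Lp.memLp v.1) R)
  rw [Measure.volume_eq_prod, integral_prod _ hint]
  simpa only [integral_mul_const] using hYi v

lemma eventually_abs_integral_snd_le (hα : 0 < α) {hp : 1 < p} {ι : Type*} {l : Filter ι}
    [l.IsCountablyGenerated] {b : ι → Rd d × Rd d → ℝ} {C : ℝ}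
    (hb : ∀ᶠ i in l, AEStronglyMeasurable (b i) volume) (hbC : ∀ i z, |b i z| ≤ C)
    (hlim : ∀ h : Rd d × Rd d → ℝ, Integrable h → Tendsto (fun i => ∫ z, b i z * h z) l (𝓝 0))
    {H : Rd d × Rd d → ℝ} {M R : ℝ} (hH : Measurable H) (hHM : ∀ z, |H z| ≤ M)
    (hHR : ∀ z, ¬ (z.1 ∈ Metric.closedBall (0 : Rd d) R ∧ z.2 ∈ Metric.closedBall (0 : Rd d) R) →
      H z = 0) {τ : ℝ} (hτ : 0 < τ) :
    ∀ᶠ i in l, ∀ v : Sobolev d α p hp,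
      |∫ z, b i z * H z * v.1 z.2| ≤ τ * ‖sobolevEmbedding d α p hp v‖ := by
  have hswap : MeasurePreserving (Prod.swap : Rd d × Rd d → Rd d × Rd d) volume volume :=
    Measure.measurePreserving_swap
  have hswapI : ∀ F : Rd d × Rd d → ℝ, ∫ z : Rd d × Rd d, F z.swap = ∫ z, F z := fun F =>
    integral_prod_swap F
  have h := eventually_abs_integral_fst_le (b := fun i z => b i z.swap) (H := fun z => H z.swap)
    hα (hp := hp) (hb.mono fun i hi => hi.comp_measurePreserving hswap) (fun i z => hbC i _)
    (fun h hh => (hlim (fun z => h z.swap) (hswap.integrable_comp_of_integrable hh)).congr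
      fun i => by
        rw [← hswapI]
        simp only [Prod.swap_swap])
    (hH.comp measurable_swap) (fun z => hHM _) (fun z hz => hHR _ fun h => hz ⟨h.2, h.1⟩) hτ
  filter_upwards [h] with i hi v
  rw [← hswapI]
  exact hi v

/-- If `b i → 0` weakly-* on `ℝ^d × ℝ^d`, then `∬ b i G (v y - v x) |x - y|^(-d-α) → 0` uniformly
for `v` in bounded sets. -/
lemma eventually_abs_integral_increment_le (hα : 0 < α) {hp : 1 < p} {ι : Type*} {l : Filter ι}
    [l.IsCountablyGenerated] {b : ι → Rd d × Rd d → ℝ} {C : ℝ}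
    (hb : ∀ᶠ i in l, AEStronglyMeasurable (b i) volume) (hbC : ∀ i z, |b i z| ≤ C)
    (hlim : ∀ h : Rd d × Rd d → ℝ, Integrable h → Tendsto (fun i => ∫ z, b i z * h z) l (𝓝 0))
    {G : Rd d × Rd d → ℝ}
    (hG : MemLp G (ENNReal.ofReal (p / (p - 1))) (gagliardoMeasure d α)) {τ : ℝ} (hτ : 0 < τ) :
    ∀ᶠ i in l, ∀ v : Sobolev d α p hp,
      |∫ z, b i z * G z * increment v.1 z ∂(gagliardoMeasure d α)| ≤
        τ * ‖sobolevEmbedding d α p hp v‖ := by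
  rcases l.eq_or_neBot with rfl | hne
  · exact eventually_bot
  obtain ⟨i₀⟩ : Nonempty ι := hne.nonempty
  have hC : 0 ≤ C := (abs_nonneg _).trans (hbC i₀ 0)
  have hp0 : 0 < p := by linarith
  have hp1 : 0 < p - 1 := by linarith
  -- The truncation also removes the points where the singular kernel exceeds `n`. The product of
  -- kernel and `G'` is then bounded, and the increment may be split into two separately integrable
  -- terms.
  obtain ⟨n, G', hGm, hGn, hGS, hGG, hGτ⟩ := exists_truncation (by positivity) hG
    (S := fun n : ℕ => (Metric.closedBall (0 : Rd d) n ×ˢ Metric.closedBall (0 : Rd d) n) ∩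
      {z | (singularKernel α z : ℝ) ≤ n})
    (fun n => (measurableSet_closedBall.prod measurableSet_closedBall).inter
      (measurableSet_le (measurable_singularKernel α).coe_nnreal_real measurable_const))
    (fun n k hnk => Set.inter_subset_inter (Set.prod_mono
      (Metric.closedBall_subset_closedBall (Nat.cast_le.2 hnk))
      (Metric.closedBall_subset_closedBall (Nat.cast_le.2 hnk)))
      fun z hz => le_trans (show (singularKernel α z : ℝ) ≤ n from hz) (Nat.cast_le.2 hnk))
    (fun z => by
      obtain ⟨n, hn⟩ := exists_nat_ge (max (max ‖z.1‖ ‖z.2‖) (singularKernel α z : ℝ))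
      rw [max_le_iff, max_le_iff] at hn
      exact ⟨n, ⟨mem_closedBall_zero_iff.2 hn.1.1, mem_closedBall_zero_iff.2 hn.1.2⟩, hn.2⟩)
    (show 0 < τ / (2 * (C + 1)) by positivity)
  set H : Rd d × Rd d → ℝ := fun z => singularKernel α z * G' z with hHdef
  have hHm : Measurable H := (measurable_singularKernel α).coe_nnreal_real.mul hGm
  have hHM : ∀ z, |H z| ≤ n * n := fun z => by
    by_cases hz : z ∈ (Metric.closedBall (0 : Rd d) n ×ˢ Metric.closedBall (0 : Rd d) n) ∩
      {z | (singularKernel α z : ℝ) ≤ n}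
    · rw [abs_mul, abs_of_nonneg (NNReal.coe_nonneg _)]
      exact mul_le_mul hz.2 (hGn z) (abs_nonneg _) (by positivity)
    · rw [hHdef]
      simp only [hGS z hz, mul_zero, abs_zero]
      positivity
  have hHR : ∀ z : Rd d × Rd d, ¬ (z.1 ∈ Metric.closedBall (0 : Rd d) n ∧
      z.2 ∈ Metric.closedBall (0 : Rd d) n) → H z = 0 := fun z hz => by
    rw [hHdef]
    simp only [hGS z fun h => hz h.1, mul_zero]
  have hf := eventually_abs_integral_fst_le (l := l) hα (hp := hp) hb hbC hlim hHm hHM hHR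
    (show 0 < τ / 4 by positivity)
  have hs := eventually_abs_integral_snd_le (l := l) hα (hp := hp) hb hbC hlim hHm hHM hHR
    (show 0 < τ / 4 by positivity)
  filter_upwards [hb, hf, hs] with i hbi hfi hsi v
  have hv := Lp.memLp v.1
  have hvi := (memLp_increment_iff (α := α) hp0 hv.1).2 v.2
  have hD : 0 ≤ ‖sobolevEmbedding d α p hp v‖ := Lp_norm_nonneg
  have hbk : AEStronglyMeasurable (b i) (gagliardoMeasure d α) :=
    hbi.mono_ac gagliardoMeasure_absolutelyContinuous
  have hG'mem : MemLp G' (ENNReal.ofReal (p / (p - 1))) (gagliardoMeasure d α) := by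
    refine (hG.sub hGG).ae_eq (.of_forall fun x => ?_)
    simp
  have i1 := integrable_mul_of_holder hp (memLp_bdd_mul hbk (hbC i) hGG) hvi
  have i2 := integrable_mul_of_holder hp (memLp_bdd_mul hbk (hbC i) hG'mem) hvi
  have e : ∫ z, b i z * G z * increment v.1 z ∂(gagliardoMeasure d α) =
      (∫ z, b i z * (G z - G' z) * increment v.1 z ∂(gagliardoMeasure d α)) +
        ∫ z, b i z * G' z * increment v.1 z ∂(gagliardoMeasure d α) := by
    rw [← integral_add i1 i2]
    congr 1; funext x; ring
  have hbH : ∀ z, |b i z * H z| ≤ C * (n * n) := fun z => by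
    rw [abs_mul]; exact mul_le_mul (hbC i z) (hHM z) (abs_nonneg _) hC
  have hvR := integrableOn_closedBall_of_memLp hp hv n
  have j1 := integrable_of_bounded_support (hbi.mul hHm.aestronglyMeasurable) hbH
    (fun z hz => by rw [Pi.mul_apply, hHR z hz, mul_zero]) hv.1 hvR
  have hswap : MeasurePreserving (Prod.swap : Rd d × Rd d → Rd d × Rd d) volume volume :=
    Measure.measurePreserving_swap
  have j2 : Integrable (fun z : Rd d × Rd d => b i z * H z * v.1 z.2) volume := by
    have h := integrable_of_bounded_support
      ((hbi.mul hHm.aestronglyMeasurable).comp_measurePreserving hswap) (fun z => hbH z.swap)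
      (fun z hz => by
        rw [Function.comp_apply, Pi.mul_apply, hHR z.swap fun h => hz ⟨h.2, h.1⟩, mul_zero])
      hv.1 hvR
    exact hswap.integrable_comp_of_integrable h
  have e2 : ∫ z, b i z * G' z * increment v.1 z ∂(gagliardoMeasure d α) =
      (∫ z, b i z * H z * v.1 z.2) - ∫ z, b i z * H z * v.1 z.1 := by
    rw [← integral_sub j2 (by exact j1), integral_gagliardoMeasure]
    congr 1; funext z
    simp only [hHdef, coe_singularKernel, increment]
    ring
  have h1 := abs_integral_bdd_mul_le hp hbk (hbC i) hGG hvi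
  have h2 := h1.trans (mul_le_mul_of_nonneg_left (mul_le_mul hGτ
    (norm_le_norm_sobolevEmbedding v).2 (by positivity) (by positivity)) hC)
  have h3 : C * (τ / (2 * (C + 1))) ≤ τ / 2 := by
    rw [mul_div_assoc', div_le_div_iff₀ (by positivity) (by positivity)]
    nlinarith
  rw [← mul_assoc] at h2
  have h4 := h2.trans (mul_le_mul_of_nonneg_right h3 hD)
  rw [e, e2]
  refine (abs_add_le _ _).trans ((add_le_add h4 ((abs_sub _ _).trans
    (add_le_add (hsi v) (hfi v)))).trans (le_of_eq ?_))
  ring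

end UniformConvergence

/-! ### Convergence of solutions for weakly convergent coefficients -/

section Solutions

variable {d : ℕ} {α p : ℝ}

/-- The functional `v ↦ -∫ g v`. -/
def sourceFunctional (α : ℝ) (hp : 1 < p) {g : Rd d → ℝ}
    (hg : MemLp g (ENNReal.ofReal (p / (p - 1))) volume) : Sobolev d α p hp →ₗ[ℝ] ℝ where
  toFun v := -∫ x, g x * v.1 x
  map_add' v w := by
    rw [← neg_add, ← integral_add (integrable_mul_of_holder hp hg (Lp.memLp v.1))
      (integrable_mul_of_holder hp hg (Lp.memLp w.1))]
    congr 1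
    refine integral_congr_ae ?_
    filter_upwards [Lp.coeFn_add v.1 w.1] with x hx
    rw [← mul_add, Submodule.coe_add, hx, Pi.add_apply]
  map_smul' c v := by
    rw [RingHom.id_apply, smul_eq_mul, mul_neg, ← integral_const_mul]
    congr 1
    refine integral_congr_ae ?_
    filter_upwards [Lp.coeFn_smul c v.1] with x hx
    rw [Submodule.coe_smul, hx, Pi.smul_apply, smul_eq_mul]
    ring

lemma sumWeight_bounds {m c C : ℝ} (hm : 0 < m) (hc : 0 < c) {ν : Rd d → ℝ}
    {a : Rd d × Rd d → ℝ} (hν : ∀ x, c ≤ ν x ∧ ν x ≤ C) (ha : ∀ z, c ≤ a z ∧ a z ≤ C)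
    (y : Rd d ⊕ (Rd d × Rd d)) :
    min (m * c) (c / 2) ≤ sumWeight m ν a y ∧ |sumWeight m ν a y| ≤ max (m * C) (C / 2) := by
  cases y with
  | inl x =>
    have h := hν x
    have h0 : 0 < m * ν x := mul_pos hm (hc.trans_le h.1)
    simp only [sumWeight, Sum.elim_inl, abs_of_pos h0]
    exact ⟨(min_le_left _ _).trans (mul_le_mul_of_nonneg_left h.1 hm.le),
      (mul_le_mul_of_nonneg_left h.2 hm.le).trans (le_max_left _ _)⟩
  | inr z =>
    have h := ha z
    have h0 : 0 < a z / 2 := half_pos (hc.trans_le h.1)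
    simp only [sumWeight, Sum.elim_inr, abs_of_pos h0]
    exact ⟨(min_le_right _ _).trans (by linarith), le_trans (by linarith) (le_max_right _ _)⟩

lemma existsUnique_isWeakSolution (hp : 1 < p) {m c C : ℝ} (hm : 0 < m) (hc : 0 < c)
    {Λ : Rd d → Rd d → ℝ} {ν f : Rd d → ℝ} (hν : AEStronglyMeasurable ν volume)
    (ha : AEStronglyMeasurable (fun z : Rd d × Rd d => ν z.1 * Λ z.1 z.2) volume)
    (hνb : ∀ x, c ≤ ν x ∧ ν x ≤ C) (hab : ∀ x y, c ≤ ν x * Λ x y ∧ ν x * Λ x y ≤ C)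
    (hf : MemLp f (ENNReal.ofReal (p / (p - 1))) volume) :
    ∃! u : Sobolev d α p hp, IsWeakSolution m Λ ν f u := by
  have : Fact (1 ≤ ENNReal.ofReal p) := ⟨by rw [ENNReal.one_le_ofReal]; exact hp.le⟩
  have hb := sumWeight_bounds hm hc hνb (a := fun z => ν z.1 * Λ z.1 z.2) fun z => hab _ _
  have hνa : ∀ x, |ν x| ≤ C := fun x => by
    rw [abs_of_pos (hc.trans_le (hνb x).1)]; exact (hνb x).2
  have h := existsUnique_weightedForm_eq (D := sobolevEmbedding d α p hp) hp
    injective_sobolevEmbedding isClosed_range_sobolevEmbedding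
    (lt_min (mul_pos hm hc) (half_pos hc)) (aestronglyMeasurable_sumWeight m hν ha)
    (fun y => (hb y).1) (fun y => (hb y).2)
    (sourceFunctional α hp (memLp_bdd_mul hν hνa hf))
    (K := C * (∫ x, |f x| ^ (p / (p - 1))) ^ (1 / (p / (p - 1)))) (fun v => by
      have hC : 0 ≤ C := (abs_nonneg _).trans (hνa 0)
      have h1 := abs_integral_bdd_mul_le hp hν hνa hf (Lp.memLp v.1)
      have h2 := mul_le_mul_of_nonneg_left (mul_le_mul_of_nonneg_left
        (norm_le_norm_sobolevEmbedding v).1 (show 0 ≤ (∫ x, |f x| ^ (p / (p - 1))) ^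
          (1 / (p / (p - 1))) by positivity)) hC
      simp only [sourceFunctional, LinearMap.coe_mk, AddHom.coe_mk, abs_neg]
      rw [mul_assoc]
      exact h1.trans h2)
  refine (existsUnique_congr fun u => ?_).2 h
  exact isWeakSolution_iff hν ha (fun y => (hb y).2) u

/-- Solutions converge strongly in the Sobolev space if the weights and the weighted kernels
converge weakly-*. -/
theorem tendsto_sobolev_of_weakStar (hα : 0 < α) (hp : 1 < p) {m c C : ℝ} (hm : 0 < m)
    (hc : 0 < c) {ι : Type*} {l : Filter ι} [l.IsCountablyGenerated]
    {Λ : ι → Rd d → Rd d → ℝ} {Λ₀ : Rd d → Rd d → ℝ} {ν : ι → Rd d → ℝ} {ν₀ f : Rd d → ℝ}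
    (hν : ∀ᶠ i in l, AEStronglyMeasurable (ν i) volume)
    (hν₀ : AEStronglyMeasurable ν₀ volume)
    (ha : ∀ᶠ i in l, AEStronglyMeasurable (fun z : Rd d × Rd d => ν i z.1 * Λ i z.1 z.2) volume)
    (ha₀ : AEStronglyMeasurable (fun z : Rd d × Rd d => ν₀ z.1 * Λ₀ z.1 z.2) volume)
    (hνb : ∀ i x, c ≤ ν i x ∧ ν i x ≤ C) (hν₀b : ∀ x, c ≤ ν₀ x ∧ ν₀ x ≤ C)
    (hab : ∀ i x y, c ≤ ν i x * Λ i x y ∧ ν i x * Λ i x y ≤ C)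
    (ha₀b : ∀ x y, c ≤ ν₀ x * Λ₀ x y ∧ ν₀ x * Λ₀ x y ≤ C)
    (hνlim : ∀ h : Rd d → ℝ, Integrable h →
      Tendsto (fun i => ∫ x, (ν i x - ν₀ x) * h x) l (𝓝 0))
    (halim : ∀ h : Rd d × Rd d → ℝ, Integrable h →
      Tendsto (fun i => ∫ z, (ν i z.1 * Λ i z.1 z.2 - ν₀ z.1 * Λ₀ z.1 z.2) * h z) l (𝓝 0))
    (hf : MemLp f (ENNReal.ofReal (p / (p - 1))) volume)
    {u : ι → Sobolev d α p hp} {u₀ : Sobolev d α p hp}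
    (hu : ∀ᶠ i in l, IsWeakSolution m (Λ i) (ν i) f (u i)) (hu₀ : IsWeakSolution m Λ₀ ν₀ f u₀) :
    Tendsto (fun i => sobolevNorm (u i - u₀)) l (𝓝 0) := by
  have : Fact (1 ≤ ENNReal.ofReal p) := ⟨by rw [ENNReal.one_le_ofReal]; exact hp.le⟩
  have hp0 : 0 < p := by linarith
  have hC0 : 0 ≤ C := hc.le.trans ((hν₀b 0).1.trans (hν₀b 0).2)
  set D := sobolevEmbedding d α p hp with hD
  set w : ι → Rd d ⊕ (Rd d × Rd d) → ℝ := fun i =>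
    sumWeight m (ν i) fun z => ν i z.1 * Λ i z.1 z.2 with hw
  set w₀ : Rd d ⊕ (Rd d × Rd d) → ℝ := sumWeight m ν₀ fun z => ν₀ z.1 * Λ₀ z.1 z.2 with hw₀
  have hb : ∀ i y, min (m * c) (c / 2) ≤ w i y ∧ |w i y| ≤ max (m * C) (C / 2) := fun i =>
    sumWeight_bounds hm hc (hνb i) fun z => hab i _ _
  have hb₀ : ∀ y, min (m * c) (c / 2) ≤ w₀ y ∧ |w₀ y| ≤ max (m * C) (C / 2) :=
    sumWeight_bounds hm hc hν₀b fun z => ha₀b _ _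
  have hνa : ∀ i x, |ν i x| ≤ C := fun i x => by
    rw [abs_of_pos (hc.trans_le (hνb i x).1)]; exact (hνb i x).2
  have hν₀a : ∀ x, |ν₀ x| ≤ C := fun x => by
    rw [abs_of_pos (hc.trans_le (hν₀b x).1)]; exact (hν₀b x).2
  -- Both values lie in `[c, C]` with `c > 0`, so the difference needs no constant larger than `C`.
  have hdν : ∀ i x, |ν i x - ν₀ x| ≤ C := fun i x => by
    rw [abs_le]
    constructor <;> linarith [(hνb i x).1, (hνb i x).2, (hν₀b x).1, (hν₀b x).2]
  have hda : ∀ i (z : Rd d × Rd d), |ν i z.1 * Λ i z.1 z.2 - ν₀ z.1 * Λ₀ z.1 z.2| ≤ C :=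
    fun i z => by
      rw [abs_le]
      have h1 := hab i z.1 z.2
      have h2 := ha₀b z.1 z.2
      constructor <;> linarith [h1.1, h1.2, h2.1, h2.2]
  have hu0mem := Lp.memLp u₀.1
  have hu0inc := (memLp_increment_iff (α := α) hp0 hu0mem.1).2 u₀.2
  have key : Tendsto (fun i => ‖D (u i) - D u₀‖) l (𝓝 0) := by
    refine tendsto_of_weightedForm_eq (D := D) hp (lt_min (mul_pos hm hc) (half_pos hc))
      (w := w) (w₀ := w₀) (ℓ := fun i v => -∫ x, ν i x * f x * v.1 x)
      (ℓ₀ := fun v => -∫ x, ν₀ x * f x * v.1 x) (C := max (m * C) (C / 2))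
      (K := C * (∫ x, |f x| ^ (p / (p - 1))) ^ (1 / (p / (p - 1)))) ?_ ?_ ?_ ?_ ?_ ?_
    · filter_upwards [hν, ha] with i h1 h2
      exact ⟨aestronglyMeasurable_sumWeight m h1 h2, hb i⟩
    · filter_upwards [hν] with i hi v
      have h1 := abs_integral_bdd_mul_le hp hi (hνa i) hf (Lp.memLp v.1)
      have h2 := mul_le_mul_of_nonneg_left (mul_le_mul_of_nonneg_left
        (norm_le_norm_sobolevEmbedding v).1 (show 0 ≤ (∫ x, |f x| ^ (p / (p - 1))) ^
          (1 / (p / (p - 1))) by positivity)) hC0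
      rw [mul_assoc, abs_neg]
      exact h1.trans h2
    · filter_upwards [hν, ha, hu] with i h1 h2 h3
      exact (isWeakSolution_iff h1 h2 (fun y => (hb i y).2) _).1 h3
    · exact (isWeakSolution_iff hν₀ ha₀ (fun y => (hb₀ y).2) _).1 hu₀
    · intro τ hτ
      -- At the fixed function `u₀` the nonlinear densities of the mass term and of the energy are
      -- fixed elements of the dual `L^q` spaces, so only the coefficient errors depend on `i`.
      have hC1 := eventually_abs_integral_mul_le (l := l) hα (hp := hp)
        (b := fun i x => ν i x - ν₀ x) (hν.mono fun i hi => hi.sub hν₀) hdν hνlim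
        ((memLp_signedPow hp hu0mem).const_mul m) (half_pos hτ)
      have hC2 := eventually_abs_integral_increment_le (l := l) hα (hp := hp)
        (b := fun i z => ν i z.1 * Λ i z.1 z.2 - ν₀ z.1 * Λ₀ z.1 z.2)
        (ha.mono fun i hi => hi.sub ha₀) hda halim
        ((memLp_signedPow hp hu0inc).const_mul (1 / 2)) (half_pos hτ)
      filter_upwards [hν, ha, hC1, hC2] with i h1 h2 h3 h4 v
      have hvmem := memLp_withIncrement v
      have e1 := weightedForm_sobolevEmbedding h1 h2 (fun y => (hb i y).2) u₀ v
      have e2 := weightedForm_sobolevEmbedding hν₀ ha₀ (fun y => (hb₀ y).2) u₀ v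
      have j1 := integrable_sobolevMeasure_iff.1 (integrable_form hp
        (aestronglyMeasurable_sumWeight m h1 h2) (fun y => (hb i y).2)
        (memLp_withIncrement u₀) (memLp_withIncrement v))
      have j2 := integrable_sobolevMeasure_iff.1 (integrable_form hp
        (aestronglyMeasurable_sumWeight m hν₀ ha₀) (fun y => (hb₀ y).2)
        (memLp_withIncrement u₀) (memLp_withIncrement v))
      have e3 : weightedForm D (w i) u₀ v - weightedForm D w₀ u₀ v =
          (∫ x, (ν i x - ν₀ x) * (m * signedPow p (u₀.1 x)) * v.1 x) +
          ∫ z, (ν i z.1 * Λ i z.1 z.2 - ν₀ z.1 * Λ₀ z.1 z.2) *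
            (1 / 2 * signedPow p (increment u₀.1 z)) * increment v.1 z
              ∂(gagliardoMeasure d α) := by
        have s1 := integral_sub j1.1 j2.1
        have s2 := integral_sub j1.2 j2.2
        simp only [sumWeight, withIncrement, Sum.elim_inl, Sum.elim_inr] at s1 s2
        rw [e1, e2, add_sub_add_comm, ← s1, ← s2]
        congr 1
        · congr 1; funext x; ring
        · congr 1; funext z; ring
      rw [e3]
      refine (abs_add_le _ _).trans ((add_le_add (h3 v) (h4 v)).trans (le_of_eq ?_))
      ring
    · intro τ hτ
      have hC1 := eventually_abs_integral_mul_le (l := l) hα (hp := hp)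
        (b := fun i x => ν i x - ν₀ x) (hν.mono fun i hi => hi.sub hν₀) hdν hνlim hf hτ
      filter_upwards [hν, hC1] with i h1 h3 v
      refine le_trans (le_of_eq ?_) (h3 v)
      have j1 := integrable_mul_of_holder hp (memLp_bdd_mul h1 (hνa i) hf) (Lp.memLp v.1)
      have j2 := integrable_mul_of_holder hp (memLp_bdd_mul hν₀ hν₀a hf) (Lp.memLp v.1)
      rw [← abs_neg, neg_sub, sub_neg_eq_add, neg_add_eq_sub, ← integral_sub j1 j2]
      congr 2; funext x; ring
  refine key.congr fun i => ?_
  rw [← map_sub, hD, norm_sobolevEmbedding]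

lemma norm_le_sobolevNorm {hp : 1 < p} (u : Sobolev d α p hp) : ‖u.1‖ ≤ sobolevNorm u := by
  rw [← norm_sobolevEmbedding, Lp_norm_eq (by linarith)]
  exact (norm_le_norm_sobolevEmbedding u).1

lemma weakTendsto_of_tendsto_sobolevNorm {hp : 1 < p} {ι : Type*} {l : Filter ι}
    {u : ι → Sobolev d α p hp} {u₀ : Sobolev d α p hp}
    (h : Tendsto (fun i => sobolevNorm (u i - u₀)) l (𝓝 0)) : WeakTendsto u l u₀ := by
  rintro ℓ ⟨C, hC⟩
  rw [tendsto_iff_norm_sub_tendsto_zero]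
  refine squeeze_zero (fun _ => norm_nonneg _) (fun i => ?_) (by simpa using h.const_mul C)
  rw [← map_sub]
  exact hC _

/-- A constant weight multiplies the whole identity. This passes between the limit weight `n₀`,
which homogenization produces, and the weight `1`. -/
lemma isWeakSolution_const_weight_iff {hp : 1 < p} {m c : ℝ} (hc : c ≠ 0)
    {Λ : Rd d → Rd d → ℝ} {f : Rd d → ℝ} {u : Sobolev d α p hp} :
    IsWeakSolution m Λ (fun _ => c) f u ↔ IsWeakSolution m Λ (fun _ => 1) f u := by
  refine forall_congr' fun v => ?_
  have e1 : energyForm α p (fun x y => c * Λ x y) u.1 v.1 =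
      c * energyForm α p (fun x y => 1 * Λ x y) u.1 v.1 := by
    unfold energyForm
    rw [mul_left_comm, ← integral_const_mul c]
    congr 2; funext z; ring
  rw [e1, integral_mul_const, integral_mul_const, integral_mul_const, integral_mul_const]
  constructor
  · intro h
    refine mul_left_cancel₀ hc ?_
    linear_combination h
  · intro h
    linear_combination c * h

end Solutions

/-! ### The unit cube as a period cell -/

section UnitCube

variable {d : ℕ}

/-- The standard basis of `ℝ^d`. -/
def stdBasis (d : ℕ) : Module.Basis (Fin d) ℝ (Rd d) := (EuclideanSpace.basisFun (Fin d) ℝ).toBasis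

lemma stdBasis_apply (i : Fin d) : stdBasis d i = EuclideanSpace.single i 1 := by
  simp [stdBasis]

lemma fundamentalDomain_stdBasis :
    ZSpan.fundamentalDomain (stdBasis d) = {ξ : Rd d | ∀ i, ξ i ∈ Set.Ico (0 : ℝ) 1} := by
  ext ξ
  simp [ZSpan.mem_fundamentalDomain, stdBasis]

lemma unitCube_eq_preimage : unitCube d = (MeasurableEquiv.toLp 2 (Fin d → ℝ)).symm ⁻¹'
    Set.Icc (fun _ => (0 : ℝ)) fun _ => 1 := by
  ext ξ
  simp [unitCube, Pi.le_def, forall_and]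

lemma fundamentalDomain_ae_eq_unitCube :
    ZSpan.fundamentalDomain (stdBasis d) =ᵐ[volume] unitCube d := by
  have hmp := EuclideanSpace.volume_preserving_symm_measurableEquiv_toLp (Fin d)
  have h := Measure.univ_pi_Ico_ae_eq_Icc (μ := fun _ : Fin d => (volume : Measure ℝ))
    (f := fun _ => 0) (g := fun _ => 1)
  have h2 := hmp.quasiMeasurePreserving.preimage_ae_eq h
  have e1 : ZSpan.fundamentalDomain (stdBasis d) = (MeasurableEquiv.toLp 2 (Fin d → ℝ)).symm ⁻¹'
      Set.univ.pi fun _ => Set.Ico (0 : ℝ) 1 := by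
    rw [fundamentalDomain_stdBasis]
    ext ξ
    simp
  rw [e1, unitCube_eq_preimage]
  exact h2

lemma volume_unitCube : volume (unitCube d) = 1 := by
  have hmp := EuclideanSpace.volume_preserving_symm_measurableEquiv_toLp (Fin d)
  rw [unitCube_eq_preimage, hmp.measure_preimage_equiv, Real.volume_Icc_pi]
  simp

lemma volume_fundamentalDomain : volume (ZSpan.fundamentalDomain (stdBasis d)) = 1 := by
  rw [measure_congr fundamentalDomain_ae_eq_unitCube, volume_unitCube]

lemma fundamentalDomain_prod :
    ZSpan.fundamentalDomain ((stdBasis d).prod (stdBasis d)) =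
      ZSpan.fundamentalDomain (stdBasis d) ×ˢ ZSpan.fundamentalDomain (stdBasis d) := by
  ext z
  simp [ZSpan.mem_fundamentalDomain]

lemma volume_fundamentalDomain_prod :
    volume (ZSpan.fundamentalDomain ((stdBasis d).prod (stdBasis d))) = 1 := by
  rw [fundamentalDomain_prod, Measure.volume_eq_prod, Measure.prod_prod, volume_fundamentalDomain,
    one_mul]

lemma restrict_fundamentalDomain_prod :
    (volume : Measure (Rd d × Rd d)).restrict
      (ZSpan.fundamentalDomain ((stdBasis d).prod (stdBasis d))) =
    (volume.restrict (unitCube d)).prod (volume.restrict (unitCube d)) := by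
  rw [fundamentalDomain_prod, Measure.volume_eq_prod, ← Measure.prod_restrict,
    Measure.restrict_congr_set fundamentalDomain_ae_eq_unitCube]

instance : (volume : Measure (Rd d × Rd d)).IsAddHaarMeasure :=
  Measure.prod.instIsAddHaarMeasure volume volume

instance : IsProbabilityMeasure (volume.restrict (unitCube d)) := ⟨by simp [volume_unitCube]⟩

lemma setIntegral_fundamentalDomain_prod {C : ℝ} {F : Rd d × Rd d → ℝ}
    (hF : AEMeasurable F volume) (hC : ∀ w, |F w| ≤ C) :
    ∫ w in ZSpan.fundamentalDomain ((stdBasis d).prod (stdBasis d)), F w =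
      ∫ η in unitCube d, ∫ ξ in unitCube d, F (ξ, η) := by
  have hi : Integrable F (volume.restrict
      (ZSpan.fundamentalDomain ((stdBasis d).prod (stdBasis d)))) := by
    rw [restrict_fundamentalDomain_prod]
    refine Integrable.of_bound ?_ C (.of_forall hC)
    rw [← restrict_fundamentalDomain_prod]
    exact hF.aestronglyMeasurable.restrict
  rw [restrict_fundamentalDomain_prod] at hi ⊢
  exact integral_prod_symm _ hi

/-- A kernel is an oscillating function on the product space: `(x, y)` is the slow variable, `(x/ε,
y/ε)` the fast one, and the lattice is generated by the product basis. -/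
lemma isOscillating_pair {C : ℝ} {Λ : Rd d → Rd d → Rd d → Rd d → ℝ}
    (hc : ∀ ξ η, Continuous fun z : Rd d × Rd d => Λ z.1 z.2 ξ η)
    (hm : ∀ x y, AEMeasurable (fun w : Rd d × Rd d => Λ x y w.1 w.2) volume)
    (hξ : ∀ x y η, UnitPeriodic fun ξ => Λ x y ξ η)
    (hη : ∀ x y ξ, UnitPeriodic fun η => Λ x y ξ η)
    (hC : ∀ x y ξ η, |Λ x y ξ η| ≤ C) :
    IsOscillating volume ((stdBasis d).prod (stdBasis d)) C
      fun (z w : Rd d × Rd d) => Λ z.1 z.2 w.1 w.2 where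
  cont w := hc w.1 w.2
  meas z := hm z.1 z.2
  periodic z i w := by
    cases i with
    | inl i => simpa [stdBasis_apply] using hξ z.1 z.2 w.2 i w.1
    | inr i => simpa [stdBasis_apply] using hη z.1 z.2 w.1 i w.2
  bound z w := hC _ _ _ _

lemma setIntegral_unitCube_bounds {a b : ℝ} {g : Rd d → ℝ} (hg : AEMeasurable g volume)
    (h : ∀ ξ, a ≤ g ξ ∧ g ξ ≤ b) :
    a ≤ ∫ ξ in unitCube d, g ξ ∧ ∫ ξ in unitCube d, g ξ ≤ b := by
  have hi : Integrable g (volume.restrict (unitCube d)) :=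
    Integrable.of_bound hg.aestronglyMeasurable.restrict (max |a| |b|)
      (.of_forall fun ξ => abs_le_max_abs_abs (h ξ).1 (h ξ).2)
  have h1 := integral_mono (integrable_const a) hi fun ξ => (h ξ).1
  have h2 := integral_mono hi (integrable_const b) fun ξ => (h ξ).2
  simpa using And.intro h1 h2

end UnitCube

/-! ### Homogenization -/

section Homogenization

variable {d : ℕ} {α p : ℝ}

/-- The common reduction of both kinds of coefficients: what remains is to identify the weak-*
limits, where the limit weight is a constant `n₀`. -/
lemma homogenization_of_weakStar (hα : 0 < α) (hp : 1 < p) {m c C n₀ : ℝ} (hm : 0 < m)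
    (hc : 0 < c) {Λ : ℝ → Rd d → Rd d → ℝ} {Λ₀ : Rd d → Rd d → ℝ} {ν : ℝ → Rd d → ℝ}
    {f : Rd d → ℝ} (hν : ∀ ε > 0, AEStronglyMeasurable (ν ε) volume)
    (ha : ∀ ε > 0, AEStronglyMeasurable (fun z : Rd d × Rd d => ν ε z.1 * Λ ε z.1 z.2) volume)
    (ha₀ : AEStronglyMeasurable (fun z : Rd d × Rd d => n₀ * Λ₀ z.1 z.2) volume)
    (hνb : ∀ ε x, c ≤ ν ε x ∧ ν ε x ≤ C) (hn₀ : c ≤ n₀ ∧ n₀ ≤ C)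
    (hab : ∀ ε x y, c ≤ ν ε x * Λ ε x y ∧ ν ε x * Λ ε x y ≤ C)
    (ha₀b : ∀ x y, c ≤ n₀ * Λ₀ x y ∧ n₀ * Λ₀ x y ≤ C)
    (hνlim : ∀ h : Rd d → ℝ, Integrable h →
      Tendsto (fun ε => ∫ x, (ν ε x - n₀) * h x) (𝓝[>] 0) (𝓝 0))
    (halim : ∀ h : Rd d × Rd d → ℝ, Integrable h →
      Tendsto (fun ε => ∫ z, (ν ε z.1 * Λ ε z.1 z.2 - n₀ * Λ₀ z.1 z.2) * h z) (𝓝[>] 0) (𝓝 0))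
    (hf : MemLp f (ENNReal.ofReal (p / (p - 1))) volume) :
    (∀ ε : ℝ, 0 < ε → ∃! u : Sobolev d α p hp, IsWeakSolution m (Λ ε) (ν ε) f u) ∧
    (∃! u₀ : Sobolev d α p hp, IsWeakSolution m Λ₀ (fun _ => 1) f u₀) ∧
    ∀ (u : ℝ → Sobolev d α p hp) (u₀ : Sobolev d α p hp),
      (∀ ε : ℝ, 0 < ε → IsWeakSolution m (Λ ε) (ν ε) f (u ε)) →
      IsWeakSolution m Λ₀ (fun _ => 1) f u₀ →
      Tendsto (fun ε => ‖(u ε).1 - u₀.1‖) (𝓝[>] 0) (𝓝 0) ∧ WeakTendsto u (𝓝[>] 0) u₀ := by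
  have hn₀0 : n₀ ≠ 0 := (hc.trans_le hn₀.1).ne'
  refine ⟨fun ε hε => existsUnique_isWeakSolution hp hm hc (hν ε hε) (ha ε hε) (hνb ε) (hab ε) hf,
    ?_, fun u u₀ hu hu₀ => ?_⟩
  · simp only [← isWeakSolution_const_weight_iff hn₀0]
    exact existsUnique_isWeakSolution hp hm hc aestronglyMeasurable_const ha₀ (fun _ => hn₀)
      ha₀b hf
  · have h := tendsto_sobolev_of_weakStar (l := 𝓝[>] (0 : ℝ)) hα hp hm hc
      (eventually_mem_of_tendsto_nhdsWithin tendsto_id |>.mono hν) aestronglyMeasurable_const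
      (eventually_mem_of_tendsto_nhdsWithin tendsto_id |>.mono ha) ha₀ hνb (fun _ => hn₀) hab
      ha₀b hνlim halim hf
      (eventually_mem_of_tendsto_nhdsWithin tendsto_id |>.mono hu)
      ((isWeakSolution_const_weight_iff hn₀0).2 hu₀)
    refine ⟨squeeze_zero (fun _ => Lp_norm_nonneg) (fun ε => ?_) h,
      weakTendsto_of_tendsto_sobolevNorm h⟩
    rw [← Submodule.coe_sub]
    exact norm_le_sobolevNorm _

end Homogenization

end NonlocalHomogenization

end

/-! ### Verification of the weak-* limits for the two kinds of coefficients. -/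

open NonlocalHomogenization in
theorem theorem1p2 {d : ℕ} (hd : 0 < d) {α p m γ : ℝ} (hα : 0 < α) (hα2 : α < 2)
    (hp : 1 < p) (hm : 0 < m) (hγ : 1 < γ)
    (K : NonlocalHomogenization.Coefficient d) (hK : K.Admissible γ)
    (f : NonlocalHomogenization.Rd d → ℝ)
    (hf : MemLp f (ENNReal.ofReal (p / (p - 1))) volume) :
    (∀ ε : ℝ, 0 < ε → ∃! u : NonlocalHomogenization.Sobolev d α p hp,
      NonlocalHomogenization.IsWeakSolution m (K.kernel ε) (K.weight ε) f u) ∧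
    (∃! u₀ : NonlocalHomogenization.Sobolev d α p hp,
      NonlocalHomogenization.IsWeakSolution m K.effective (fun _ => 1) f u₀) ∧
    ∀ (u : ℝ → NonlocalHomogenization.Sobolev d α p hp)
      (u₀ : NonlocalHomogenization.Sobolev d α p hp),
      (∀ ε : ℝ, 0 < ε →
        NonlocalHomogenization.IsWeakSolution m (K.kernel ε) (K.weight ε) f (u ε)) →
      NonlocalHomogenization.IsWeakSolution m K.effective (fun _ => 1) f u₀ →
      Tendsto (fun ε => ‖(u ε).1 - u₀.1‖) (𝓝[>] 0) (𝓝 0) ∧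
      NonlocalHomogenization.WeakTendsto u (𝓝[>] 0) u₀ := by
  have hγ0 : 0 < γ := by linarith
  have hγi : 0 < γ⁻¹ := inv_pos.2 hγ0
  have hγi1 : γ⁻¹ ≤ 1 := inv_le_one_of_one_le₀ hγ.le
  cases K with
  | product lam mu =>
    obtain ⟨hlm, hmm, hlp, hmp, hlb, hmb⟩ := hK
    have hl0 : ∀ ξ, 0 < lam ξ := fun ξ => hγi.trans_le (hlb ξ).1
    have hmul : ∀ s t : ℝ, γ⁻¹ ≤ s ∧ s ≤ γ → γ⁻¹ ≤ t ∧ t ≤ γ →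
        γ⁻¹ * γ⁻¹ ≤ s * t ∧ s * t ≤ γ * γ := fun s t hs ht =>
      ⟨mul_le_mul hs.1 ht.1 hγi.le (hγi.le.trans hs.1),
        mul_le_mul hs.2 ht.2 (hγi.le.trans ht.1) hγ0.le⟩
    have habs : ∀ t : ℝ, γ⁻¹ * γ⁻¹ ≤ t ∧ t ≤ γ * γ → |t| ≤ γ * γ := fun t ht => by
      rw [abs_of_pos ((mul_pos hγi hγi).trans_le ht.1)]; exact ht.2
    have hνb : ∀ ξ, γ⁻¹ * γ⁻¹ ≤ mu ξ / lam ξ ∧ mu ξ / lam ξ ≤ γ * γ := fun ξ => by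
      rw [div_eq_mul_inv]
      refine hmul _ _ (hmb ξ) ⟨inv_anti₀ (hl0 ξ) (hlb ξ).2, ?_⟩
      rw [← inv_inv γ]
      exact inv_anti₀ hγi (hlb ξ).1
    have hνm : AEMeasurable (fun ξ => mu ξ / lam ξ) volume := hmm.div hlm
    have hν : IsOscillating volume (stdBasis d) (γ * γ) fun (_ ξ : Rd d) => mu ξ / lam ξ :=
      { cont := fun _ => continuous_const
        meas := fun _ => hνm
        periodic := fun _ i ξ => by rw [stdBasis_apply, hmp i ξ, hlp i ξ]
        bound := fun _ ξ => habs _ (hνb ξ) }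
    have hpm : AEMeasurable (fun w : Rd d × Rd d => mu w.1 * mu w.2) volume :=
      (hmm.comp_quasiMeasurePreserving Measure.quasiMeasurePreserving_fst).mul
        (hmm.comp_quasiMeasurePreserving Measure.quasiMeasurePreserving_snd)
    -- The weight cancels `lam`, so the coefficient that oscillates in the energy is the symmetric
    -- product of two copies of `mu`.
    have ha := isOscillating_pair (C := γ * γ) (Λ := fun (_ _ : Rd d) ξ η => mu ξ * mu η)
      (fun _ _ => continuous_const) (fun _ _ => hpm)
      (fun _ _ η i ξ => by simp only [hmp i ξ]) (fun _ _ ξ i η => by simp only [hmp i η])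
      (fun _ _ ξ η => habs _ (hmul _ _ (hmb ξ) (hmb η)))
    set n₀ := ∫ ξ in unitCube d, mu ξ / lam ξ with hn₀
    set M := ∫ ξ in unitCube d, mu ξ with hM
    have hn₀b := setIntegral_unitCube_bounds hνm hνb
    have hMb := setIntegral_unitCube_bounds hmm hmb
    have hn₀0 : n₀ ≠ 0 := ((mul_pos hγi hγi).trans_le hn₀b.1).ne'
    -- The inverse mean in the effective kernel is exactly what the limit weight `n₀` cancels.
    have heff : ∀ x y, n₀ * (Coefficient.product lam mu).effective x y = M * M := fun x y => by
      rw [Coefficient.effective, ← hn₀, ← hM, mul_inv_cancel_left₀ hn₀0, sq]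
    have hker : ∀ ε x y, (Coefficient.product lam mu).weight ε x *
        (Coefficient.product lam mu).kernel ε x y = mu (ε⁻¹ • x) * mu (ε⁻¹ • y) := fun ε x y => by
      have := (hl0 (ε⁻¹ • x)).ne'
      simp only [Coefficient.weight, Coefficient.kernel]
      rw [← mul_assoc, div_mul_cancel₀ _ this]
    have hmean : ∫ w in ZSpan.fundamentalDomain ((stdBasis d).prod (stdBasis d)),
        mu w.1 * mu w.2 = M * M := by
      rw [setIntegral_fundamentalDomain_prod hpm
        fun w => habs _ (hmul _ _ (hmb w.1) (hmb w.2))]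
      simp only [integral_mul_const, integral_const_mul, ← hM]
    refine homogenization_of_weakStar (c := γ⁻¹ * γ⁻¹) (C := γ * γ) (n₀ := n₀) hα hp hm
      (mul_pos hγi hγi) (fun ε hε => hν.aestronglyMeasurable_diag (ne_of_gt hε)) (fun ε hε => ?_)
      ?_ (fun ε x => hνb _) hn₀b (fun ε x y => ?_) (fun x y => ?_) (fun h hh => ?_)
      (fun h hh => ?_) hf
    · simp only [hker]
      exact ha.aestronglyMeasurable_diag (ne_of_gt hε)
    · simp only [heff]
      exact aestronglyMeasurable_const
    · rw [hker]
      exact hmul _ _ (hmb _) (hmb _)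
    · rw [heff]
      exact hmul _ _ hMb hMb
    · have := hν.tendsto_integral volume_fundamentalDomain hh
      rwa [setIntegral_congr_set fundamentalDomain_ae_eq_unitCube] at this
    · have := ha.tendsto_integral volume_fundamentalDomain_prod hh
      simp only [hmean] at this
      simp only [hker, heff]
      exact this
  | locallyPeriodic Λ =>
    obtain ⟨hc, hme, hξ, hη, -, hb⟩ := hK
    have habs : ∀ x y ξ η, |Λ x y ξ η| ≤ γ := fun x y ξ η => by
      rw [abs_of_pos (hγi.trans_le (hb x y ξ η).1)]; exact (hb x y ξ η).2
    have ha := isOscillating_pair hc hme hξ hη habs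
    have hmean : ∀ x y, ∫ w in ZSpan.fundamentalDomain ((stdBasis d).prod (stdBasis d)),
        Λ x y w.1 w.2 = (Coefficient.locallyPeriodic Λ).effective x y := fun x y =>
      setIntegral_fundamentalDomain_prod (hme x y) fun w => habs x y w.1 w.2
    have hker : ∀ ε x y, (Coefficient.locallyPeriodic Λ).weight ε x *
        (Coefficient.locallyPeriodic Λ).kernel ε x y = Λ x y (ε⁻¹ • x) (ε⁻¹ • y) :=
      fun ε x y => one_mul _
    have heffb : ∀ x y, γ⁻¹ ≤ (Coefficient.locallyPeriodic Λ).effective x y ∧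
        (Coefficient.locallyPeriodic Λ).effective x y ≤ γ := fun x y => by
      have : IsProbabilityMeasure ((volume : Measure (Rd d × Rd d)).restrict
          (ZSpan.fundamentalDomain ((stdBasis d).prod (stdBasis d)))) :=
        ⟨by simp [volume_fundamentalDomain_prod]⟩
      have hi : Integrable (fun w : Rd d × Rd d => Λ x y w.1 w.2) (volume.restrict
          (ZSpan.fundamentalDomain ((stdBasis d).prod (stdBasis d)))) :=
        Integrable.of_bound (hme x y).aestronglyMeasurable.restrict γ
          (.of_forall fun w => habs x y w.1 w.2)
      have h1 := integral_mono (integrable_const γ⁻¹) hi fun w => (hb x y w.1 w.2).1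
      have h2 := integral_mono hi (integrable_const γ) fun w => (hb x y w.1 w.2).2
      rw [← hmean]
      simpa using And.intro h1 h2
    refine homogenization_of_weakStar (c := γ⁻¹) (C := γ) (n₀ := 1) hα hp hm hγi
      (fun ε hε => aestronglyMeasurable_const) (fun ε hε => ?_) ?_
      (fun ε x => ⟨hγi1, hγ.le⟩) ⟨hγi1, hγ.le⟩ (fun ε x y => ?_) (fun x y => ?_) (fun h hh => ?_)
      (fun h hh => ?_) hf
    · simp only [hker]
      exact ha.aestronglyMeasurable_diag (ne_of_gt hε)
    · simp only [one_mul, ← hmean]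
      exact ha.aestronglyMeasurable_mean _
    · rw [hker]
      exact hb _ _ _ _
    · rw [one_mul]
      exact heffb x y
    -- The weight is identically `1 = n₀`, so there is no error to estimate.
    · simp [Coefficient.weight]
    · simp only [hker, one_mul, ← hmean]
      exact ha.tendsto_integral volume_fundamentalDomain_prod hh
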